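/- Conventions. A \emph{metric} on a finite-dimensional real Lie algebra is a nondegenerate symmetric bilinear form of any signature; on a Lie group with that Lie algebra it determines a left-invariant pseudo-Riemannian metric, whose Levi-Civita connection and Ricci operator $\mathrm{Ric}$ are computed on the Lie algebra. The metric is \emph{Einstein} if $\mathrm{Ric}=\lambda\,\mathrm{id}$ for some $\lambda\in\mathbb R$. A nilpotent Lie algebra with a metric is a \emph{nilsoliton} if $\mathrm{Ric}=\lambda\,\mathrm{id}+D$ for some $\lambda\in\mathbb R$ and some derivation $D$. A basis $e_1,\dots,e_n$ with dual basis $e^1,\dots,e^n$ is \emph{nice} if every $[e_i,e_j]$ is a multiple of a basis element and every $e_i\lrcorner\,de^k$ is a multiple of some $e^j$; it is \emph{orthonormal} if $\langle e_i,e_j\rangle=\pm\delta_{ij}$. A metric Lie algebra is a \emph{pseudo-Iwasawa Einstein extension} of $\mathfrak n$ if it is Einstein and is an orthogonal direct sum $\mathfrak n\rtimes\mathfrak a$ with $\mathfrak n$ a nilpotent ideal, $\mathfrak a\neq 0$ an abelian subalgebra, and $\mathrm{ad}\,X$ symmetric with respect to the metric for all $X\in\mathfrak a$. In the table below, a Lie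 algebra $\mathfrak g$ with basis $e_1,\dots,e_n$ is given by $(de^1,\dots,de^n)$, where $de^k(x,y)=-e^k([x,y])$ and $e^{ij}=e^i\wedge e^j$; the derivation $D$ is given as $(\lambda_1,\dots,\lambda_n)+\sum a\,e^i\otimes e_j$, i.e. $\mathrm{diag}(\lambda_1,\dots,\lambda_n)$ plus the maps sending $e_i$ to $a\,e_j$ and the other basis vectors to $0$. A signature is given by the string of indices $i$ with $\langle e_i,e_i\rangle=-1$; the basis is orthonormal, with $\langle e_i,e_i\rangle=1$ for the other indices. 1. $(0,0,\frac47e^{12})$, $D=(\frac67,-\frac27,\frac47)+\frac87e^1\otimes e_2$; signatures $13, 23$. 2. $(0,0,0)$, $D=(1,-\frac15,\frac25)+\frac65e^1\otimes e_2$; signatures $1,13,2,23$. 3. $(0,0,\frac{14}{51}\sqrt3e^{12},\frac7{51}\sqrt{34}e^{13})$, $D=(\frac{28}{51},-\frac7{17},\frac7{51},\frac{35}{51})+\frac7{51}\sqrt{66}e^1\otimes e_2$; signatures $13,234$. 4. $(0,0,0,\frac2{17}\sqrt{22}e^{12})$, $D=(\frac{15}{17},-\frac7{17},\frac6{17},\frac8{17})+\frac{22}{17}e^1\otimes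 e_2$; signatures $134,14,234,24$. 5. $(0,0,0,\frac13\sqrt6e^{12})$, $D=(0,0,1,0)+\frac23\sqrt3e^3\otimes e_4$; signatures $123,14,3$. 6. $(0,0,0,\frac13\sqrt6e^{12})$, $D=(\frac23,0,-\frac13,\frac23)+\frac23\sqrt3e^1\otimes e_3$; signatures $12,14,234,3$. 7. $(0,0,0,\frac29\sqrt6e^{12})$, $D=(\frac13,-\frac13,\frac23,0)+\frac23e^1\otimes e_2+\frac49\sqrt3e^3\otimes e_4$; signatures $14,24$. 8. $(0,0,0,0)$, $D=(1,-\frac13,\frac13,\frac13)+\frac43e^1\otimes e_2$; signatures $1,13,134,2,23,234$. 9. $(0,0,0,0)$, $D=(\frac35,\frac35,-\frac15,-\frac15)+\frac45e^1\otimes e_3+\frac45e^2\otimes e_4$; signatures $12,14,34$. Statement. Let $(\mathfrak g,D)$ be a row of the table, let $g$ be the metric on $\mathfrak g$ of one of its listed signatures, and let $\tilde{\mathfrak g}=\mathfrak g\rtimes_D\mathbb R e_0$ (with $[e_0,v]=Dv$ for $v\in\mathfrak g$) carry the metric $\tilde g=g+e^0\otimes e^0$. Then $\tilde g$ is Einstein.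 Moreover, let $G$ be a Lie group with Lie algebra $\tilde{\mathfrak g}$ and the left-invariant metric determined by $\tilde g$, and let $G'$ be a Lie group with a left-invariant metric whose metric Lie algebra is a pseudo-Iwasawa Einstein extension of a nilsoliton $\mathfrak n$ that admits a nice orthonormal basis. Then $G$ and $G'$ are not isometric, even up to rescaling: there are no diffeomorphism $\varphi\colon G\to G'$ and constant $c\neq0$ with $\varphi^*\langle\cdot,\cdot\rangle_{G'}=c\,\langle\cdot,\cdot\rangle_G$. -/

import Mathlib

open scoped Manifold ContDiff Matrix

set_option linter.unnecessarySeqFocus false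

noncomputable section

namespace EinsteinSolv

/-! ### Metrics on Lie algebras and their curvature -/

/-- A metric on a real vector space: a nondegenerate symmetric bilinear form, of any signature. -/
structure LieMetric (L : Type*) [AddCommGroup L] [Module ℝ L] where
  form : LinearMap.BilinForm ℝ L
  symm : ∀ x y, form x y = form y x
  nondegenerate : form.Nondegenerate

namespace LieMetric

variable {L : Type*} [LieRing L] [LieAlgebra ℝ L] [FiniteDimensional ℝ L]

/-- The right-hand side of the Koszul formula for left-invariant vector fields, as a function of
the third field: `½ (g([x,y],z) - g([y,z],x) + g([z,x],y))`. -/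
def koszul (g : LieMetric L) (x y : L) : Module.Dual ℝ L where
  toFun z := (1 / 2 : ℝ) * (g.form ⁅x, y⁆ z - g.form ⁅y, z⁆ x + g.form ⁅z, x⁆ y)
  map_add' z w := by
    simp only [lie_add, add_lie, map_add, LinearMap.add_apply]; ring
  map_smul' c z := by
    simp only [lie_smul, smul_lie, map_smul, LinearMap.smul_apply, smul_eq_mul, RingHom.id_apply]
    ring

/-- The Levi-Civita connection `∇ x y = ∇_x y` on left-invariant vector fields, as determined by
the Koszul formula. -/
def leviCivita (g : LieMetric L) : L →ₗ[ℝ] L →ₗ[ℝ] L :=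
  LinearMap.mk₂ ℝ (fun x y => (g.form.toDual g.nondegenerate).symm (g.koszul x y))
    (fun x x' y => by
      rw [← map_add]; congr 1; ext z
      simp only [koszul, lie_add, add_lie, map_add, LinearMap.add_apply, LinearMap.coe_mk,
        AddHom.coe_mk]; ring)
    (fun c x y => by
      rw [← map_smul]; congr 1; ext z
      simp only [koszul, lie_smul, smul_lie, map_smul, LinearMap.smul_apply, smul_eq_mul,
        LinearMap.coe_mk, AddHom.coe_mk]; ring)
    (fun x y y' => by
      rw [← map_add]; congr 1; ext z
      simp only [koszul, lie_add, add_lie, map_add, LinearMap.add_apply, LinearMap.coe_mk,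
        AddHom.coe_mk]; ring)
    (fun c x y => by
      rw [← map_smul]; congr 1; ext z
      simp only [koszul, lie_smul, smul_lie, map_smul, LinearMap.smul_apply, smul_eq_mul,
        LinearMap.coe_mk, AddHom.coe_mk]; ring)

theorem form_leviCivita (g : LieMetric L) (x y z : L) :
    g.form (g.leviCivita x y) z =
      (1 / 2 : ℝ) * (g.form ⁅x, y⁆ z - g.form ⁅y, z⁆ x + g.form ⁅z, x⁆ y) := by
  rw [← LinearMap.BilinForm.toDual_def g.nondegenerate]
  simp [leviCivita, koszul]

/-- The curvature `R(x,y)z = ∇_x ∇_y z - ∇_y ∇_x z - ∇_[x,y] z`. -/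
def curvature (g : LieMetric L) (x y z : L) : L :=
  g.leviCivita x (g.leviCivita y z) - g.leviCivita y (g.leviCivita x z) - g.leviCivita ⁅x, y⁆ z

/-- The endomorphism `x ↦ R(x,y)z`. -/
def curvatureEnd (g : LieMetric L) (y z : L) : L →ₗ[ℝ] L where
  toFun x := g.curvature x y z
  map_add' x x' := by
    simp only [curvature, add_lie, map_add, LinearMap.add_apply]; abel
  map_smul' c x := by
    simp only [curvature, smul_lie, map_smul, LinearMap.smul_apply, RingHom.id_apply, smul_sub]

/-- The Ricci tensor `ric(y,z) = Tr (x ↦ R(x,y)z)`. -/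
def ricciForm (g : LieMetric L) : LinearMap.BilinForm ℝ L :=
  LinearMap.mk₂ ℝ (fun y z => LinearMap.trace ℝ L (g.curvatureEnd y z))
    (fun y y' z => by
      rw [← map_add]; congr 1; ext x
      simp only [curvatureEnd, curvature, lie_add, map_add, LinearMap.add_apply, LinearMap.coe_mk,
        AddHom.coe_mk]; abel)
    (fun c y z => by
      rw [← map_smul]; congr 1; ext x
      simp only [curvatureEnd, curvature, lie_smul, map_smul, LinearMap.smul_apply,
        LinearMap.coe_mk, AddHom.coe_mk, smul_sub])
    (fun y z z' => by
      rw [← map_add]; congr 1; ext x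
      simp only [curvatureEnd, curvature, map_add, LinearMap.add_apply, LinearMap.coe_mk,
        AddHom.coe_mk]; abel)
    (fun c y z => by
      rw [← map_smul]; congr 1; ext x
      simp only [curvatureEnd, curvature, map_smul, LinearMap.smul_apply,
        LinearMap.coe_mk, AddHom.coe_mk, smul_sub])

/-- The Ricci operator, `g(Ric x, y) = ric(x,y)`. -/
def ricci (g : LieMetric L) : L →ₗ[ℝ] L :=
  (g.form.toDual g.nondegenerate).symm.toLinearMap ∘ₗ g.ricciForm

theorem form_ricci (g : LieMetric L) (x y : L) : g.form (g.ricci x) y = g.ricciForm x y := by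
  rw [← LinearMap.BilinForm.toDual_def g.nondegenerate]
  simp [ricci]

/-- The Einstein condition `Ric = λ id`. -/
def IsEinstein (g : LieMetric L) : Prop :=
  ∃ lam : ℝ, ∀ x, g.ricci x = lam • x

/-- The nilsoliton equation `Ric = λ id + D` with `D` a derivation (on a nilpotent Lie algebra). -/
def IsNilsoliton (g : LieMetric L) : Prop :=
  LieRing.IsNilpotent L ∧
    ∃ (lam : ℝ) (D : LieDerivation ℝ L L), ∀ x, g.ricci x = lam • x + D x

end LieMetric

/-! ### Nice bases -/

/-- A basis `e` is nice if each `[e_i, e_j]` is a multiple of a basis element and each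
`e_i ⌟ de^k`, i.e. each functional `x ↦ e^k([e_i, x])` up to sign, is a multiple of an element of
the dual basis. -/
def IsNiceBasis {L : Type*} [LieRing L] [LieAlgebra ℝ L] {m : ℕ}
    (e : Module.Basis (Fin m) ℝ L) : Prop :=
  (∀ i j, ∃ (k : Fin m) (c : ℝ), ⁅e i, e j⁆ = c • e k) ∧
  (∀ i k, ∃ (j : Fin m) (c : ℝ), ∀ x, e.coord k ⁅e i, x⁆ = c * e.coord j x)

/-- Orthonormality in arbitrary signature: `g(e_i, e_j) = ± δ_ij`. -/
def IsOrthonormalBasis {L : Type*} [AddCommGroup L] [Module ℝ L] {m : ℕ} (g : LieMetric L)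
    (e : Module.Basis (Fin m) ℝ L) : Prop :=
  (∀ i j, i ≠ j → g.form (e i) (e j) = 0) ∧
  (∀ i, g.form (e i) (e i) = 1 ∨ g.form (e i) (e i) = -1)

/-! ### Pseudo-Iwasawa extensions of nilsolitons -/

section PseudoIwasawa

variable {L : Type*} [LieRing L] [LieAlgebra ℝ L]

/-- `L = 𝔫 ⋊ 𝔞` is a standard decomposition of pseudo-Iwasawa type: `𝔫` is a nilpotent ideal, `𝔞`
an abelian subalgebra, the decomposition is orthogonal, and `ad X` is symmetric for all
`X ∈ 𝔞`. -/
structure IsPseudoIwasawaDecomposition (g : LieMetric L) (n : LieIdeal ℝ L)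
    (a : LieSubalgebra ℝ L) : Prop where
  nilpotent : LieRing.IsNilpotent n
  abelian : ∀ X ∈ a, ∀ Y ∈ a, ⁅X, Y⁆ = 0
  isCompl : IsCompl n.toSubmodule a.toSubmodule
  orthogonal : ∀ x ∈ n, ∀ X ∈ a, g.form x X = 0
  symmetric : ∀ X ∈ a, ∀ y z, g.form ⁅X, y⁆ z = g.form y ⁅X, z⁆

/-- The metric Lie algebra `(L, g)` is Einstein and is obtained as a pseudo-Iwasawa extension
`𝔫 ⋊ 𝔞`, `𝔞 ≠ 0`, of a nilsoliton `𝔫` admitting a nice orthonormal basis. -/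
def IsEinsteinPseudoIwasawaOverNice [FiniteDimensional ℝ L] (g : LieMetric L) : Prop :=
  g.IsEinstein ∧
  ∃ (n : LieIdeal ℝ L) (a : LieSubalgebra ℝ L),
    IsPseudoIwasawaDecomposition g n a ∧ a ≠ ⊥ ∧
    ∃ gn : LieMetric n, (∀ x y : n, gn.form x y = g.form (x : L) (y : L)) ∧
      gn.IsNilsoliton ∧
      ∃ (m : ℕ) (e : Module.Basis (Fin m) ℝ n), IsNiceBasis e ∧ IsOrthonormalBasis gn e

end PseudoIwasawa

/-! ### Left-invariant metrics on Lie groups and isometries up to rescaling -/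

instance : ENat.LEInfty (minSmoothness ℝ 3) :=
  ⟨by rw [minSmoothness_of_isRCLikeNormedField]; exact ENat.LEInfty.out⟩

section Manifold

variable {m : ℕ} {G : Type*} [TopologicalSpace G] [ChartedSpace (EuclideanSpace ℝ (Fin m)) G]
variable {m' : ℕ} {G' : Type*} [TopologicalSpace G'] [ChartedSpace (EuclideanSpace ℝ (Fin m')) G']

/-- A field of bilinear forms on the tangent spaces of a manifold. -/
abbrev MetricField (m : ℕ) (G : Type*) [TopologicalSpace G]
    [ChartedSpace (EuclideanSpace ℝ (Fin m)) G] : Type _ :=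
  ∀ p : G, LinearMap.BilinForm ℝ (TangentSpace (𝓡 m) p)

/-- All left translations are isometries. -/
def IsLeftInvariant [Group G] (γ : MetricField m G) : Prop :=
  ∀ (h p : G) (u v : TangentSpace (𝓡 m) p),
    γ (h * p) (mfderiv (𝓡 m) (𝓡 m) (fun q : G => h * q) p u)
      (mfderiv (𝓡 m) (𝓡 m) (fun q : G => h * q) p v) = γ p u v

/-- `γ` is a left-invariant metric on the Lie group `G`, whose Lie algebra, endowed with the
value of `γ` at the identity, is the metric Lie algebra `(L, g)`. -/
def IsLeftInvariantMetricOf [Group G] [LieGroup (𝓡 m) ∞ G]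
    {L : Type*} [LieRing L] [LieAlgebra ℝ L] (γ : MetricField m G) (g : LieMetric L) : Prop :=
  IsLeftInvariant γ ∧
  ∃ f : GroupLieAlgebra (𝓡 m) G ≃ₗ⁅ℝ⁆ L,
    ∀ u v : GroupLieAlgebra (𝓡 m) G, γ 1 u v = g.form (f u) (f v)

/-- Some diffeomorphism `φ` satisfies `φ^* γ' = c γ` for a nonzero constant `c`. -/
def IsometricUpToRescaling (γ : MetricField m G) (γ' : MetricField m' G') : Prop :=
  ∃ (c : ℝ) (φ : Diffeomorph (𝓡 m) (𝓡 m') G G' ∞), c ≠ 0 ∧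
    ∀ (p : G) (u v : TangentSpace (𝓡 m) p),
      γ' (φ p) (mfderiv (𝓡 m) (𝓡 m') φ p u) (mfderiv (𝓡 m) (𝓡 m') φ p v) = c * γ p u v

end Manifold

/-! ### The extensions `𝔤 ⋊_D ℝ` -/

/-- The bracket on `ℝⁿ` determined by the differentials of the dual basis,
`de^k = ∑ d k i j e^i ∧ e^j`, via `de^k(x, y) = - e^k([x, y])`. -/
def bracketOf {n : ℕ} (d : Fin n → Matrix (Fin n) (Fin n) ℝ) (x y : Fin n → ℝ) : Fin n → ℝ :=
  fun k => -∑ i, ∑ j, d k i j * (x i * y j - x j * y i)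

/-- A Lie algebra structure on `ℝⁿ`, with a derivation `D` (acting on column vectors) and a list
of signatures; a signature is the set of indices, counted from `1`, of the timelike vectors of the
standard basis. -/
structure TableRow where
  n : ℕ
  d : Fin n → Matrix (Fin n) (Fin n) ℝ
  jacobi : ∀ x y z, bracketOf d x (bracketOf d y z) =
    bracketOf d (bracketOf d x y) z + bracketOf d y (bracketOf d x z)
  D : Matrix (Fin n) (Fin n) ℝ
  leibniz : ∀ x y, D *ᵥ bracketOf d x y = bracketOf d (D *ᵥ x) y + bracketOf d x (D *ᵥ y)
  signatures : Finset (Finset ℕ)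

namespace TableRow

/-- The Lie algebra `𝔤` of a row. -/
def Alg (r : TableRow) : Type := Fin r.n → ℝ

variable (r : TableRow)

instance : AddCommGroup r.Alg := inferInstanceAs (AddCommGroup (Fin r.n → ℝ))
instance : Module ℝ r.Alg := inferInstanceAs (Module ℝ (Fin r.n → ℝ))
instance : FiniteDimensional ℝ r.Alg := inferInstanceAs (FiniteDimensional ℝ (Fin r.n → ℝ))

instance : LieRing r.Alg where
  bracket x y := bracketOf r.d x y
  add_lie x y z := by
    funext k
    change bracketOf r.d (fun i => x i + y i) z k = bracketOf r.d x z k + bracketOf r.d y z k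
    simp only [bracketOf, ← neg_add, ← Finset.sum_add_distrib]
    refine congrArg Neg.neg (Finset.sum_congr rfl fun i _ => Finset.sum_congr rfl fun j _ => ?_)
    ring
  lie_add x y z := by
    funext k
    change bracketOf r.d x (fun i => y i + z i) k = bracketOf r.d x y k + bracketOf r.d x z k
    simp only [bracketOf, ← neg_add, ← Finset.sum_add_distrib]
    refine congrArg Neg.neg (Finset.sum_congr rfl fun i _ => Finset.sum_congr rfl fun j _ => ?_)
    ring
  lie_self x := by
    funext k
    change bracketOf r.d x x k = 0
    simp only [bracketOf, neg_eq_zero]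
    refine Finset.sum_eq_zero fun i _ => Finset.sum_eq_zero fun j _ => ?_
    ring
  leibniz_lie x y z := r.jacobi x y z

instance : LieAlgebra ℝ r.Alg where
  lie_smul c x y := by
    funext k
    change bracketOf r.d x (fun i => c * y i) k = c * bracketOf r.d x y k
    simp only [bracketOf, mul_neg, Finset.mul_sum]
    refine congrArg Neg.neg (Finset.sum_congr rfl fun i _ => Finset.sum_congr rfl fun j _ => ?_)
    ring

/-- The derivation `D` of `𝔤`. -/
def der : LieDerivation ℝ r.Alg r.Alg where
  toFun x := r.D *ᵥ x
  map_add' x y := Matrix.mulVec_add r.D x y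
  map_smul' c x := Matrix.mulVec_smul r.D c x
  leibniz' x y := by
    let Dx : r.Alg := r.D *ᵥ x
    let Dy : r.Alg := r.D *ᵥ y
    change (r.D *ᵥ bracketOf r.d x y : r.Alg) = ⁅x, Dy⁆ - ⁅y, Dx⁆
    rw [← lie_skew y Dx, sub_neg_eq_add, add_comm]
    exact r.leibniz x y

/- The bracket `st - ts = 0` on `ℝ`. -/
attribute [local instance 100] LieRing.ofAssociativeRing

/-- The action `t ↦ t D` of the abelian Lie algebra `ℝ` on `𝔤`. -/
def action : ℝ →ₗ⁅ℝ⁆ LieDerivation ℝ r.Alg r.Alg where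
  toFun t := t • r.der
  map_add' s t := add_smul s t _
  map_smul' s t := mul_smul s t _
  map_lie' {s t} := by
    simp [Ring.lie_def, mul_comm]

/-- The semidirect product `𝔤 ⋊_D ℝ`, in which `[e₀, v] = D v` for `v ∈ 𝔤`. -/
abbrev Ext : Type := LieAlgebra.SemiDirectSum r.Alg ℝ r.action

instance : FiniteDimensional ℝ r.Ext :=
  LinearEquiv.finiteDimensional (LieAlgebra.SemiDirectSum.toProdl r.action).symm

/-- `g(e_i, e_i)`: equal to `-1` for the indices in `S` (counted from `1`), to `1` otherwise. -/
def sign (S : Finset ℕ) (i : Fin r.n) : ℝ := if (i : ℕ) + 1 ∈ S then -1 else 1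

/-- The metric `g + e⁰ ⊗ e⁰` on `𝔤 ⋊_D ℝ`, with `g` the diagonal metric of signature `S`. -/
def metric (S : Finset ℕ) : LieMetric r.Ext where
  form := LinearMap.mk₂ ℝ
    (fun x y => (∑ i, r.sign S i * (x.left i * y.left i)) + x.right * y.right)
    (fun x x' y => by
      change (∑ i, r.sign S i * ((x.left i + x'.left i) * y.left i))
        + (x.right + x'.right) * y.right = _
      simp only [add_mul, mul_add, Finset.sum_add_distrib]; ring)
    (fun c x y => by
      change (∑ i, r.sign S i * ((c * x.left i) * y.left i)) + (c * x.right) * y.right = _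
      simp only [smul_eq_mul, mul_add, Finset.mul_sum]
      refine congrArg₂ (· + ·) (Finset.sum_congr rfl fun i _ => ?_) ?_ <;> ring)
    (fun x y y' => by
      change (∑ i, r.sign S i * (x.left i * (y.left i + y'.left i)))
        + x.right * (y.right + y'.right) = _
      simp only [mul_add, Finset.sum_add_distrib]; ring)
    (fun c x y => by
      change (∑ i, r.sign S i * (x.left i * (c * y.left i))) + x.right * (c * y.right) = _
      simp only [smul_eq_mul, mul_add, Finset.mul_sum]
      refine congrArg₂ (· + ·) (Finset.sum_congr rfl fun i _ => ?_) ?_ <;> ring)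
  symm x y := by
    simp only [LinearMap.mk₂_apply, mul_comm]
  nondegenerate := by
    have key : ∀ x : r.Ext, (∑ i, r.sign S i * (x.left i * (r.sign S i * x.left i)))
        + x.right * x.right = 0 → x = 0 := by
      intro x hx
      have hs : ∀ i, r.sign S i * (x.left i * (r.sign S i * x.left i)) = x.left i ^ 2 := by
        intro i
        unfold sign
        split_ifs <;> ring
      simp only [hs] at hx
      have h0 : 0 ≤ ∑ i, x.left i ^ 2 := Finset.sum_nonneg fun i _ => sq_nonneg _
      have h1 : x.right = 0 := by nlinarith [mul_self_nonneg x.right]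
      have h2 : ∑ i, x.left i ^ 2 = 0 := by nlinarith [mul_self_nonneg x.right]
      have h3 : x.left = 0 := by
        funext i
        have := (Finset.sum_eq_zero_iff_of_nonneg fun i _ => sq_nonneg (x.left i)).1 h2 i
          (Finset.mem_univ i)
        exact pow_eq_zero_iff (two_ne_zero) |>.1 this
      exact LieAlgebra.SemiDirectSum.ext h3 h1
    refine ⟨fun x hx => key x (hx ⟨fun i => r.sign S i * x.left i, x.right⟩), fun x hx => key x ?_⟩
    have := hx ⟨fun i => r.sign S i * x.left i, x.right⟩
    simp only [LinearMap.mk₂_apply] at this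
    rw [← this]
    refine congrArg₂ (· + ·) (Finset.sum_congr rfl fun i _ => ?_) rfl
    ring

end TableRow

/-! ### Computation rules for the bracket and the derivation -/

theorem sum_single {n : ℕ} (a b : Fin n) (c : ℝ) (x y : Fin n → ℝ) :
    ∑ i, ∑ j, Matrix.single a b c i j * (x i * y j - x j * y i) = c * (x a * y b - x b * y a) := by
  rw [Finset.sum_eq_single a, Finset.sum_eq_single b]
  · simp
  · intro j _ hj; simp [Matrix.single_apply_of_col_ne _ _ hj.symm]
  · simp
  · intro i _ hi
    exact Finset.sum_eq_zero fun j _ => by simp [Matrix.single_apply_of_row_ne hi.symm]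
  · simp

theorem neg_sum_zero {n : ℕ} (x y : Fin n → ℝ) :
    -∑ i, ∑ j, (0 : Matrix (Fin n) (Fin n) ℝ) i j * (x i * y j - x j * y i) = 0 := by
  simp only [Matrix.zero_apply, zero_mul, Finset.sum_const_zero, neg_zero]

theorem bracketOf_three (p : ℝ) (x y : Fin 3 → ℝ) :
    bracketOf ![0, 0, Matrix.single 0 1 p] x y = ![0, 0, -(p * (x 0 * y 1 - x 1 * y 0))] := by
  funext k
  fin_cases k
  · exact neg_sum_zero x y
  · exact neg_sum_zero x y
  · exact congrArg Neg.neg (sum_single 0 1 p x y)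

theorem bracketOf_four (p q : ℝ) (x y : Fin 4 → ℝ) :
    bracketOf ![0, 0, Matrix.single 0 1 p, Matrix.single 0 2 q] x y =
      ![0, 0, -(p * (x 0 * y 1 - x 1 * y 0)), -(q * (x 0 * y 2 - x 2 * y 0))] := by
  funext k
  fin_cases k
  · exact neg_sum_zero x y
  · exact neg_sum_zero x y
  · exact congrArg Neg.neg (sum_single 0 1 p x y)
  · exact congrArg Neg.neg (sum_single 0 2 q x y)

theorem bracketOf_four_single (p : ℝ) (x y : Fin 4 → ℝ) :
    bracketOf ![0, 0, 0, Matrix.single 0 1 p] x y =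
      ![0, 0, 0, -(p * (x 0 * y 1 - x 1 * y 0))] := by
  funext k
  fin_cases k
  · exact neg_sum_zero x y
  · exact neg_sum_zero x y
  · exact neg_sum_zero x y
  · exact congrArg Neg.neg (sum_single 0 1 p x y)

theorem bracketOf_zero {n : ℕ} (x y : Fin n → ℝ) :
    bracketOf (0 : Fin n → Matrix (Fin n) (Fin n) ℝ) x y = 0 := by
  funext k
  exact neg_sum_zero x y

theorem mulVec_one {n : ℕ} (v : Fin n → ℝ) (a b : Fin n) (c : ℝ) (x : Fin n → ℝ) (i : Fin n) :
    ((Matrix.diagonal v + Matrix.single a b c) *ᵥ x) i =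
      v i * x i + if i = a then c * x b else 0 := by
  rw [Matrix.add_mulVec, Pi.add_apply, Matrix.mulVec_diagonal]
  congr 1
  rw [Matrix.single_mulVec]
  simp [Function.update_apply]

theorem mulVec_two {n : ℕ} (v : Fin n → ℝ) (a b a' b' : Fin n) (c c' : ℝ) (x : Fin n → ℝ)
    (i : Fin n) :
    ((Matrix.diagonal v + Matrix.single a b c + Matrix.single a' b' c') *ᵥ x) i =
      v i * x i + (if i = a then c * x b else 0) + if i = a' then c' * x b' else 0 := by
  rw [Matrix.add_mulVec, Pi.add_apply, mulVec_one]
  congr 1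
  rw [Matrix.single_mulVec]
  simp [Function.update_apply]

/-! ### The solutions of the generalized nilsoliton equation with `n = 3, 4` -/

/-- `(0, 0, 4/7 e¹²)`, `D = (6/7, -2/7, 4/7) + 8/7 e¹ ⊗ e₂`. -/
def row31 : TableRow where
  n := 3
  d := ![0, 0, Matrix.single 0 1 (4 / 7)]
  jacobi x y z := by
    simp only [bracketOf_three]
    funext k
    fin_cases k <;> simp
  D := Matrix.diagonal ![6 / 7, -2 / 7, 4 / 7] + Matrix.single 1 0 (8 / 7)
  leibniz x y := by
    simp only [bracketOf_three]
    funext k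
    fin_cases k <;> simp [mulVec_one] <;> ring
  signatures := {{1, 3}, {2, 3}}

/-- `(0, 0, 0)`, `D = (1, -1/5, 2/5) + 6/5 e¹ ⊗ e₂`. -/
def row3 : TableRow where
  n := 3
  d := 0
  jacobi x y z := by
    simp only [bracketOf_zero, add_zero]
  D := Matrix.diagonal ![1, -1 / 5, 2 / 5] + Matrix.single 1 0 (6 / 5)
  leibniz x y := by
    simp only [bracketOf_zero, Matrix.mulVec_zero, add_zero]
  signatures := {{1}, {1, 3}, {2}, {2, 3}}

/-- `(0, 0, 14/51 √3 e¹², 7/51 √34 e¹³)`,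
`D = (28/51, -7/17, 7/51, 35/51) + 7/51 √66 e¹ ⊗ e₂`. -/
def row421 : TableRow where
  n := 4
  d := ![0, 0, Matrix.single 0 1 (14 / 51 * √3), Matrix.single 0 2 (7 / 51 * √34)]
  jacobi x y z := by
    simp only [bracketOf_four]
    funext k
    fin_cases k <;> simp <;> ring
  D := Matrix.diagonal ![28 / 51, -7 / 17, 7 / 51, 35 / 51] + Matrix.single 1 0 (7 / 51 * √66)
  leibniz x y := by
    simp only [bracketOf_four]
    funext k
    fin_cases k <;> simp [mulVec_one] <;> ring
  signatures := {{1, 3}, {2, 3, 4}}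

/-- `(0, 0, 0, 2/17 √22 e¹²)`, `D = (15/17, -7/17, 6/17, 8/17) + 22/17 e¹ ⊗ e₂`. -/
def row41a : TableRow where
  n := 4
  d := ![0, 0, 0, Matrix.single 0 1 (2 / 17 * √22)]
  jacobi x y z := by
    simp only [bracketOf_four_single]
    funext k
    fin_cases k <;> simp
  D := Matrix.diagonal ![15 / 17, -7 / 17, 6 / 17, 8 / 17] + Matrix.single 1 0 (22 / 17)
  leibniz x y := by
    simp only [bracketOf_four_single]
    funext k
    fin_cases k <;> simp [mulVec_one] <;> ring
  signatures := {{1, 3, 4}, {1, 4}, {2, 3, 4}, {2, 4}}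

/-- `(0, 0, 0, 1/3 √6 e¹²)`, `D = (0, 0, 1, 0) + 2/3 √3 e³ ⊗ e₄`. -/
def row41b : TableRow where
  n := 4
  d := ![0, 0, 0, Matrix.single 0 1 (1 / 3 * √6)]
  jacobi x y z := by
    simp only [bracketOf_four_single]
    funext k
    fin_cases k <;> simp
  D := Matrix.diagonal ![0, 0, 1, 0] + Matrix.single 3 2 (2 / 3 * √3)
  leibniz x y := by
    simp only [bracketOf_four_single]
    funext k
    fin_cases k <;> simp [mulVec_one]
  signatures := {{1, 2, 3}, {1, 4}, {3}}

/-- `(0, 0, 0, 1/3 √6 e¹²)`, `D = (2/3, 0, -1/3, 2/3) + 2/3 √3 e¹ ⊗ e₃`. -/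
def row41c : TableRow where
  n := 4
  d := ![0, 0, 0, Matrix.single 0 1 (1 / 3 * √6)]
  jacobi x y z := by
    simp only [bracketOf_four_single]
    funext k
    fin_cases k <;> simp
  D := Matrix.diagonal ![2 / 3, 0, -1 / 3, 2 / 3] + Matrix.single 2 0 (2 / 3 * √3)
  leibniz x y := by
    simp only [bracketOf_four_single]
    funext k
    fin_cases k <;> simp [mulVec_one] <;> ring
  signatures := {{1, 2}, {1, 4}, {2, 3, 4}, {3}}

/-- `(0, 0, 0, 2/9 √6 e¹²)`, `D = (1/3, -1/3, 2/3, 0) + 2/3 e¹ ⊗ e₂ + 4/9 √3 e³ ⊗ e₄`. -/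
def row41d : TableRow where
  n := 4
  d := ![0, 0, 0, Matrix.single 0 1 (2 / 9 * √6)]
  jacobi x y z := by
    simp only [bracketOf_four_single]
    funext k
    fin_cases k <;> simp
  D := Matrix.diagonal ![1 / 3, -1 / 3, 2 / 3, 0] + Matrix.single 1 0 (2 / 3) + Matrix.single 3 2 (4 / 9 * √3)
  leibniz x y := by
    simp only [bracketOf_four_single]
    funext k
    fin_cases k <;> simp [mulVec_two] <;> ring
  signatures := {{1, 4}, {2, 4}}

/-- `(0, 0, 0, 0)`, `D = (1, -1/3, 1/3, 1/3) + 4/3 e¹ ⊗ e₂`. -/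
def row4a : TableRow where
  n := 4
  d := 0
  jacobi x y z := by
    simp only [bracketOf_zero, add_zero]
  D := Matrix.diagonal ![1, -1 / 3, 1 / 3, 1 / 3] + Matrix.single 1 0 (4 / 3)
  leibniz x y := by
    simp only [bracketOf_zero, Matrix.mulVec_zero, add_zero]
  signatures := {{1}, {1, 3}, {1, 3, 4}, {2}, {2, 3}, {2, 3, 4}}

/-- `(0, 0, 0, 0)`, `D = (3/5, 3/5, -1/5, -1/5) + 4/5 e¹ ⊗ e₃ + 4/5 e² ⊗ e₄`. -/
def row4b : TableRow where
  n := 4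
  d := 0
  jacobi x y z := by
    simp only [bracketOf_zero, add_zero]
  D := Matrix.diagonal ![3 / 5, 3 / 5, -1 / 5, -1 / 5] + Matrix.single 2 0 (4 / 5) + Matrix.single 3 1 (4 / 5)
  leibniz x y := by
    simp only [bracketOf_zero, Matrix.mulVec_zero, add_zero]
  signatures := {{1, 2}, {1, 4}, {3, 4}}

/-- The table of solutions with `n = 3, 4`. -/
def table : List TableRow :=
  [row31, row3, row421, row41a, row41b, row41c, row41d, row4a, row4b]


end EinsteinSolv

end

open EinsteinSolv

/-! Reduction to algebra. Multiplying a metric by a constant does not change its Levi-Civita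
connection, so an isometry up to rescaling preserves the curvature tensor of type (1,3). Read in
left-invariant coframes at one point, this gives a linear isomorphism A of Lie algebras with
A(R(x,y)z) = R'(Ax,Ay)Az (`exists_linearEquiv_curvature`). A need not respect brackets, so the two
sides must be separated by curvature alone. The Ricci form is a trace of R, hence is preserved
exactly; on an Einstein space with nonzero constant it is a multiple of the metric and replaces it
as a scale-free metric. Comparing R(x,y)z with ric(y,z)x − ric(x,z)y gives the curvature operator on
bivectors an intrinsic spectrum, encoded by `eigenbivectors`; constant curvature in dimension n+1
corresponds to κ = 1/n.

The invariant is `HasGenericCurvature`: nonzero Ricci form, nonconstant curvature, every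
decomposable bivector in the kernel of the curvature operator spans a degenerate plane, and certain
eigenspaces are small. Every row of the table has it: after rescaling the basis the structure
constants are integers, the curvature is an integer array, and the eigenvalue conditions are linear
systems settled by fraction-free elimination.

A pseudo-Iwasawa Einstein extension of a nilsoliton with a nice orthonormal basis never has it in
dimensions 4 and 5 (`not_hasGenericCurvature`). The complement 𝔞 is flat and nondegenerate, so the
condition on decomposable kernel bivectors forces dim 𝔞 = 1. The ideal then has dimension 3 or 4,
and its nice basis is, up to order, [e₁,e₂] = a e₃, together with [e₁,e₃] = d e₄ in dimension 4. The
Einstein equation makes ad X diagonal and determines its eigenvalues up to scale: equal in the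
abelian case (constant curvature), (1,1,2) for Heisenberg (two independent kernel bivectors),
(2,2,4,3) for Heisenberg plus a line (two eigenbivectors for 2/11), (1,2,3,4) for the filiform
algebra (an eigenbivector for 4/15). Each case contradicts one clause of generic curvature
(`HasGenericCurvature.false_of_stdThree`, `HasGenericCurvature.false_of_stdFour`). -/

/-! ### Coframes with values in a metric algebra, in Euclidean space -/

namespace EinsteinSolv

open Filter Topology

section Coframe

variable {E K K' : Type*} [NormedAddCommGroup E] [NormedSpace ℝ E]
  [NormedAddCommGroup K] [NormedSpace ℝ K] [NormedAddCommGroup K'] [NormedSpace ℝ K']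

/-- The curvature of a constant-coefficient torsion-free connection `N`. -/
noncomputable def constCurvature {K : Type*} [AddCommGroup K] (N : K → K → K) (x y z : K) : K :=
  N x (N y z) - N y (N x z) - N (N x y - N y x) z

/-- The Maurer-Cartan equation at a point, for the bracket `N x y - N y x`. -/
noncomputable def MaurerCartanAt (θ : E → E →L[ℝ] K) (N : K →L[ℝ] K →L[ℝ] K) (x : E) : Prop :=
  ∀ u v, fderiv ℝ θ x u v - fderiv ℝ θ x v u = -(N (θ x u) (θ x v) - N (θ x v) (θ x u))

/-- The Christoffel symbols of the connection with coefficients `N` in the coframe `θ`. -/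
noncomputable def christoffel (θ : E → E →L[ℝ] K) (N : K →L[ℝ] K →L[ℝ] K) (x u v : E) : E :=
  (θ x).inverse (fderiv ℝ θ x u v + N (θ x u) (θ x v))

/-- The curvature of a connection on `E` given by its Christoffel symbols. -/
noncomputable def chartCurvature (Γ : E → E → E → E) (x u v w : E) : E :=
  fderiv ℝ (fun y => Γ y v w) x u - fderiv ℝ (fun y => Γ y u w) x v
    + Γ x u (Γ x v w) - Γ x v (Γ x u w)

theorem apply_christoffel {θ : E → E →L[ℝ] K} {N : K →L[ℝ] K →L[ℝ] K} {x : E}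
    (hi : (θ x).IsInvertible) (u v : E) :
    θ x (christoffel θ N x u v) = fderiv ℝ θ x u v + N (θ x u) (θ x v) :=
  hi.self_apply_inverse _

/-- The connection is torsion-free: by Maurer–Cartan the antisymmetric part of dθ cancels that of N.
-/
theorem christoffel_comm {θ : E → E →L[ℝ] K} {N : K →L[ℝ] K →L[ℝ] K} {x : E}
    (hmc : MaurerCartanAt θ N x) (u v : E) :
    christoffel θ N x u v = christoffel θ N x v u := by
  unfold christoffel
  congr 1
  have h := hmc u v
  have : fderiv ℝ θ x u v + N (θ x u) (θ x v) - (fderiv ℝ θ x v u + N (θ x v) (θ x u)) = 0 := by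
    rw [add_sub_add_comm, h]; abel
  exact sub_eq_zero.1 this

/-- The connection is metric: N is skew for q, so the N-terms added to dθ in the Christoffel symbols
contribute nothing. -/
theorem fderiv_form_coframe {θ : E → E →L[ℝ] K} {N : K →L[ℝ] K →L[ℝ] K} {x : E}
    (hi : (θ x).IsInvertible) (hθ : DifferentiableAt ℝ θ x) (q : K →L[ℝ] K →L[ℝ] ℝ)
    (hq : ∀ a b c, q (N a b) c + q b (N a c) = 0) (u v w : E) :
    fderiv ℝ (fun y => q (θ y v) (θ y w)) x u =
      q (θ x (christoffel θ N x u v)) (θ x w) + q (θ x v) (θ x (christoffel θ N x u w)) := by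
  have h1 : ∀ v, HasFDerivAt (fun y => θ y v) ((fderiv ℝ θ x).flip v) x := fun v => by
    have := hθ.hasFDerivAt.clm_apply (hasFDerivAt_const v x)
    convert! this using 1
    ext; simp
  have h2 := q.hasFDerivAt_of_bilinear (h1 v) (h1 w)
  rw [h2.fderiv, apply_christoffel hi, apply_christoffel hi]
  have := hq (θ x u) (θ x v) (θ x w)
  simp
  linarith

omit [NormedSpace ℝ E] in
/-- Uniqueness of the torsion-free metric connection. -/
theorem bilinear_eq_of_symm_of_metric {G : E → E → ℝ} (hadd : ∀ a b c, G (a - b) c = G a c - G b c)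
    (hsymm : ∀ a b, G a b = G b a) (hnd : ∀ a, (∀ b, G a b = 0) → a = 0)
    {A B : E → E → E} (hA : ∀ u v, A u v = A v u) (hB : ∀ u v, B u v = B v u)
    (h : ∀ u v w, G (A u v) w + G v (A u w) = G (B u v) w + G v (B u w)) (u v : E) :
    A u v = B u v := by
  refine sub_eq_zero.1 (hnd _ fun w => ?_)
  rw [hadd]
  have e1 := h u v w
  have e2 := h v w u
  have e3 := h w u v
  rw [hsymm v, hsymm v] at e1
  rw [hsymm w, hsymm w, hA v w, hB v w, hA v u, hB v u] at e2
  rw [hsymm u, hsymm u, hA w u, hB w u] at e3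
  linarith

/-- The coframe trivialises the connection to constant coefficients. Differentiating θ(Γ(v,w)) =
dθ(·)(v)(w) + N(θv,θw) expresses θ(dΓ) through second derivatives of θ, which cancel by symmetry,
and first derivatives, whose antisymmetric part is given by Maurer–Cartan. -/
theorem apply_chartCurvature {θ : E → E →L[ℝ] K} {N : K →L[ℝ] K →L[ℝ] K} {x : E}
    [CompleteSpace E]
    (hi : ∀ᶠ y in 𝓝 x, (θ y).IsInvertible) (hθ : ContDiffAt ℝ 2 θ x)
    (hmc : MaurerCartanAt θ N x) (u v w : E) :
    θ x (chartCurvature (christoffel θ N) x u v w) =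
      constCurvature (fun a b => N a b) (θ x u) (θ x v) (θ x w) := by
  have hix := hi.self_of_nhds
  have hd : DifferentiableAt ℝ θ x := hθ.differentiableAt (by norm_num)
  have hd2 : DifferentiableAt ℝ (fderiv ℝ θ) x :=
    (hθ.fderiv_right (m := 1) (by norm_num)).differentiableAt (by norm_num)
  have hinv : DifferentiableAt ℝ (fun y => (θ y).inverse) x := by
    obtain ⟨e, he⟩ := hix
    have : DifferentiableAt ℝ ContinuousLinearMap.inverse (θ x) := by
      rw [← he]
      exact (contDiffAt_map_inverse (n := 1) e).differentiableAt (by norm_num)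
    exact this.comp x hd
  have h1 : ∀ v, HasFDerivAt (fun y => θ y v) ((fderiv ℝ θ x).flip v) x := fun v => by
    have := hd.hasFDerivAt.clm_apply (hasFDerivAt_const v x)
    convert! this using 1
    ext; simp
  have h2 : ∀ v w, HasFDerivAt (fun y => fderiv ℝ θ y v w)
      (((fderiv ℝ (fderiv ℝ θ) x).flip v).flip w) x := fun v w => by
    have := (hd2.hasFDerivAt.clm_apply (hasFDerivAt_const v x)).clm_apply (hasFDerivAt_const w x)
    convert! this using 1
    ext; simp
  have h3 : ∀ v w, HasFDerivAt (fun y => fderiv ℝ θ y v w + N (θ y v) (θ y w)) _ x :=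
    fun v w => (h2 v w).add (N.hasFDerivAt_of_bilinear (h1 v) (h1 w))
  have hΓ : ∀ v w, DifferentiableAt ℝ (fun y => christoffel θ N y v w) x := fun v w =>
    hinv.clm_apply (h3 v w).differentiableAt
  have key : ∀ u v w, θ x (fderiv ℝ (fun y => christoffel θ N y v w) x u) =
      fderiv ℝ (fderiv ℝ θ) x u v w + N (fderiv ℝ θ x u v) (θ x w) + N (θ x v) (fderiv ℝ θ x u w)
        - fderiv ℝ θ x u (christoffel θ N x v w) := by
    intro u v w
    have e1 : HasFDerivAt (fun y => θ y (christoffel θ N y v w)) _ x :=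
      hd.hasFDerivAt.clm_apply (hΓ v w).hasFDerivAt
    have e2 : (fun y => θ y (christoffel θ N y v w)) =ᶠ[𝓝 x]
        fun y => fderiv ℝ θ y v w + N (θ y v) (θ y w) := by
      filter_upwards [hi] with y hy using apply_christoffel hy v w
    have e3 := (e1.congr_of_eventuallyEq e2.symm).unique (h3 v w)
    have e4 := DFunLike.congr_fun e3 u
    simp at e4
    rw [eq_sub_iff_add_eq, e4]
    abel
  have hsymm : fderiv ℝ (fderiv ℝ θ) x u v = fderiv ℝ (fderiv ℝ θ) x v u := by
    have := hθ.isSymmSndFDerivAt (by simp)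
    exact this u v
  have hm := hmc u v
  unfold chartCurvature constCurvature
  simp only [map_add, map_sub, key, apply_christoffel hix, hsymm]
  have hN : N (fderiv ℝ θ x u v) (θ x w) - N (fderiv ℝ θ x v u) (θ x w) =
      -(N (N (θ x u) (θ x v)) (θ x w) - N (N (θ x v) (θ x u)) (θ x w)) := by
    rw [← sub_apply, ← map_sub, hm]
    simp
  simp only [sub_apply]
  rw [sub_eq_iff_eq_add] at hN
  rw [hN]
  abel

/-- Two coframes whose metrics are proportional have the same curvature. -/
theorem constCurvature_comp_coframe [CompleteSpace E] {θ : E → E →L[ℝ] K} {θ' : E → E →L[ℝ] K'}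
    {N : K →L[ℝ] K →L[ℝ] K} {N' : K' →L[ℝ] K' →L[ℝ] K'} {x₀ : E}
    (hi : ∀ᶠ x in 𝓝 x₀, (θ x).IsInvertible) (hi' : ∀ᶠ x in 𝓝 x₀, (θ' x).IsInvertible)
    (hθ : ∀ᶠ x in 𝓝 x₀, ContDiffAt ℝ 2 θ x) (hθ' : ∀ᶠ x in 𝓝 x₀, ContDiffAt ℝ 2 θ' x)
    (hmc : ∀ᶠ x in 𝓝 x₀, MaurerCartanAt θ N x) (hmc' : ∀ᶠ x in 𝓝 x₀, MaurerCartanAt θ' N' x)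
    {q : K →L[ℝ] K →L[ℝ] ℝ} {q' : K' →L[ℝ] K' →L[ℝ] ℝ}
    (hq : ∀ a b c, q (N a b) c + q b (N a c) = 0) (hq' : ∀ a b c, q' (N' a b) c + q' b (N' a c) = 0)
    (hsymm : ∀ a b, q a b = q b a) (hnd : ∀ a, (∀ b, q a b = 0) → a = 0)
    {c : ℝ} (hc : c ≠ 0)
    (hqq : ∀ᶠ x in 𝓝 x₀, ∀ u v, q' (θ' x u) (θ' x v) = c * q (θ x u) (θ x v)) (u v w : K) :
    θ' x₀ ((θ x₀).inverse (constCurvature (fun a b => N a b) u v w)) =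
      constCurvature (fun a b => N' a b) (θ' x₀ ((θ x₀).inverse u)) (θ' x₀ ((θ x₀).inverse v))
        (θ' x₀ ((θ x₀).inverse w)) := by
  -- Both families of Christoffel symbols are torsion-free and metric for q(θ·,θ·): the second one
  -- is metric for c times this form, and the constant c can be cancelled. Uniqueness of the
  -- Levi-Civita connection identifies them near x₀, so their derivatives, and hence their
  -- curvatures, agree at x₀.
  have hΓ : ∀ᶠ x in 𝓝 x₀, christoffel θ N x = christoffel θ' N' x := by
    filter_upwards [hi, hi', hθ, hθ', hmc, hmc', hqq.eventually_nhds] with x i1 i2 d1 d2 m1 m2 hx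
    funext u v
    refine bilinear_eq_of_symm_of_metric (G := fun a b => q (θ x a) (θ x b)) (by simp)
      (fun a b => hsymm _ _) (fun a ha => ?_) (christoffel_comm m1) (christoffel_comm m2)
      (fun u v w => ?_) u v
    · refine i1.injective ?_
      rw [map_zero]
      refine hnd _ fun b => ?_
      rw [← i1.self_apply_inverse b]
      exact ha _
    · have e1 := fderiv_form_coframe i1 (d1.differentiableAt (by norm_num)) q hq u v w
      have e2 := fderiv_form_coframe i2 (d2.differentiableAt (by norm_num)) q' hq' u v w
      have e3 : (fun y => q' (θ' y v) (θ' y w)) =ᶠ[𝓝 x] fun y => c * q (θ y v) (θ y w) := by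
        filter_upwards [hx] with y hy using hy v w
      have hd : DifferentiableAt ℝ (fun y => q (θ y v) (θ y w)) x := by
        have h := d1.differentiableAt (show (2 : WithTop ℕ∞) ≠ 0 by norm_num)
        exact (q.differentiableAt.comp x (h.clm_apply (differentiableAt_const v))).clm_apply
          (h.clm_apply (differentiableAt_const w))
      rw [e3.fderiv_eq, fderiv_const_mul hd] at e2
      simp only [smul_apply, smul_eq_mul] at e2
      rw [e1, hx.self_of_nhds, hx.self_of_nhds, ← mul_add] at e2
      exact mul_left_cancel₀ hc e2
  have hR : ∀ u v w, chartCurvature (christoffel θ N) x₀ u v w =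
      chartCurvature (christoffel θ' N') x₀ u v w := by
    intro u v w
    have h : ∀ v w, (fun y => christoffel θ N y v w) =ᶠ[𝓝 x₀] fun y => christoffel θ' N' y v w := by
      intro v w
      filter_upwards [hΓ] with y hy
      rw [hy]
    unfold chartCurvature
    rw [(h v w).fderiv_eq, (h u w).fderiv_eq, hΓ.self_of_nhds]
  have i1 := hi.self_of_nhds
  have e1 := apply_chartCurvature hi hθ.self_of_nhds hmc.self_of_nhds
    ((θ x₀).inverse u) ((θ x₀).inverse v) ((θ x₀).inverse w)
  have e2 := apply_chartCurvature hi' hθ'.self_of_nhds hmc'.self_of_nhds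
    ((θ x₀).inverse u) ((θ x₀).inverse v) ((θ x₀).inverse w)
  rw [← e2, ← hR]
  simp only [i1.self_apply_inverse] at e1
  rw [← e1, i1.inverse_apply_self]

end Coframe

end EinsteinSolv

/-! ### The coframe of left-invariant forms -/

namespace EinsteinSolv

open Filter Topology VectorField

section LieGroup

variable {E : Type*} [NormedAddCommGroup E] [NormedSpace ℝ E] [CompleteSpace E]
variable {m : ℕ} {G : Type*} [TopologicalSpace G] [ChartedSpace (EuclideanSpace ℝ (Fin m)) G]
  [Group G] [LieGroup (𝓡 m) ∞ G]

/-- The frame on an open subset of `E` obtained by pulling back left-invariant vector fields. -/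
noncomputable def pulledFrame (F : E → G) (x : E) : EuclideanSpace ℝ (Fin m) →L[ℝ] E :=
  (mfderiv 𝓘(ℝ, E) (𝓡 m) F x).inverse.comp (mfderiv (𝓡 m) (𝓡 m) (fun q : G => F x * q) 1)

theorem isInvertible_mfderiv_mul_left (g h : G) :
    (mfderiv (𝓡 m) (𝓡 m) (fun q : G => g * q) h).IsInvertible := by
  have H : ∀ h p : G, MDifferentiableAt (𝓡 m) (𝓡 m) (fun q : G => h * q) p := fun h p =>
    (contMDiff_mul_left (I := 𝓡 m) (n := ∞) (a := h)).contMDiffAt.mdifferentiableAt (by simp)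
  have A : mfderiv (𝓡 m) (𝓡 m) ((fun x : G => g⁻¹ * x) ∘ (fun x => g * x)) h =
      ContinuousLinearMap.id _ _ := by
    have : (fun x : G => g⁻¹ * x) ∘ (fun x => g * x) = id := by ext x; simp
    rw [this, id_eq, mfderiv_id]
  rw [mfderiv_comp (I' := 𝓡 m) _ (H _ _) (H _ _)] at A
  have A' : mfderiv (𝓡 m) (𝓡 m) ((fun x : G => g * x) ∘ (fun x => g⁻¹ * x)) (g * h) =
      ContinuousLinearMap.id _ _ := by
    have : (fun x : G => g * x) ∘ (fun x => g⁻¹ * x) = id := by ext x; simp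
    rw [this, id_eq, mfderiv_id]
  rw [mfderiv_comp (I' := 𝓡 m) _ (H _ _) (H _ _), inv_mul_cancel_left g h] at A'
  exact ContinuousLinearMap.IsInvertible.of_inverse A' A

variable (m G) in
/-- The Lie bracket of a Lie group, on the model space. -/
noncomputable def leftBracket (v w : EuclideanSpace ℝ (Fin m)) : EuclideanSpace ℝ (Fin m) :=
  @Bracket.bracket (GroupLieAlgebra (𝓡 m) G) (GroupLieAlgebra (𝓡 m) G) _ v w

omit [CompleteSpace E] in
theorem isInvertible_pulledFrame {F : E → G} {x : E}
    (hi : (mfderiv 𝓘(ℝ, E) (𝓡 m) F x).IsInvertible) : (pulledFrame (m := m) F x).IsInvertible :=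
  hi.inverse.comp (isInvertible_mfderiv_mul_left _ _)

theorem contDiffAt_pulledFrame {F : E → G} {U : Set E} (hU : IsOpen U)
    (hF : ∀ x ∈ U, ContMDiffAt 𝓘(ℝ, E) (𝓡 m) ∞ F x)
    (hi : ∀ x ∈ U, (mfderiv 𝓘(ℝ, E) (𝓡 m) F x).IsInvertible) {x : E} (hx : x ∈ U) :
    ContDiffAt ℝ 2 (pulledFrame (m := m) F) x := by
  refine ContDiffOn.contDiffAt (s := U) ?_ (hU.mem_nhds hx)
  rw [contDiffOn_clm_apply]
  intro v y hy
  refine ContDiffAt.contDiffWithinAt ?_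
  have h := contMDiffAt_mulInvariantVectorField (I := 𝓡 m) (v : GroupLieAlgebra (𝓡 m) G) (g := F y)
  have := ContMDiffAt.mpullback_vectorField_preimage (n := ∞) (h.of_le (m := 2) (by simp))
    (hF y hy) (hi y hy) (by norm_cast)
  exact contMDiffAt_vectorSpace_iff_contDiffAt.1 this

/-- Brackets of vector fields are natural under pullback by a local diffeomorphism, and
left-invariant fields close under the bracket. -/
theorem lieBracket_pulledFrame {F : E → G} {x : E}
    (hF : ContMDiffAt 𝓘(ℝ, E) (𝓡 m) ∞ F x) (v w : GroupLieAlgebra (𝓡 m) G) :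
    lieBracket ℝ (fun y => pulledFrame F y v) (fun y => pulledFrame F y w) x =
      pulledFrame F x (leftBracket m G v w) := by
  have h1 := mpullback_mlieBracket (n := ∞) (I := 𝓘(ℝ, E)) (f := F) (x₀ := x)
    (mdifferentiableAt_mulInvariantVectorField (I := 𝓡 m) v)
    (mdifferentiableAt_mulInvariantVectorField (I := 𝓡 m) w) hF
    (by rw [minSmoothness_of_isRCLikeNormedField]; exact ENat.LEInfty.out)
  have h2 := mulInvariantVector_mlieBracket (I := 𝓡 m) v w
  rw [← mlieBracketWithin_univ (I := 𝓘(ℝ, E)), mlieBracketWithin_eq_lieBracketWithin, ← h2] at h1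
  have h3 := congrFun (lieBracketWithin_univ (𝕜 := ℝ) (V := fun y => pulledFrame F y v)
    (W := fun y => pulledFrame F y w)) x
  exact (h1.trans h3).symm

/-- The left-invariant coframe. -/
noncomputable def pulledCoframe (F : E → G) (x : E) : E →L[ℝ] EuclideanSpace ℝ (Fin m) :=
  (pulledFrame F x).inverse

theorem contDiffAt_pulledCoframe {F : E → G} {U : Set E} (hU : IsOpen U)
    (hF : ∀ x ∈ U, ContMDiffAt 𝓘(ℝ, E) (𝓡 m) ∞ F x)
    (hi : ∀ x ∈ U, (mfderiv 𝓘(ℝ, E) (𝓡 m) F x).IsInvertible) {x : E} (hx : x ∈ U) :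
    ContDiffAt ℝ 2 (pulledCoframe (m := m) F) x :=
  ((isInvertible_pulledFrame (hi x hx)).contDiffAt_map_inverse).comp x
    (contDiffAt_pulledFrame hU hF hi hx)

-- Identifies the coframe with the pullback by F of the Maurer–Cartan form of G.
omit [CompleteSpace E] in
theorem mulInvariantVectorField_pulledCoframe {F : E → G} {x : E}
    (hi : (mfderiv 𝓘(ℝ, E) (𝓡 m) F x).IsInvertible) (u : E) :
    mulInvariantVectorField (I := 𝓡 m) (pulledCoframe F x u : GroupLieAlgebra (𝓡 m) G) (F x) =
      mfderiv 𝓘(ℝ, E) (𝓡 m) F x u := by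
  have h := (isInvertible_pulledFrame hi).self_apply_inverse u
  have h2 : (mfderiv 𝓘(ℝ, E) (𝓡 m) F x).inverse
    (mulInvariantVectorField (I := 𝓡 m) (pulledCoframe F x u : GroupLieAlgebra (𝓡 m) G) (F x)) = u
    := h
  exact hi.inverse_apply_eq.1 h2

/-- The Maurer–Cartan equation. Differentiating θ(V_a) = a, with V_a a frame field, trades
derivatives of θ for derivatives of the frame; antisymmetrising produces θ of a bracket of frame
fields. -/
theorem fderiv_pulledCoframe_sub {F : E → G} {U : Set E} (hU : IsOpen U)
    (hF : ∀ x ∈ U, ContMDiffAt 𝓘(ℝ, E) (𝓡 m) ∞ F x)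
    (hi : ∀ x ∈ U, (mfderiv 𝓘(ℝ, E) (𝓡 m) F x).IsInvertible) {x : E} (hx : x ∈ U) (u v : E) :
    fderiv ℝ (pulledCoframe F) x u v - fderiv ℝ (pulledCoframe F) x v u =
      -leftBracket m G (pulledCoframe F x u) (pulledCoframe F x v) := by
  have hinv : ∀ y ∈ U, (pulledFrame (m := m) F y).IsInvertible := fun y hy =>
    isInvertible_pulledFrame (hi y hy)
  have hθ := (contDiffAt_pulledCoframe hU hF hi hx).differentiableAt (by norm_num)
  have hV := (contDiffAt_pulledFrame hU hF hi hx).differentiableAt (by norm_num)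
  have key : ∀ (a : EuclideanSpace ℝ (Fin m)) (u : E),
      fderiv ℝ (pulledCoframe (m := m) F) x u (pulledFrame F x a) =
        - pulledCoframe F x (fderiv ℝ (fun y => pulledFrame F y a) x u) := by
    intro a u
    have hVa : DifferentiableAt ℝ (fun y => pulledFrame (m := m) F y a) x :=
      hV.clm_apply (differentiableAt_const a)
    have e1 := hθ.hasFDerivAt.clm_apply hVa.hasFDerivAt
    have e2 : (fun y => pulledCoframe (m := m) F y (pulledFrame F y a)) =ᶠ[𝓝 x] fun _ => a := by
      filter_upwards [hU.mem_nhds hx] with y hy using (hinv y hy).inverse_apply_self a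
    have e3 := (e1.congr_of_eventuallyEq e2.symm).unique (hasFDerivAt_const a x)
    have e4 := DFunLike.congr_fun e3 u
    simp at e4
    rw [← add_eq_zero_iff_eq_neg, ← e4]
    abel
  have hu : pulledFrame (m := m) F x (pulledCoframe F x u) = u := (hinv x hx).self_apply_inverse u
  have hv : pulledFrame (m := m) F x (pulledCoframe F x v) = v := (hinv x hx).self_apply_inverse v
  have k1 := key (pulledCoframe F x v) u
  have k2 := key (pulledCoframe F x u) v
  have hb := lieBracket_pulledFrame (hF x hx) (pulledCoframe F x u) (pulledCoframe F x v)
  simp only [lieBracket, hu, hv] at k1 k2 hb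
  rw [k1, k2]
  have := congrArg (pulledCoframe (m := m) F x) hb
  rw [map_sub] at this
  have h3 : ∀ a, pulledCoframe (m := m) F x (pulledFrame F x a) = a :=
    (hinv x hx).inverse_apply_self
  rw [h3] at this
  rw [← this]
  abel

end LieGroup

/-! ### The Levi-Civita product of a metric Lie algebra as a constant-coefficient connection. -/

namespace LieMetric

variable {L : Type*} [LieRing L] [LieAlgebra ℝ L] [FiniteDimensional ℝ L]

omit [FiniteDimensional ℝ L] in
theorem ext_form (g : LieMetric L) {x y : L} (h : ∀ z, g.form x z = g.form y z) : x = y := by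
  refine sub_eq_zero.1 (g.nondegenerate.1 _ fun z => ?_)
  rw [map_sub, LinearMap.sub_apply, h, sub_self]

theorem leviCivita_sub (g : LieMetric L) (x y : L) :
    g.leviCivita x y - g.leviCivita y x = ⁅x, y⁆ := by
  refine g.ext_form fun z => ?_
  rw [map_sub, LinearMap.sub_apply, form_leviCivita, form_leviCivita, ← lie_skew y x,
    ← lie_skew x z, ← lie_skew z y]
  simp only [map_neg, LinearMap.neg_apply]
  ring

theorem form_leviCivita_add (g : LieMetric L) (x y z : L) :
    g.form (g.leviCivita x y) z + g.form y (g.leviCivita x z) = 0 := by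
  rw [g.symm y, form_leviCivita, form_leviCivita, ← lie_skew x z, ← lie_skew y x, ← lie_skew z y]
  simp only [map_neg, LinearMap.neg_apply]
  ring

theorem curvature_eq_constCurvature (g : LieMetric L) (x y z : L) :
    g.curvature x y z = constCurvature (fun a b => g.leviCivita a b) x y z := by
  rw [curvature, constCurvature, leviCivita_sub]

end LieMetric

/-! ### Isometries up to rescaling preserve the curvature tensor of the metric Lie algebras. -/

section Isometry

variable {m : ℕ} {G : Type*} [TopologicalSpace G] [ChartedSpace (EuclideanSpace ℝ (Fin m)) G]
  [Group G] [LieGroup (𝓡 m) ∞ G]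
variable {L : Type*} [LieRing L] [LieAlgebra ℝ L] [FiniteDimensional ℝ L]

omit [LieGroup (𝓡 m) ∞ G] in
theorem IsLeftInvariant.apply_mulInvariantVectorField {γ : MetricField m G}
    (hγ : IsLeftInvariant γ) (h : G) (v w : GroupLieAlgebra (𝓡 m) G) :
    γ h (mulInvariantVectorField v h) (mulInvariantVectorField w h) = γ 1 v w := by
  have key : ∀ (p : G) (_ : p = h) (a b : EuclideanSpace ℝ (Fin m)), γ p a b = γ h a b := by
    rintro _ rfl a b
    rfl
  exact (key _ (mul_one h) _ _).symm.trans (hγ h 1 v w)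

/-- The pulled-back coframe of a left-invariant metric, with its Levi-Civita connection. -/
theorem IsLeftInvariantMetricOf.exists_coframe {γ : MetricField m G} {g : LieMetric L}
    (hγ : IsLeftInvariantMetricOf γ g) :
    ∃ (f : EuclideanSpace ℝ (Fin m) ≃ₗ[ℝ] L)
      (N : EuclideanSpace ℝ (Fin m) →L[ℝ] EuclideanSpace ℝ (Fin m) →L[ℝ] EuclideanSpace ℝ (Fin m))
      (q : EuclideanSpace ℝ (Fin m) →L[ℝ] EuclideanSpace ℝ (Fin m) →L[ℝ] ℝ),
      (∀ a b, f (N a b) = g.leviCivita (f a) (f b)) ∧ (∀ a b, q a b = g.form (f a) (f b)) ∧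
      (∀ a b, N a b - N b a = leftBracket m G a b) ∧ ∀ a b, γ 1 a b = q a b := by
  obtain ⟨_, φ, hφ⟩ := hγ
  let f : EuclideanSpace ℝ (Fin m) ≃ₗ[ℝ] L := φ.toLinearEquiv
  have hf : ∀ a b, f (leftBracket m G a b) = ⁅f a, f b⁆ := fun a b => φ.map_lie a b
  let N₀ : EuclideanSpace ℝ (Fin m) →ₗ[ℝ] EuclideanSpace ℝ (Fin m) →ₗ[ℝ]
      EuclideanSpace ℝ (Fin m) :=
    (g.leviCivita.compl₁₂ f.toLinearMap f.toLinearMap).compr₂ f.symm.toLinearMap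
  let q₀ : EuclideanSpace ℝ (Fin m) →ₗ[ℝ] EuclideanSpace ℝ (Fin m) →ₗ[ℝ] ℝ :=
    g.form.compl₁₂ f.toLinearMap f.toLinearMap
  refine ⟨f, (LinearMap.toContinuousLinearMap.toLinearMap ∘ₗ N₀).toContinuousLinearMap,
    (LinearMap.toContinuousLinearMap.toLinearMap ∘ₗ q₀).toContinuousLinearMap, fun a b => ?_,
    fun a b => rfl, fun a b => ?_, fun a b => hφ a b⟩
  · exact f.apply_symm_apply _
  · refine f.injective ?_
    rw [map_sub, hf, ← g.leviCivita_sub]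
    exact congrArg₂ (· - ·) (f.apply_symm_apply _) (f.apply_symm_apply _)

variable {m' : ℕ} {G' : Type*} [TopologicalSpace G']
  [ChartedSpace (EuclideanSpace ℝ (Fin m')) G'] [Group G'] [LieGroup (𝓡 m') ∞ G']
variable {L' : Type*} [LieRing L'] [LieAlgebra ℝ L'] [FiniteDimensional ℝ L']

/-- An isometry up to rescaling between left-invariant metrics identifies their curvatures. -/
theorem exists_linearEquiv_curvature {γ : MetricField m G} {g : LieMetric L}
    (hγ : IsLeftInvariantMetricOf γ g) {γ' : MetricField m' G'} {g' : LieMetric L'}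
    (hγ' : IsLeftInvariantMetricOf γ' g') (h : IsometricUpToRescaling γ γ') :
    ∃ A : L ≃ₗ[ℝ] L', ∀ x y z, A (g.curvature x y z) = g'.curvature (A x) (A y) (A z) := by
  obtain ⟨c, φ, hc, hφ⟩ := h
  obtain ⟨f, N, q, hN, hq, hb, hγq⟩ := hγ.exists_coframe
  obtain ⟨f', N', q', hN', hq', hb', hγq'⟩ := hγ'.exists_coframe
  -- F is the inverse of the chart at the identity and F' = φ ∘ F, so both coframes live on the same
  -- open set U. There is no need for φ to fix the identity, since left translations absorb φ(1).
  let F : EuclideanSpace ℝ (Fin m) → G := (extChartAt (𝓡 m) (1 : G)).symm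
  let U : Set (EuclideanSpace ℝ (Fin m)) := (extChartAt (𝓡 m) (1 : G)).target
  let F' : EuclideanSpace ℝ (Fin m) → G' := φ ∘ F
  let x₀ : EuclideanSpace ℝ (Fin m) := extChartAt (𝓡 m) (1 : G) 1
  have hU : IsOpen U := isOpen_extChartAt_target 1
  have hx₀ : x₀ ∈ U := mem_extChartAt_target 1
  have hmem : ∀ᶠ x in 𝓝 x₀, x ∈ U := hU.mem_nhds hx₀
  have hF : ∀ x ∈ U, ContMDiffAt 𝓘(ℝ, EuclideanSpace ℝ (Fin m)) (𝓡 m) ∞ F x := fun x hx =>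
    (contMDiffOn_extChartAt_symm (I := 𝓡 m) (n := ∞) (1 : G)).contMDiffAt (hU.mem_nhds hx)
  have hi : ∀ x ∈ U, (mfderiv 𝓘(ℝ, EuclideanSpace ℝ (Fin m)) (𝓡 m) F x).IsInvertible := by
    intro x hx
    have := isInvertible_mfderivWithin_extChartAt_symm (I := 𝓡 m) hx
    rwa [ModelWithCorners.range_eq_univ, mfderivWithin_univ] at this
  have hφF : ∀ x ∈ U, mfderiv 𝓘(ℝ, EuclideanSpace ℝ (Fin m)) (𝓡 m') F' x =
      (mfderiv (𝓡 m) (𝓡 m') φ (F x)).comp (mfderiv 𝓘(ℝ, EuclideanSpace ℝ (Fin m)) (𝓡 m) F x) :=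
    fun x hx => mfderiv_comp x (φ.contMDiff.mdifferentiable (by simp) _)
      ((hF x hx).mdifferentiableAt (by simp))
  have hF' : ∀ x ∈ U, ContMDiffAt 𝓘(ℝ, EuclideanSpace ℝ (Fin m)) (𝓡 m') ∞ F' x := fun x hx =>
    φ.contMDiff.contMDiffAt.comp x (hF x hx)
  have hi' : ∀ x ∈ U, (mfderiv 𝓘(ℝ, EuclideanSpace ℝ (Fin m)) (𝓡 m') F' x).IsInvertible := by
    intro x hx
    rw [hφF x hx]
    exact ContinuousLinearMap.IsInvertible.comp
      ⟨φ.mfderivToContinuousLinearEquiv (by simp) (F x), rfl⟩ (hi x hx)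
  have key := constCurvature_comp_coframe (x₀ := x₀) (θ := pulledCoframe F)
    (θ' := pulledCoframe F') (N := N) (N' := N') (q := q) (q' := q')
    (hmem.mono fun x hx => (isInvertible_pulledFrame (hi x hx)).inverse)
    (hmem.mono fun x hx => (isInvertible_pulledFrame (hi' x hx)).inverse)
    (hmem.mono fun x hx => contDiffAt_pulledCoframe hU hF hi hx)
    (hmem.mono fun x hx => contDiffAt_pulledCoframe hU hF' hi' hx)
    (hmem.mono fun x hx u v => by rw [fderiv_pulledCoframe_sub hU hF hi hx, hb])
    (hmem.mono fun x hx u v => by rw [fderiv_pulledCoframe_sub hU hF' hi' hx, hb'])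
    (fun a b c => by rw [hq, hq, hN, hN, g.form_leviCivita_add])
    (fun a b c => by rw [hq', hq', hN', hN', g'.form_leviCivita_add])
    (fun a b => by rw [hq, hq, g.symm])
    (fun a ha => by
      refine f.injective ?_
      rw [map_zero]
      refine g.nondegenerate.1 _ fun z => ?_
      rw [← f.apply_symm_apply z, ← hq, ha])
    -- Left invariance evaluates both metrics at the identity on the coframe values, so the relation
    -- between γ' and γ becomes a relation between the constant forms q' and q.
    hc (hmem.mono fun x hx u v => by
      have e1 := hφ (F x) (mfderiv 𝓘(ℝ, EuclideanSpace ℝ (Fin m)) (𝓡 m) F x u)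
        (mfderiv 𝓘(ℝ, EuclideanSpace ℝ (Fin m)) (𝓡 m) F x v)
      have e2 : ∀ u, mfderiv 𝓘(ℝ, EuclideanSpace ℝ (Fin m)) (𝓡 m') F' x u =
          mfderiv (𝓡 m) (𝓡 m') φ (F x)
          (mfderiv 𝓘(ℝ, EuclideanSpace ℝ (Fin m)) (𝓡 m) F x u) := fun u => by
        rw [hφF x hx]; rfl
      have e3 := (congrArg₂ (fun s t => γ (F x) s t)
        (mulInvariantVectorField_pulledCoframe (hi x hx) u)
        (mulInvariantVectorField_pulledCoframe (hi x hx) v)).symm.trans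
        (hγ.1.apply_mulInvariantVectorField (F x) _ _)
      have e4 := (congrArg₂ (fun s t => γ' (F' x) s t)
        ((mulInvariantVectorField_pulledCoframe (hi' x hx) u).trans (e2 u))
        ((mulInvariantVectorField_pulledCoframe (hi' x hx) v).trans (e2 v))).symm.trans
        (hγ'.1.apply_mulInvariantVectorField (F' x) _ _)
      exact (hγq' _ _).symm.trans (e4.symm.trans (e1.trans (congrArg (c * ·)
        (e3.trans (hγq _ _))))))
  -- The isomorphism is f' ∘ θ'(x₀) ∘ θ(x₀)⁻¹ ∘ f⁻¹.
  obtain ⟨B, hB⟩ := (isInvertible_pulledFrame (hi x₀ hx₀)).inverse.inverse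
  obtain ⟨B', hB'⟩ := (isInvertible_pulledFrame (hi' x₀ hx₀)).inverse
  refine ⟨f.symm.trans ((B.trans B').toLinearEquiv.trans f'), fun x y z => ?_⟩
  have hconst : ∀ a b c, f (constCurvature (fun a b => N a b) a b c) =
      g.curvature (f a) (f b) (f c) := fun a b c => by
    simp only [LieMetric.curvature_eq_constCurvature, constCurvature, map_sub, sub_apply,
      LinearMap.sub_apply, hN]
  have hconst' : ∀ a b c, f' (constCurvature (fun a b => N' a b) a b c) =
      g'.curvature (f' a) (f' b) (f' c) := fun a b c => by
    simp only [LieMetric.curvature_eq_constCurvature, constCurvature, map_sub, sub_apply,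
      LinearMap.sub_apply, hN']
  have e := key (f.symm x) (f.symm y) (f.symm z)
  have hBB : ∀ a, pulledCoframe F' x₀ ((pulledCoframe F x₀).inverse a) = B' (B a) := fun a => by
    rw [pulledCoframe, pulledCoframe, ← hB, ← hB']; rfl
  simp only [hBB] at e
  have e' := congrArg f' e
  rw [hconst'] at e'
  have e4 : f.symm (g.curvature x y z) =
      constCurvature (fun a b => N a b) (f.symm x) (f.symm y) (f.symm z) := by
    rw [f.symm_apply_eq, hconst]; simp
  change f' (B' (B (f.symm (g.curvature x y z)))) = _
  rw [e4, e']
  rfl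

end Isometry

end EinsteinSolv

/-! ### Curvature in an orthogonal frame -/

namespace EinsteinSolv

section Arrays

variable {K : Type*} [CommRing K] {ι : Type*} [Fintype ι]

/-- Twice the lowered connection coefficients `⟨∇_i e_j, e_k⟩` of an orthogonal frame with
structure constants `C` and squared norms `w`. -/
def gamArr (C : ι → ι → ι → K) (w : ι → K) (i j k : ι) : K :=
  C i j k * w k - C j k i * w i + C k i j * w j

/-- The lowered curvature coefficients `4 W ⟨R(e_i, e_j) e_l, e_k⟩`, where `w i * u i = W`. -/
def rmArr (C : ι → ι → ι → K) (w u : ι → K) (W : K) (i j l k : ι) : K :=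
  ∑ m, (u m * (gamArr C w i l m * gamArr C w j k m - gamArr C w j l m * gamArr C w i k m)
    - 2 * W * C i j m * gamArr C w m l k)

/-- The Ricci coefficients `4 W² ric(e_j, e_l)`. -/
def ricArr (C : ι → ι → ι → K) (w u : ι → K) (W : K) (j l : ι) : K :=
  ∑ i, u i * rmArr C w u W i j l i

/-- Structure constants of a semidirect sum `𝔫 ⋊_δ ℝ`. -/
def semiArr {κ : Type*} (c : κ → κ → κ → K) (δ : κ → κ → K) : κ ⊕ Unit → κ ⊕ Unit → κ ⊕ Unit → K
  | .inl i, .inl j, .inl k => c i j k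
  | .inr _, .inl j, .inl k => δ k j
  | .inl i, .inr _, .inl k => -δ k i
  | _, _, _ => 0

-- The coefficients are polynomial in C, w, u and W with integer coefficients. With integral data
-- they can therefore be computed in ℤ and cast, which makes them decidable; this is why u and W are
-- used instead of inverses of w.
omit [Fintype ι] in
theorem gamArr_cast (C : ι → ι → ι → ℤ) (w : ι → ℤ) (i j k : ι) :
    gamArr (fun i j k => (C i j k : ℝ)) (fun i => (w i : ℝ)) i j k = (gamArr C w i j k : ℤ) := by
  simp [gamArr]

theorem rmArr_cast (C : ι → ι → ι → ℤ) (w u : ι → ℤ) (W : ℤ) (i j l k : ι) :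
    rmArr (fun i j k => (C i j k : ℝ)) (fun i => (w i : ℝ)) (fun i => (u i : ℝ)) W i j l k =
      (rmArr C w u W i j l k : ℤ) := by
  simp [rmArr, gamArr_cast]

theorem ricArr_cast (C : ι → ι → ι → ℤ) (w u : ι → ℤ) (W : ℤ) (j l : ι) :
    ricArr (fun i j k => (C i j k : ℝ)) (fun i => (w i : ℝ)) (fun i => (u i : ℝ)) W j l =
      (ricArr C w u W j l : ℤ) := by
  simp [ricArr, rmArr_cast]

end Arrays

/-! ### Curvature and Ricci form of a metric Lie algebra from its structure constants. -/

section Frame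

variable {L : Type*} [LieRing L] [LieAlgebra ℝ L]
variable {ι : Type*} [Fintype ι] [DecidableEq ι]

/-- An orthogonal frame with structure constants `C` and squared norms `ρ w_i`, where
`w_i u_i = W`. -/
structure IsFrame (g : LieMetric L) (b : Module.Basis ι ℝ L) (C : ι → ι → ι → ℝ) (w u : ι → ℝ)
    (W ρ : ℝ) : Prop where
  lie : ∀ i j, ⁅b i, b j⁆ = ∑ k, C i j k • b k
  form : ∀ i j, g.form (b i) (b j) = if i = j then ρ * w i else 0
  mul_eq : ∀ i, w i * u i = W
  W_ne : W ≠ 0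
  ρ_ne : ρ ≠ 0

namespace IsFrame

variable {g : LieMetric L} {b : Module.Basis ι ℝ L} {C : ι → ι → ι → ℝ} {w u : ι → ℝ} {W ρ : ℝ}

theorem w_ne (h : IsFrame g b C w u W ρ) (i : ι) : w i ≠ 0 := by
  have := h.mul_eq i
  have := h.W_ne
  rintro h0
  simp_all

theorem form_sum (h : IsFrame g b C w u W ρ) (x : ι → ℝ) (k : ι) :
    g.form (∑ i, x i • b i) (b k) = x k * (ρ * w k) := by
  simp [map_sum, LinearMap.sum_apply, h.form]

theorem form_sum_right (h : IsFrame g b C w u W ρ) (x : ι → ℝ) (k : ι) :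
    g.form (b k) (∑ i, x i • b i) = x k * (ρ * w k) := by
  rw [g.symm, h.form_sum]

theorem ext_form (_ : IsFrame g b C w u W ρ) {x y : L}
    (hxy : ∀ k, g.form x (b k) = g.form y (b k)) : x = y := by
  refine g.ext_form fun z => ?_
  rw [← b.sum_repr z]
  simp only [map_sum, map_smul, hxy]

variable [FiniteDimensional ℝ L]

theorem form_leviCivita (h : IsFrame g b C w u W ρ) (i j k : ι) :
    g.form (g.leviCivita (b i) (b j)) (b k) = ρ / 2 * gamArr C w i j k := by
  rw [g.form_leviCivita, h.lie, h.lie, h.lie, h.form_sum, h.form_sum, h.form_sum, gamArr]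
  ring

theorem leviCivita (h : IsFrame g b C w u W ρ) (i j : ι) :
    g.leviCivita (b i) (b j) = ∑ k, (u k * gamArr C w i j k / (2 * W)) • b k := by
  refine h.ext_form fun k => ?_
  rw [h.form_leviCivita, h.form_sum]
  have := h.mul_eq k
  have h1 := h.W_ne
  field_simp
  rw [← this]
  ring

/-- Metric compatibility moves the outer derivative to the last slot: ⟨∇_i∇_j e_l, e_k⟩ = −⟨∇_j e_l,
∇_i e_k⟩. Only products of lowered coefficients remain. -/
theorem form_curvature (h : IsFrame g b C w u W ρ) (i j l k : ι) :
    g.form (g.curvature (b i) (b j) (b l)) (b k) = ρ / (4 * W) * rmArr C w u W i j l k := by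
  have key : ∀ i j, g.form (g.leviCivita (b i) (g.leviCivita (b j) (b l))) (b k) =
      - ∑ m, ρ / (4 * W) * (u m * gamArr C w j l m * gamArr C w i k m) := by
    intro i j
    have e := g.form_leviCivita_add (b i) (g.leviCivita (b j) (b l)) (b k)
    rw [eq_neg_of_add_eq_zero_left e, h.leviCivita j l]
    simp only [map_sum, map_smul, LinearMap.sum_apply, LinearMap.smul_apply]
    rw [neg_inj]
    refine Finset.sum_congr rfl fun m _ => ?_
    rw [g.symm, h.form_leviCivita]
    have h1 := h.W_ne
    simp only [smul_eq_mul]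
    field_simp
    ring
  rw [LieMetric.curvature, map_sub, map_sub, LinearMap.sub_apply, LinearMap.sub_apply, key, key,
    h.lie, rmArr]
  simp only [map_sum, map_smul, LinearMap.sum_apply, LinearMap.smul_apply, h.form_leviCivita]
  rw [Finset.mul_sum, ← Finset.sum_neg_distrib, ← Finset.sum_neg_distrib, ← Finset.sum_sub_distrib,
    ← Finset.sum_sub_distrib]
  refine Finset.sum_congr rfl fun m _ => ?_
  have h1 := h.W_ne
  simp only [smul_eq_mul]
  field_simp
  ring

theorem curvature (h : IsFrame g b C w u W ρ) (i j l : ι) :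
    g.curvature (b i) (b j) (b l) = ∑ k, (u k * rmArr C w u W i j l k / (4 * W ^ 2)) • b k := by
  refine h.ext_form fun k => ?_
  rw [h.form_curvature, h.form_sum]
  have := h.mul_eq k
  have h1 := h.W_ne
  field_simp
  rw [← this]
  ring

/-- The factor ρ drops out, since the Ricci form does not change when the metric is rescaled. -/
theorem ricciForm (h : IsFrame g b C w u W ρ) (j l : ι) :
    g.ricciForm (b j) (b l) = ricArr C w u W j l / (4 * W ^ 2) := by
  change LinearMap.trace ℝ L (g.curvatureEnd (b j) (b l)) = _
  rw [LinearMap.trace_eq_matrix_trace ℝ b, Matrix.trace, ricArr, Finset.sum_div]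
  refine Finset.sum_congr rfl fun i _ => ?_
  rw [Matrix.diag_apply, LinearMap.toMatrix_apply]
  change b.repr (g.curvature (b i) (b j) (b l)) i = _
  rw [h.curvature]
  simp [Finsupp.single_apply]

theorem ricciForm_eq (h : IsFrame g b C w u W ρ) {Λ : ℝ}
    (hΛ : ∀ j l, ricArr C w u W j l = if j = l then Λ * w j else 0) (x y : L) :
    g.ricciForm x y = Λ / (4 * W ^ 2 * ρ) * g.form x y := by
  have : g.ricciForm = (Λ / (4 * W ^ 2 * ρ)) • g.form := by
    refine LinearMap.BilinForm.ext_basis b fun i j => ?_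
    rw [h.ricciForm, hΛ, LinearMap.smul_apply, LinearMap.smul_apply, h.form]
    have h1 := h.W_ne
    have h2 := h.ρ_ne
    split_ifs
    · rw [smul_eq_mul]; field_simp
    · simp
  rw [this]
  rfl

theorem isEinstein (h : IsFrame g b C w u W ρ) {Λ : ℝ}
    (hΛ : ∀ j l, ricArr C w u W j l = if j = l then Λ * w j else 0) : g.IsEinstein := by
  refine ⟨Λ / (4 * W ^ 2 * ρ), fun x => g.ext_form fun y => ?_⟩
  rw [g.form_ricci, h.ricciForm_eq hΛ, map_smul, LinearMap.smul_apply, smul_eq_mul]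

end IsFrame

end Frame

end EinsteinSolv

/-! ### Fraction-free elimination -/

namespace EinsteinSolv

/-- Fraction-free Gaussian elimination: whether the linear system with the given rows of
coefficients, in `n` unknowns, has only the zero solution. -/
def onlyZero : ℕ → List (List ℤ) → Bool
  | 0, _ => true
  | n + 1, rows =>
    match rows.find? (fun r => r.headI != 0) with
    | none => false
    | some p => onlyZero n (rows.map fun r =>
        if r.headI = 0 then r.tail
        else List.zipWith (fun a b => p.headI * b - r.headI * a) p.tail r.tail)

/-- The value of a linear form. -/
def dotList : List ℤ → List ℝ → ℝ
  | a :: r, x :: xs => a * x + dotList r xs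
  | _, _ => 0

/-- One row operation of the elimination, evaluated on a vector. -/
theorem dotList_zipWith (a b : ℤ) : ∀ (p r : List ℤ) (x : List ℝ), p.length = r.length →
    dotList (List.zipWith (fun s t => a * t - b * s) p r) x = a * dotList r x - b * dotList p x
  | [], [], _, _ => by simp [dotList]
  | s :: p, t :: r, [], _ => by simp [dotList]
  | s :: p, t :: r, x :: xs, h => by
    simp only [List.zipWith_cons_cons, dotList]
    rw [dotList_zipWith a b p r xs (by simpa using h)]
    push_cast
    ring

/-- Only soundness is needed. The new rows are integer combinations of a row and the pivot row in
which the first unknown cancels, so the tail of a solution solves the smaller system; once the tail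
vanishes, the nonzero pivot kills the head. -/
theorem eq_zero_of_onlyZero : ∀ (n : ℕ) (rows : List (List ℤ)) (x : List ℝ),
    onlyZero n rows = true → (∀ r ∈ rows, r.length = n) → x.length = n →
    (∀ r ∈ rows, dotList r x = 0) → ∀ y ∈ x, y = 0
  | 0, _, x, _, _, hx, _ => by simp [List.length_eq_zero_iff.1 hx]
  | n + 1, rows, [], _, _, hx, _ => by simp
  | n + 1, rows, x :: xs, h, hl, hx, h0 => by
    unfold onlyZero at h
    split at h
    · simp at h
    · rename_i p hp
      have hpm := List.mem_of_find?_eq_some hp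
      have hp0 : p.headI ≠ 0 := by simpa using List.find?_some hp
      have hsplit : ∀ r ∈ rows, r.tail.length = n ∧
          (r.headI : ℝ) * x + dotList r.tail xs = 0 := by
        intro r hr
        have := hl r hr
        have h1 := h0 r hr
        cases r with
        | nil => simp at this
        | cons a r => exact ⟨by simpa using this, by simpa [dotList] using h1⟩
      have hxs : ∀ y ∈ xs, y = 0 := by
        refine eq_zero_of_onlyZero n _ xs h ?_ (by simpa using hx) ?_
        · intro r hr
          obtain ⟨s, hs, rfl⟩ := List.mem_map.1 hr
          have := (hsplit s hs).1
          have := (hsplit p hpm).1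
          split_ifs <;> simp_all
        · intro r hr
          obtain ⟨s, hs, rfl⟩ := List.mem_map.1 hr
          have h1 := hsplit s hs
          have h2 := hsplit p hpm
          split_ifs with h3
          · simpa [h3] using h1.2
          · rw [dotList_zipWith _ _ _ _ _ (h2.1.trans h1.1.symm)]
            linear_combination (p.headI : ℝ) * h1.2 - (s.headI : ℝ) * h2.2
      have hdot : ∀ (r : List ℤ) (l : List ℝ), (∀ y ∈ l, y = 0) → dotList r l = 0 := by
        intro r l
        induction l generalizing r with
        | nil => intro _; cases r <;> rfl
        | cons a l ih =>
          intro hl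
          cases r with
          | nil => rfl
          | cons b r =>
            simp only [dotList]
            rw [ih r fun y hy => hl y (List.mem_cons_of_mem _ hy), hl a List.mem_cons_self]
            simp
      have := (hsplit p hpm).2
      rw [hdot _ _ hxs, add_zero] at this
      have hx0 : x = 0 := by
        rcases mul_eq_zero.1 this with h | h
        · exact absurd (by exact_mod_cast h) hp0
        · exact h
      intro y hy
      rcases List.mem_cons.1 hy with rfl | hy
      · exact hx0
      · exact hxs y hy

/-! ### Eigenbivectors of the curvature operator -/

section Bivector

open TensorProduct

variable {L : Type*} [LieRing L] [LieAlgebra ℝ L] [FiniteDimensional ℝ L]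

/-- For fixed `z`, the bilinear map `(x, y) ↦ R(x, y) z - κ (ric(y, z) x - ric(x, z) y)`. -/
noncomputable def LieMetric.curvatureDefect (g : LieMetric L) (κ : ℝ) (z : L) : L →ₗ[ℝ] L →ₗ[ℝ] L :=
  LinearMap.mk₂ ℝ (fun x y => g.curvature x y z - κ • (g.ricciForm y z • x - g.ricciForm x z • y))
    (fun x x' y => by
      simp only [LieMetric.curvature, add_lie, map_add, LinearMap.add_apply]; module)
    (fun c x y => by
      simp only [LieMetric.curvature, smul_lie, map_smul, LinearMap.smul_apply, smul_eq_mul]; module)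
    (fun x y y' => by
      simp only [LieMetric.curvature, lie_add, map_add, LinearMap.add_apply]; module)
    (fun c x y => by
      simp only [LieMetric.curvature, lie_smul, map_smul, LinearMap.smul_apply, smul_eq_mul]; module)

theorem LieMetric.curvatureDefect_apply (g : LieMetric L) (κ : ℝ) (x y z : L) :
    g.curvatureDefect κ z x y =
      g.curvature x y z - κ • (g.ricciForm y z • x - g.ricciForm x z • y) := rfl

/-- The bivectors, represented by tensors, on which the curvature operator acts as `κ` times the
curvature operator of constant curvature defined by the Ricci form. -/
noncomputable def LieMetric.eigenbivectors (g : LieMetric L) (κ : ℝ) : Submodule ℝ (L ⊗[ℝ] L) :=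
  ⨅ z, LinearMap.ker (TensorProduct.lift (g.curvatureDefect κ z))

theorem LieMetric.mem_eigenbivectors {g : LieMetric L} {κ : ℝ} {t : L ⊗[ℝ] L} :
    t ∈ g.eigenbivectors κ ↔ ∀ z, TensorProduct.lift (g.curvatureDefect κ z) t = 0 := by
  simp [LieMetric.eigenbivectors]

variable {L' : Type*} [LieRing L'] [LieAlgebra ℝ L'] [FiniteDimensional ℝ L']

/-- The endomorphisms x ↦ R(x,y)z are conjugate under A, so their traces agree. No scaling constant
appears, although the metrics may differ by one. -/
theorem ricciForm_of_curvature {g : LieMetric L} {g' : LieMetric L'} {A : L ≃ₗ[ℝ] L'}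
    (hA : ∀ x y z, A (g.curvature x y z) = g'.curvature (A x) (A y) (A z)) (y z : L) :
    g'.ricciForm (A y) (A z) = g.ricciForm y z := by
  change LinearMap.trace ℝ L' (g'.curvatureEnd (A y) (A z)) =
    LinearMap.trace ℝ L (g.curvatureEnd y z)
  rw [← LinearMap.trace_conj' (g.curvatureEnd y z) A]
  congr 1
  ext x
  change g'.curvature x (A y) (A z) = A (g.curvature (A.symm x) y z)
  rw [hA, A.apply_symm_apply]

/-- The defining condition involves only the curvature and the Ricci form, both of which A
transports. -/
theorem congr_mem_eigenbivectors {g : LieMetric L} {g' : LieMetric L'} {A : L ≃ₗ[ℝ] L'}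
    (hA : ∀ x y z, A (g.curvature x y z) = g'.curvature (A x) (A y) (A z)) {κ : ℝ}
    {t : L' ⊗[ℝ] L'} (ht : t ∈ g'.eigenbivectors κ) :
    TensorProduct.congr A.symm A.symm t ∈ g.eigenbivectors κ := by
  rw [LieMetric.mem_eigenbivectors] at ht ⊢
  intro z
  have h := ht (A z)
  have key : (TensorProduct.lift (g.curvatureDefect κ z)) ∘ₗ
      (TensorProduct.congr A.symm A.symm).toLinearMap =
      A.symm.toLinearMap ∘ₗ TensorProduct.lift (g'.curvatureDefect κ (A z)) := by
    refine TensorProduct.ext' fun x y => ?_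
    refine A.injective ?_
    have hx := hA (A.symm x) (A.symm y) z
    have h1 := ricciForm_of_curvature hA (A.symm x) z
    have h2 := ricciForm_of_curvature hA (A.symm y) z
    simp only [A.apply_symm_apply] at hx h1 h2
    simp [LieMetric.curvatureDefect_apply, hx, h1, h2]
  have := LinearMap.congr_fun key t
  rw [LinearMap.comp_apply, LinearMap.comp_apply, h, map_zero] at this
  exact this

end Bivector

end EinsteinSolv

/-! ### Integral models of the rows of the table -/

namespace EinsteinSolv

theorem bracketOf_ite {n : ℕ} (d : Fin n → Matrix (Fin n) (Fin n) ℝ) (a b : ℝ)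
    (i j k : Fin n) :
    bracketOf d (fun l => if l = i then a else 0) (fun l => if l = j then b else 0) k =
      a * b * (d k j i - d k i j) := by
  simp only [bracketOf, mul_sub, Finset.sum_sub_distrib, mul_ite, ite_mul, mul_zero, zero_mul,
    Finset.sum_ite_eq', Finset.sum_ite_irrel, Finset.sum_const_zero, Finset.mem_univ, if_true]
  ring

/-- Integers describing a semidirect sum `ℝⁿ ⋊ ℝ` in a rescaled basis: `d` and `D` are, up to the
factor `κ`, the differentials and the derivation in the basis `e_i` times the square root of
`τ_i`. -/
structure IntModel (n : ℕ) where
  κ : ℤ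
  d : Fin n → Matrix (Fin n) (Fin n) ℤ
  D : Matrix (Fin n) (Fin n) ℤ
  τ : Fin n → ℤ
  W : ℤ

namespace IntModel

variable {n : ℕ} (M : IntModel n) (S : Finset ℕ)

/-- The structure constants. -/
def C : Fin n ⊕ Unit → Fin n ⊕ Unit → Fin n ⊕ Unit → ℤ :=
  semiArr (fun i j k => M.d k j i - M.d k i j) M.D

/-- The squared norms of the basis vectors, divided by `κ ^ 2`. -/
def w : Fin n ⊕ Unit → ℤ :=
  Sum.elim (fun i => (if (i : ℕ) + 1 ∈ S then -1 else 1) * M.τ i) (fun _ => 1)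

/-- The integers `W / w i`. -/
def u (i : Fin n ⊕ Unit) : ℤ := M.W / M.w S i

/-- The lowered curvature coefficients. -/
def rm (i j l k : Fin n ⊕ Unit) : ℤ := rmArr M.C (M.w S) (M.u S) M.W i j l k

/-- The Ricci coefficients. -/
def ric (j l : Fin n ⊕ Unit) : ℤ := ricArr M.C (M.w S) (M.u S) M.W j l

/-- The lowered coefficients of `b R(x, y) z - a (ric(y, z) x - ric(x, z) y)`, up to a factor. -/
def defect (Λ a b : ℤ) (i j l k : Fin n ⊕ Unit) : ℤ :=
  b * M.W * M.rm S i j l k - a * Λ * M.w S l * M.w S k *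
    ((if j = l ∧ i = k then 1 else 0) - if i = l ∧ j = k then 1 else 0)

/-- The linear system satisfied by the coordinates of a bivector in `eigenbivectors (a / b)`. -/
def system (pairs : List ((Fin n ⊕ Unit) × (Fin n ⊕ Unit))) (Λ a b : ℤ) : List (List ℤ) :=
  pairs.map fun q => pairs.map fun p => M.defect S Λ a b p.1 p.2 q.2 q.1

/-- The model describes the row `r`, in the basis `e_i` times `κ t_i`. -/
structure Describes (r : TableRow) (M : IntModel r.n) (t : Fin r.n → ℝ) : Prop where
  sq : ∀ i, t i ^ 2 = M.τ i
  d : ∀ k i j, M.κ * t i * t j * r.d k i j = M.d k i j * t k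
  D : ∀ k j, M.κ * t j * r.D k j = M.D k j * t k
  κ_ne : M.κ ≠ 0
  W_ne : M.W ≠ 0
  dvd : ∀ i, M.τ i ∣ M.W

namespace Describes

/- The bracket `st - ts = 0` on `ℝ`. -/
attribute [local instance 100] LieRing.ofAssociativeRing

variable {r : TableRow} {M : IntModel r.n} {t : Fin r.n → ℝ}

theorem τ_ne (h : Describes r M t) (i : Fin r.n) : M.τ i ≠ 0 := fun h0 =>
  h.W_ne (zero_dvd_iff.1 (h0 ▸ h.dvd i))

theorem t_ne (h : Describes r M t) (i : Fin r.n) : t i ≠ 0 := by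
  intro h0
  have := h.sq i
  rw [h0, zero_pow two_ne_zero] at this
  exact h.τ_ne i (by exact_mod_cast this.symm)

/-- The integer division defining `u` is exact because each τ_i divides W. -/
theorem w_mul_u (h : Describes r M t) (S : Finset ℕ) (i : Fin r.n ⊕ Unit) :
    M.w S i * M.u S i = M.W := by
  refine Int.mul_ediv_cancel' ?_
  rcases i with i | _
  · simp only [w, Sum.elim_inl]
    split_ifs
    · simpa using h.dvd i
    · simpa using h.dvd i
  · exact one_dvd _

/-- Coordinates with respect to the rescaled basis. -/
noncomputable def coordEquiv (h : Describes r M t) : r.Ext ≃ₗ[ℝ] (Fin r.n ⊕ Unit → ℝ) where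
  toFun x := Sum.elim (fun i => x.left i / (M.κ * t i)) (fun _ => x.right / M.κ)
  invFun c := ⟨fun i => M.κ * t i * c (.inl i), M.κ * c (.inr ())⟩
  map_add' x y := by
    ext (i | i)
    · exact add_div (x.left i) (y.left i) _
    · exact add_div x.right y.right _
  map_smul' s x := by
    ext (i | i)
    · exact mul_div_assoc s (x.left i) _
    · exact mul_div_assoc s x.right _
  left_inv x := by
    have h1 : (M.κ : ℝ) ≠ 0 := by exact_mod_cast h.κ_ne
    refine LieAlgebra.SemiDirectSum.ext (funext fun i => ?_) ?_
    · exact mul_div_cancel₀ (x.left i) (mul_ne_zero h1 (h.t_ne i))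
    · exact mul_div_cancel₀ x.right h1
  right_inv c := by
    have h1 : (M.κ : ℝ) ≠ 0 := by exact_mod_cast h.κ_ne
    ext (i | i)
    · exact mul_div_cancel_left₀ (c (.inl i)) (mul_ne_zero h1 (h.t_ne i))
    · exact mul_div_cancel_left₀ (c (.inr ())) h1

/-- The rescaled basis. -/
noncomputable def basis (h : Describes r M t) : Module.Basis (Fin r.n ⊕ Unit) ℝ r.Ext :=
  Module.Basis.ofEquivFun h.coordEquiv

theorem basis_sum (h : Describes r M t) (c : Fin r.n ⊕ Unit → ℝ) :
    ∑ i, c i • h.basis i = ⟨fun i => M.κ * t i * c (.inl i), M.κ * c (.inr ())⟩ := by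
  have : ∑ i, c i • h.basis i = h.coordEquiv.symm c := by
    rw [← Module.Basis.equivFun_symm_apply, basis, Module.Basis.equivFun_ofEquivFun]
  rw [this]
  rfl

theorem basis_inl (h : Describes r M t) (i : Fin r.n) :
    h.basis (.inl i) = ⟨fun j => if j = i then M.κ * t i else 0, 0⟩ := by
  have : h.basis (.inl i) = h.coordEquiv.symm (Pi.single (.inl i) 1) := by
    simp [basis]
  rw [this]
  refine LieAlgebra.SemiDirectSum.ext (funext fun j => ?_) ?_
  · change M.κ * t j * _ = _
    by_cases hj : j = i
    · simp [hj]
    · simp [hj]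
  · change M.κ * _ = (0 : ℝ)
    simp

theorem basis_inr (h : Describes r M t) : h.basis (.inr ()) = ⟨0, (M.κ : ℝ)⟩ := by
  have : h.basis (.inr ()) = h.coordEquiv.symm (Pi.single (.inr ()) 1) := by
    simp [basis]
  rw [this]
  refine LieAlgebra.SemiDirectSum.ext (funext fun j => ?_) ?_
  · change M.κ * t j * _ = (0 : ℝ)
    simp
  · change M.κ * _ = (M.κ : ℝ)
    simp

/-- The frame is κ t_i e_i together with κ e₀, so its squared norms carry the common factor ρ = κ².
The powers of κ and the ratios of the t_i are arranged so that the structure constants are the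
integers of the model. -/
theorem isFrame (h : Describes r M t) (S : Finset ℕ) :
    IsFrame (r.metric S) h.basis (fun i j k => (M.C i j k : ℝ)) (fun i => (M.w S i : ℝ))
      (fun i => (M.u S i : ℝ)) M.W (M.κ ^ 2) where
  mul_eq i := by exact_mod_cast h.w_mul_u S i
  W_ne := by exact_mod_cast h.W_ne
  ρ_ne := by exact_mod_cast pow_ne_zero 2 h.κ_ne
  form i j := by
    rcases i with i | i <;> rcases j with j | j
    · rw [basis_inl, basis_inl]
      change (∑ k, r.sign S k * (_ * _)) + (0 : ℝ) * 0 = _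
      by_cases hij : i = j
      · subst hij
        have := h.sq i
        simp only [TableRow.sign, w, ite_mul, mul_ite, mul_zero, zero_mul, Finset.sum_ite_eq',
          Finset.mem_univ, if_true, Sum.elim_inl]
        split_ifs <;> push_cast
        · linear_combination -(M.κ : ℝ) ^ 2 * this
        · linear_combination (M.κ : ℝ) ^ 2 * this
      · simp [hij, Ne.symm hij]
    · rw [basis_inl, basis_inr]
      change (∑ k, r.sign S k * (_ * (0 : ℝ))) + (0 : ℝ) * _ = _
      simp
    · rw [basis_inl, basis_inr]
      change (∑ k, r.sign S k * ((0 : ℝ) * _)) + _ * (0 : ℝ) = _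
      simp
    · rw [basis_inr]
      change (∑ k, r.sign S k * ((0 : ℝ) * 0)) + (M.κ : ℝ) * M.κ = _
      simp [w, pow_two]
  lie i j := by
    rw [h.basis_sum]
    rcases i with i | i <;> rcases j with j | j
    · rw [basis_inl, basis_inl]
      refine LieAlgebra.SemiDirectSum.ext (funext fun k => ?_) ?_
      · change bracketOf r.d (fun l => if l = i then M.κ * t i else 0)
          (fun l => if l = j then M.κ * t j else 0) k + (0 : ℝ) * _ - (0 : ℝ) * _ = _
        rw [bracketOf_ite]
        simp only [C, semiArr]
        push_cast
        linear_combination M.κ * h.d k j i - M.κ * h.d k i j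
      · simp [C, semiArr]
    · rw [basis_inl, basis_inr]
      refine LieAlgebra.SemiDirectSum.ext (funext fun k => ?_) ?_
      · have h0 : bracketOf r.d (fun l => if l = i then M.κ * t i else 0) 0 k = 0 := by
          simp [bracketOf]
        change bracketOf r.d (fun l => if l = i then M.κ * t i else 0) 0 k + (0 : ℝ) * _ -
          M.κ * (r.D *ᵥ fun l => if l = i then M.κ * t i else 0) k = _
        simp only [h0, C, semiArr, Matrix.mulVec, dotProduct, mul_ite, mul_zero,
          Finset.sum_ite_eq', Finset.mem_univ, if_true]
        push_cast
        linear_combination -M.κ * h.D k i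
      · simp [C, semiArr]
    · rw [basis_inl, basis_inr]
      refine LieAlgebra.SemiDirectSum.ext (funext fun k => ?_) ?_
      · have h0 : bracketOf r.d 0 (fun l => if l = j then M.κ * t j else 0) k = 0 := by
          simp [bracketOf]
        change bracketOf r.d 0 (fun l => if l = j then M.κ * t j else 0) k +
          M.κ * (r.D *ᵥ fun l => if l = j then M.κ * t j else 0) k - (0 : ℝ) * _ = _
        simp only [h0, C, semiArr, Matrix.mulVec, dotProduct, mul_ite, mul_zero,
          Finset.sum_ite_eq', Finset.mem_univ, if_true]
        push_cast
        linear_combination M.κ * h.D k j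
      · simp [C, semiArr]
    · rw [basis_inr]
      rw [lie_self]
      refine LieAlgebra.SemiDirectSum.ext (funext fun k => ?_) ?_
      · change (0 : ℝ) = _
        simp [C, semiArr]
      · simp [C, semiArr]

end Describes
end IntModel
end EinsteinSolv

/-! ### Eigenbivectors in an integral model -/

namespace EinsteinSolv

open TensorProduct

theorem dotList_map {α : Type*} (f : α → ℤ) (x : α → ℝ) : ∀ l : List α,
    dotList (l.map f) (l.map x) = (l.map fun p => x p * f p).sum
  | [] => rfl
  | a :: l => by simp [dotList, dotList_map f x l, mul_comm]

theorem rmArr_swap {K : Type*} [CommRing K] {ι : Type*} [Fintype ι] {C : ι → ι → ι → K}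
    (hC : ∀ i j k, C i j k = -C j i k) (w u : ι → K) (W : K) (i j l k : ι) :
    rmArr C w u W i j l k = -rmArr C w u W j i l k := by
  rw [rmArr, rmArr, ← Finset.sum_neg_distrib]
  refine Finset.sum_congr rfl fun m _ => ?_
  rw [hC i j m]
  ring

/-- The list contains each unordered pair of distinct indices once. -/
structure IsPairList {ι : Type*} [Fintype ι] (pairs : List (ι × ι)) : Prop where
  mem : ∀ i j, i = j ∨ (i, j) ∈ pairs ∨ (j, i) ∈ pairs
  sum : ∀ τ D : ι → ι → ℝ, (∀ i j, D i j = -D j i) →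
    ∑ i, ∑ j, τ i j * D i j = (pairs.map fun p => (τ p.1 p.2 - τ p.2 p.1) * D p.1 p.2).sum

/-- Coordinates of the bivector represented by a tensor. -/
noncomputable def bivectorCoord {L : Type*} [AddCommGroup L] [Module ℝ L] {ι : Type*}
    (b : Module.Basis ι ℝ L) (p : ι × ι) : L ⊗[ℝ] L →ₗ[ℝ] ℝ :=
  (b.tensorProduct b).coord p - (b.tensorProduct b).coord p.swap

theorem bivectorCoord_tmul {L : Type*} [AddCommGroup L] [Module ℝ L] {ι : Type*}
    (b : Module.Basis ι ℝ L) (p : ι × ι) (x y : L) :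
    bivectorCoord b p (x ⊗ₜ y) =
      b.repr x p.1 * b.repr y p.2 - b.repr x p.2 * b.repr y p.1 := by
  obtain ⟨i, j⟩ := p
  simp [bivectorCoord, Module.Basis.tensorProduct_repr_tmul_apply]
  ring

/-- Bivectors are handled as tensors modulo symmetric ones. Being fixed by the flip is how the
vanishing of the underlying bivector is expressed. -/
theorem comm_eq_self_of_bivectorCoord {L : Type*} [AddCommGroup L] [Module ℝ L] {ι : Type*}
    {b : Module.Basis ι ℝ L} {t : L ⊗[ℝ] L} (h : ∀ p, bivectorCoord b p t = 0) :
    TensorProduct.comm ℝ L L t = t := by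
  have key : ∀ p, (b.tensorProduct b).coord p ∘ₗ (TensorProduct.comm ℝ L L).toLinearMap =
      (b.tensorProduct b).coord p.swap := by
    intro p
    refine TensorProduct.ext' fun x y => ?_
    obtain ⟨i, j⟩ := p
    simp [Module.Basis.tensorProduct_repr_tmul_apply, mul_comm]
  refine (b.tensorProduct b).ext_elem fun p => ?_
  have h1 := LinearMap.congr_fun (key p) t
  have h2 := h p
  simp only [bivectorCoord, LinearMap.sub_apply] at h2
  exact h1.trans (sub_eq_zero.1 h2).symm

namespace IntModel

theorem C_swap {n : ℕ} (M : IntModel n) (i j k : Fin n ⊕ Unit) : M.C i j k = -M.C j i k := by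
  rcases i with i | i <;> rcases j with j | j <;> rcases k with k | k <;> simp [C, semiArr]

theorem defect_swap {n : ℕ} (M : IntModel n) (S : Finset ℕ) (Λ a b : ℤ) (i j l k : Fin n ⊕ Unit) :
    M.defect S Λ a b i j l k = -M.defect S Λ a b j i l k := by
  rw [defect, defect, rm, rmArr_swap M.C_swap, ← rm]
  ring

namespace Describes

attribute [local instance 100] LieRing.ofAssociativeRing

variable {r : TableRow} {M : IntModel r.n} {t : Fin r.n → ℝ} {S : Finset ℕ} {Λ : ℤ}

theorem ricArr_eq (hΛ : ∀ j l, M.ric S j l = if j = l then Λ * M.w S j else 0)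
    (j l : Fin r.n ⊕ Unit) :
    ricArr (fun i j k => (M.C i j k : ℝ)) (fun i => (M.w S i : ℝ)) (fun i => (M.u S i : ℝ)) M.W j l
      = if j = l then (Λ : ℝ) * M.w S j else 0 := by
  rw [ricArr_cast]
  have := hΛ j l
  rw [ric] at this
  rw [this]
  split_ifs <;> simp

theorem isEinstein (h : Describes r M t)
    (hΛ : ∀ j l, M.ric S j l = if j = l then Λ * M.w S j else 0) : (r.metric S).IsEinstein :=
  (h.isFrame S).isEinstein (ricArr_eq hΛ)

theorem ricciForm_basis (h : Describes r M t)
    (hΛ : ∀ j l, M.ric S j l = if j = l then Λ * M.w S j else 0) (j l : Fin r.n ⊕ Unit) :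
    (r.metric S).ricciForm (h.basis j) (h.basis l) =
      if j = l then (Λ : ℝ) * M.w S l / (4 * M.W ^ 2) else 0 := by
  rw [(h.isFrame S).ricciForm, ricArr_eq hΛ]
  split_ifs with hjl
  · rw [hjl]
  · simp

theorem form_curvatureDefect (h : Describes r M t)
    (hΛ : ∀ j l, M.ric S j l = if j = l then Λ * M.w S j else 0) {a b : ℤ} (hb : b ≠ 0)
    (i j l k : Fin r.n ⊕ Unit) :
    (r.metric S).form ((r.metric S).curvatureDefect (a / b) (h.basis l) (h.basis i) (h.basis j))
      (h.basis k) = (M.κ : ℝ) ^ 2 / (4 * M.W ^ 2 * b) * M.defect S Λ a b i j l k := by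
  have hW : (M.W : ℝ) ≠ 0 := by exact_mod_cast h.W_ne
  have hb' : (b : ℝ) ≠ 0 := by exact_mod_cast hb
  have hric : ∀ j l, (r.metric S).ricciForm (h.basis j) (h.basis l) =
      (Λ : ℝ) * M.w S l / (4 * M.W ^ 2) * if j = l then 1 else 0 := fun j l => by
    rw [h.ricciForm_basis hΛ, mul_boole]
  have hform : ∀ i, (r.metric S).form (h.basis i) (h.basis k) =
      (M.κ : ℝ) ^ 2 * M.w S k * if i = k then 1 else 0 := fun i => by
    rw [(h.isFrame S).form, mul_boole]
    split_ifs with hik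
    · rw [hik]
    · rfl
  have hite : ∀ P Q : Prop, [Decidable P] → [Decidable Q] →
      (((if P ∧ Q then 1 else 0 : ℤ)) : ℝ) = (if P then 1 else 0) * if Q then 1 else 0 := by
    intro P Q _ _
    by_cases hP : P <;> by_cases hQ : Q <;> simp [hP, hQ]
  rw [LieMetric.curvatureDefect_apply, hric, hric]
  simp only [map_sub, map_smul, LinearMap.sub_apply, LinearMap.smul_apply, smul_eq_mul]
  rw [(h.isFrame S).form_curvature, hform, hform, rmArr_cast, defect, rm, Int.cast_sub,
    Int.cast_mul _ (_ - _), Int.cast_sub (ite _ _ _), hite, hite]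
  push_cast
  field_simp

/-- Pairing the eigenbivector equation at e_l with e_k turns it into one linear equation on the
coordinates of the tensor. -/
theorem sum_defect (h : Describes r M t)
    (hΛ : ∀ j l, M.ric S j l = if j = l then Λ * M.w S j else 0) {a b : ℤ} (hb : b ≠ 0)
    {s : r.Ext ⊗[ℝ] r.Ext} (hs : s ∈ (r.metric S).eigenbivectors (a / b))
    (l k : Fin r.n ⊕ Unit) :
    ∑ i, ∑ j, (h.basis.tensorProduct h.basis).repr s (i, j) * (M.defect S Λ a b i j l k : ℝ) = 0 := by
  have hW : (M.W : ℝ) ≠ 0 := by exact_mod_cast h.W_ne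
  have hκ : (M.κ : ℝ) ≠ 0 := by exact_mod_cast h.κ_ne
  have hb' : (b : ℝ) ≠ 0 := by exact_mod_cast hb
  have h1 := LieMetric.mem_eigenbivectors.1 hs (h.basis l)
  have h2 : (r.metric S).form (TensorProduct.lift
      ((r.metric S).curvatureDefect (a / b) (h.basis l)) s) (h.basis k) = 0 := by
    rw [h1, map_zero, LinearMap.zero_apply]
  rw [← (h.basis.tensorProduct h.basis).sum_repr s] at h2
  simp only [map_sum, map_smul, LinearMap.sum_apply, LinearMap.smul_apply,
    Module.Basis.tensorProduct_apply, TensorProduct.lift.tmul, Fintype.sum_prod_type,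
    h.form_curvatureDefect hΛ hb, smul_eq_mul] at h2
  have h3 : (M.κ : ℝ) ^ 2 / (4 * M.W ^ 2 * b) * ∑ i, ∑ j,
      (h.basis.tensorProduct h.basis).repr s (i, j) * (M.defect S Λ a b i j l k : ℝ) = 0 := by
    rw [← h2]
    simp only [Finset.mul_sum]
    refine Finset.sum_congr rfl fun i _ => Finset.sum_congr rfl fun j _ => ?_
    ring
  refine (mul_eq_zero.1 h3).resolve_left ?_
  positivity

/-- The defect is skew in its first two indices, so the sum over all pairs folds to one over
unordered pairs, weighted by the bivector coordinates. -/
theorem dotList_system (h : Describes r M t)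
    (hΛ : ∀ j l, M.ric S j l = if j = l then Λ * M.w S j else 0) {a b : ℤ} (hb : b ≠ 0)
    {s : r.Ext ⊗[ℝ] r.Ext} (hs : s ∈ (r.metric S).eigenbivectors (a / b))
    {pairs : List ((Fin r.n ⊕ Unit) × (Fin r.n ⊕ Unit))} (hp : IsPairList pairs)
    {row : List ℤ} (hrow : row ∈ M.system S pairs Λ a b) :
    dotList row (pairs.map fun p => bivectorCoord h.basis p s) = 0 := by
  obtain ⟨q, -, rfl⟩ := List.mem_map.1 hrow
  rw [dotList_map, ← h.sum_defect hΛ hb hs q.2 q.1, hp.sum]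
  · rfl
  · intro i j
    rw [M.defect_swap]
    simp

theorem length_of_mem_system {pairs : List ((Fin r.n ⊕ Unit) × (Fin r.n ⊕ Unit))} {a b : ℤ}
    {row : List ℤ} (hrow : row ∈ M.system S pairs Λ a b) : row.length = pairs.length := by
  obtain ⟨q, -, rfl⟩ := List.mem_map.1 hrow
  simp

theorem bivectorCoord_eq_zero {h : Describes r M t}
    {pairs : List ((Fin r.n ⊕ Unit) × (Fin r.n ⊕ Unit))} (hp : IsPairList pairs)
    {s : r.Ext ⊗[ℝ] r.Ext} (hs : ∀ p ∈ pairs, bivectorCoord h.basis p s = 0)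
    (p : (Fin r.n ⊕ Unit) × (Fin r.n ⊕ Unit)) : bivectorCoord h.basis p s = 0 := by
  have hsw : ∀ p, bivectorCoord h.basis p.swap s = -bivectorCoord h.basis p s := by
    intro p
    simp [bivectorCoord]
  rcases hp.mem p.1 p.2 with h1 | h1 | h1
  · have : p.swap = p := Prod.ext h1.symm h1
    have h2 := hsw p
    rw [this] at h2
    linarith
  · exact hs p h1
  · have h2 := hsw p
    rw [show p.swap = (p.2, p.1) from rfl, hs _ h1] at h2
    linarith

/-- If the linear system has only the zero solution, there are no nonzero eigenbivectors. -/
theorem comm_eq_self (h : Describes r M t)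
    (hΛ : ∀ j l, M.ric S j l = if j = l then Λ * M.w S j else 0) {a b : ℤ} (hb : b ≠ 0)
    {pairs : List ((Fin r.n ⊕ Unit) × (Fin r.n ⊕ Unit))} (hp : IsPairList pairs)
    (ho : onlyZero pairs.length (M.system S pairs Λ a b) = true)
    {s : r.Ext ⊗[ℝ] r.Ext} (hs : s ∈ (r.metric S).eigenbivectors (a / b)) :
    TensorProduct.comm ℝ _ _ s = s := by
  refine comm_eq_self_of_bivectorCoord (b := h.basis) (bivectorCoord_eq_zero hp fun p hpp => ?_)
  exact eq_zero_of_onlyZero _ _ (pairs.map fun p => bivectorCoord h.basis p s) ho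
    (fun row hrow => length_of_mem_system hrow) (by simp)
    (fun row hrow => h.dotList_system hΛ hb hs hp hrow) _ (List.mem_map.2 ⟨p, hpp, rfl⟩)

/-- If the linear system together with the vanishing of the first coordinate has only the zero
solution, the eigenbivectors are multiples of a given solution `v`. -/
theorem bivectorCoord_eq (h : Describes r M t)
    (hΛ : ∀ j l, M.ric S j l = if j = l then Λ * M.w S j else 0) {a b : ℤ} (hb : b ≠ 0)
    {p₀ : (Fin r.n ⊕ Unit) × (Fin r.n ⊕ Unit)}
    {pairs : List ((Fin r.n ⊕ Unit) × (Fin r.n ⊕ Unit))} (hp : IsPairList (p₀ :: pairs))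
    (v : (Fin r.n ⊕ Unit) × (Fin r.n ⊕ Unit) → ℤ) (hv0 : v p₀ = 1)
    (hv : ∀ q ∈ p₀ :: pairs,
      ((p₀ :: pairs).map fun p => v p * M.defect S Λ a b p.1 p.2 q.2 q.1).sum = 0)
    (ho : onlyZero pairs.length ((M.system S (p₀ :: pairs) Λ a b).map List.tail) = true)
    {s : r.Ext ⊗[ℝ] r.Ext} (hs : s ∈ (r.metric S).eigenbivectors (a / b)) :
    ∀ p ∈ p₀ :: pairs, bivectorCoord h.basis p s = bivectorCoord h.basis p₀ s * v p := by
  set c := bivectorCoord h.basis p₀ s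
  -- Subtracting c v from the coordinates of s gives a solution with zero first coordinate. The
  -- system with its first column deleted forces the remaining coordinates to vanish.
  have key := eq_zero_of_onlyZero _ _ (pairs.map fun p => bivectorCoord h.basis p s - c * v p) ho
    ?_ (by simp) ?_
  · intro p hpp
    rcases List.mem_cons.1 hpp with rfl | hpp
    · simp [hv0, c]
    · exact sub_eq_zero.1 (key _ (List.mem_map.2 ⟨p, hpp, rfl⟩))
  · intro row hrow
    obtain ⟨row', hrow', rfl⟩ := List.mem_map.1 hrow
    simp [length_of_mem_system hrow']
  · intro row hrow
    obtain ⟨row', hrow', rfl⟩ := List.mem_map.1 hrow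
    have h1 := h.dotList_system hΛ hb hs hp hrow'
    obtain ⟨q, hq, rfl⟩ := List.mem_map.1 hrow'
    have h2 := hv q hq
    simp only [List.map_cons, List.tail_cons, List.sum_cons, dotList, hv0] at h1 h2 ⊢
    rw [dotList_map] at h1 ⊢
    have h3 : (pairs.map fun p => (bivectorCoord h.basis p s - c * v p) *
        (M.defect S Λ a b p.1 p.2 q.2 q.1 : ℝ)).sum =
        (pairs.map fun p => bivectorCoord h.basis p s *
          (M.defect S Λ a b p.1 p.2 q.2 q.1 : ℝ)).sum -
        c * ((pairs.map fun p => v p * M.defect S Λ a b p.1 p.2 q.2 q.1).sum : ℤ) := by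
      clear * -
      induction pairs with
      | nil => simp
      | cons p l ih =>
        simp only [List.map_cons, List.sum_cons]
        rw [ih]
        push_cast
        ring
    rw [h3]
    have h4 : ((pairs.map fun p => v p * M.defect S Λ a b p.1 p.2 q.2 q.1).sum : ℝ) =
      - M.defect S Λ a b p₀.1 p₀.2 q.2 q.1 := by
      have : (pairs.map fun p => v p * M.defect S Λ a b p.1 p.2 q.2 q.1).sum =
        - M.defect S Λ a b p₀.1 p₀.2 q.2 q.1 := by linarith
      exact_mod_cast this
    rw [h4]
    linear_combination h1

/-- The eigenbivectors on which one coordinate vanishes are zero. -/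
theorem comm_eq_self_of_tail (h : Describes r M t)
    (hΛ : ∀ j l, M.ric S j l = if j = l then Λ * M.w S j else 0) {a b : ℤ} (hb : b ≠ 0)
    {p₀ : (Fin r.n ⊕ Unit) × (Fin r.n ⊕ Unit)}
    {pairs : List ((Fin r.n ⊕ Unit) × (Fin r.n ⊕ Unit))} (hp : IsPairList (p₀ :: pairs))
    (ho : onlyZero pairs.length ((M.system S (p₀ :: pairs) Λ a b).map List.tail) = true)
    {s : r.Ext ⊗[ℝ] r.Ext} (hs : s ∈ (r.metric S).eigenbivectors (a / b))
    (hs0 : bivectorCoord h.basis p₀ s = 0) : TensorProduct.comm ℝ _ _ s = s := by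
  refine comm_eq_self_of_bivectorCoord (b := h.basis) (bivectorCoord_eq_zero hp fun p hpp => ?_)
  rcases List.mem_cons.1 hpp with rfl | hpp
  · exact hs0
  refine eq_zero_of_onlyZero _ _ (pairs.map fun p => bivectorCoord h.basis p s) ho
    ?_ (by simp) ?_ _ (List.mem_map.2 ⟨p, hpp, rfl⟩)
  · intro row hrow
    obtain ⟨row', hrow', rfl⟩ := List.mem_map.1 hrow
    simp [length_of_mem_system hrow']
  · intro row hrow
    obtain ⟨row', hrow', rfl⟩ := List.mem_map.1 hrow
    have h1 := h.dotList_system hΛ hb hs hp hrow'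
    obtain ⟨q, hq, rfl⟩ := List.mem_map.1 hrow'
    simpa [dotList, hs0] using h1

end Describes
end IntModel
end EinsteinSolv

/-! ### The curvature of the rows of the table -/

namespace EinsteinSolv

open TensorProduct

/-- Restrictions on the curvature of a metric Lie algebra of dimension `n + 1`, which are invariant
under linear isomorphisms preserving the curvature. -/
structure HasGenericCurvature (n : ℕ) {L : Type*} [LieRing L] [LieAlgebra ℝ L]
    [FiniteDimensional ℝ L] (g : LieMetric L) : Prop where
  finrank : Module.finrank ℝ L = n + 1
  ricciForm_ne : g.ricciForm ≠ 0
  -- Excludes the extensions of abelian ideals, which have constant curvature and hence ratio 1/n to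
  -- the Ricci form.
  not_constant : ∃ x y z, g.curvature x y z ≠
    (1 / n : ℝ) • (g.ricciForm y z • x - g.ricciForm x z • y)
  -- Excludes complements 𝔞 of dimension greater than one: two vectors of 𝔞 give a decomposable
  -- kernel bivector.
  degenerate : ∀ x y, x ⊗ₜ y ∈ g.eigenbivectors 0 →
    g.ricciForm x x * g.ricciForm y y = g.ricciForm x y * g.ricciForm y x
  -- The kernel of the curvature operator on bivectors is at most one-dimensional, which excludes
  -- the extensions of the Heisenberg algebra.
  three : n = 3 → ∃ f : L ⊗[ℝ] L →ₗ[ℝ] ℝ,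
    ∀ s ∈ g.eigenbivectors 0, f s = 0 → TensorProduct.comm ℝ L L s = s
  -- 4/15 is not an eigenvalue, which excludes the filiform case. The eigenspace of 2/11 is at most
  -- one-dimensional, which excludes Heisenberg plus a line.
  four : n = 4 → (∀ s ∈ g.eigenbivectors (4 / 15), TensorProduct.comm ℝ L L s = s) ∧
    ∃ f : L ⊗[ℝ] L →ₗ[ℝ] ℝ,
      ∀ s ∈ g.eigenbivectors (2 / 11), f s = 0 → TensorProduct.comm ℝ L L s = s

theorem comm_congr {L L' : Type*} [AddCommGroup L] [Module ℝ L] [AddCommGroup L'] [Module ℝ L']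
    (e : L' ≃ₗ[ℝ] L) {s : L' ⊗[ℝ] L'}
    (h : TensorProduct.comm ℝ L L (TensorProduct.congr e e s) = TensorProduct.congr e e s) :
    TensorProduct.comm ℝ L' L' s = s := by
  refine (TensorProduct.congr e e).injective ?_
  rw [← h]
  have key : (TensorProduct.congr e e).toLinearMap ∘ₗ (TensorProduct.comm ℝ L' L').toLinearMap =
      (TensorProduct.comm ℝ L L).toLinearMap ∘ₗ (TensorProduct.congr e e).toLinearMap :=
    TensorProduct.ext' fun x y => by simp
  exact LinearMap.congr_fun key s

theorem HasGenericCurvature.of_equiv {n : ℕ} {L L' : Type*} [LieRing L] [LieAlgebra ℝ L]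
    [FiniteDimensional ℝ L] [LieRing L'] [LieAlgebra ℝ L'] [FiniteDimensional ℝ L']
    {g : LieMetric L} {g' : LieMetric L'} (h : HasGenericCurvature n g) (A : L ≃ₗ[ℝ] L')
    (hA : ∀ x y z, A (g.curvature x y z) = g'.curvature (A x) (A y) (A z)) :
    HasGenericCurvature n g' where
  finrank := by rw [← A.finrank_eq, h.finrank]
  ricciForm_ne h0 := h.ricciForm_ne (LinearMap.ext fun x => LinearMap.ext fun y => by
    rw [← ricciForm_of_curvature hA, h0]; rfl)
  not_constant := by
    obtain ⟨x, y, z, hxyz⟩ := h.not_constant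
    refine ⟨A x, A y, A z, fun h0 => hxyz (A.injective ?_)⟩
    rw [hA, h0, ricciForm_of_curvature hA, ricciForm_of_curvature hA]
    simp
  degenerate x y hxy := by
    have := h.degenerate (A.symm x) (A.symm y) (by simpa using congr_mem_eigenbivectors hA hxy)
    simpa only [← ricciForm_of_curvature hA, A.apply_symm_apply] using this
  three hn := by
    obtain ⟨f, hf⟩ := h.three hn
    exact ⟨f ∘ₗ (TensorProduct.congr A.symm A.symm).toLinearMap, fun s hs hs0 =>
      comm_congr A.symm (hf _ (congr_mem_eigenbivectors hA hs) hs0)⟩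
  four hn := by
    obtain ⟨h1, f, hf⟩ := h.four hn
    exact ⟨fun s hs => comm_congr A.symm (h1 _ (congr_mem_eigenbivectors hA hs)),
      f ∘ₗ (TensorProduct.congr A.symm A.symm).toLinearMap, fun s hs hs0 =>
      comm_congr A.symm (hf _ (congr_mem_eigenbivectors hA hs) hs0)⟩

/-- Apply the bilinear form (u,v) ↦ q(x,u) q(y,v) to x⊗y and to y⊗x. -/
theorem degenerate_of_comm {L : Type*} [AddCommGroup L] [Module ℝ L] (q : LinearMap.BilinForm ℝ L)
    {x y : L} (h : TensorProduct.comm ℝ L L (x ⊗ₜ y) = x ⊗ₜ y) : q x x * q y y = q x y * q y x := by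
  have := congrArg (TensorProduct.lift ((LinearMap.mul ℝ ℝ).compl₁₂ (q x) (q y))) h
  simp at this
  linarith

/-- The pairs of distinct basis vectors. -/
def pairsThree : List ((Fin 3 ⊕ Unit) × (Fin 3 ⊕ Unit)) :=
  -- The order matters: the head of the list is the coordinate p₀ that detects eigenbivectors when
  -- an eigenspace may be one-dimensional.
  [(.inl 0, .inl 2), (.inl 0, .inl 1), (.inl 1, .inl 2), (.inl 0, .inr ()), (.inl 1, .inr ()),
    (.inl 2, .inr ())]

/-- The pairs of distinct basis vectors. -/
def pairsFour : List ((Fin 4 ⊕ Unit) × (Fin 4 ⊕ Unit)) :=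
  [(.inl 0, .inl 2), (.inl 0, .inl 1), (.inl 0, .inl 3), (.inl 1, .inl 2), (.inl 1, .inl 3),
    (.inl 2, .inl 3), (.inl 0, .inr ()), (.inl 1, .inr ()), (.inl 2, .inr ()), (.inl 3, .inr ())]

theorem isPairList_three : IsPairList pairsThree where
  mem := by
    rintro (i | i) (j | j)
    · fin_cases i <;> fin_cases j <;> simp [pairsThree]
    · fin_cases i <;> simp [pairsThree]
    · fin_cases j <;> simp [pairsThree]
    · exact Or.inl rfl
  sum τ D hD := by
    have hd : ∀ i, D i i = 0 := fun i => by linarith [hD i i]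
    simp only [pairsThree, Fintype.sum_sum_type, Fin.sum_univ_three, Finset.univ_unique,
      Finset.sum_singleton, List.map_cons, List.map_nil, List.sum_cons, List.sum_nil, hd,
      PUnit.default_eq_unit]
    rw [hD (.inl 1) (.inl 0), hD (.inl 2) (.inl 0), hD (.inl 2) (.inl 1), hD (.inr ()) (.inl 0),
      hD (.inr ()) (.inl 1), hD (.inr ()) (.inl 2)]
    ring

theorem isPairList_four : IsPairList pairsFour where
  mem := by
    rintro (i | i) (j | j)
    · fin_cases i <;> fin_cases j <;> simp [pairsFour]
    · fin_cases i <;> simp [pairsFour]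
    · fin_cases j <;> simp [pairsFour]
    · exact Or.inl rfl
  sum τ D hD := by
    have hd : ∀ i, D i i = 0 := fun i => by linarith [hD i i]
    simp only [pairsFour, Fintype.sum_sum_type, Fin.sum_univ_four, Finset.univ_unique,
      Finset.sum_singleton, List.map_cons, List.map_nil, List.sum_cons, List.sum_nil, hd,
      PUnit.default_eq_unit]
    rw [hD (.inl 1) (.inl 0), hD (.inl 2) (.inl 0), hD (.inl 2) (.inl 1), hD (.inl 3) (.inl 0),
      hD (.inl 3) (.inl 1), hD (.inl 3) (.inl 2), hD (.inr ()) (.inl 0), hD (.inr ()) (.inl 1),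
      hD (.inr ()) (.inl 2), hD (.inr ()) (.inl 3)]
    ring

namespace IntModel.Describes

attribute [local instance 100] LieRing.ofAssociativeRing

variable {r : TableRow} {M : IntModel r.n} {t : Fin r.n → ℝ} {S : Finset ℕ} {Λ : ℤ}

theorem finrank_ext (h : Describes r M t) : Module.finrank ℝ r.Ext = r.n + 1 := by
  rw [Module.finrank_eq_card_basis h.basis]
  simp

/-- Evaluated on the last basis vector, whose `w` is 1, the Ricci form equals Λ/(4W²). -/
theorem ricciForm_ne (h : Describes r M t)
    (hΛ : ∀ j l, M.ric S j l = if j = l then Λ * M.w S j else 0) (h0 : Λ ≠ 0) :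
    (r.metric S).ricciForm ≠ 0 := by
  intro hr
  have h1 := h.ricciForm_basis hΛ (.inr ()) (.inr ())
  have hW : (M.W : ℝ) ≠ 0 := by exact_mod_cast h.W_ne
  have hΛ0 : (Λ : ℝ) ≠ 0 := by exact_mod_cast h0
  rw [hr] at h1
  have : (Λ : ℝ) * M.w S (.inr ()) / (4 * M.W ^ 2) = 0 := by simpa using h1.symm
  simp [w, hW, hΛ0] at this

theorem not_constant (h : Describes r M t)
    (hΛ : ∀ j l, M.ric S j l = if j = l then Λ * M.w S j else 0) (i j l k : Fin r.n ⊕ Unit)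
    (hn : r.n ≠ 0) (hd : M.defect S Λ 1 r.n i j l k ≠ 0) :
    ∃ x y z, (r.metric S).curvature x y z ≠
      (1 / r.n : ℝ) • ((r.metric S).ricciForm y z • x - (r.metric S).ricciForm x z • y) := by
  refine ⟨h.basis i, h.basis j, h.basis l, fun h0 => ?_⟩
  have h1 := h.form_curvatureDefect hΛ (a := 1) (b := r.n) (by exact_mod_cast hn) i j l k
  rw [LieMetric.curvatureDefect_apply, h0] at h1
  have hW : (M.W : ℝ) ≠ 0 := by exact_mod_cast h.W_ne
  have hκ : (M.κ : ℝ) ≠ 0 := by exact_mod_cast h.κ_ne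
  have hn' : (r.n : ℝ) ≠ 0 := by exact_mod_cast hn
  have hd' : (M.defect S Λ 1 r.n i j l k : ℝ) ≠ 0 := by exact_mod_cast hd
  push_cast at h1
  rw [sub_self, map_zero, LinearMap.zero_apply] at h1
  have : (M.κ : ℝ) ^ 2 / (4 * M.W ^ 2 * r.n) * M.defect S Λ 1 r.n i j l k ≠ 0 := by positivity
  exact this h1.symm

/-- A criterion for generic curvature in terms of the integral model. -/
theorem hasGenericCurvature_four (h : Describes r M t) (hn : r.n = 4)
    (hΛ : ∀ j l, M.ric S j l = if j = l then Λ * M.w S j else 0) (h0 : Λ ≠ 0)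
    {p₀ : (Fin r.n ⊕ Unit) × (Fin r.n ⊕ Unit)}
    {pairs : List ((Fin r.n ⊕ Unit) × (Fin r.n ⊕ Unit))} (hp : IsPairList (p₀ :: pairs))
    (i j l k : Fin r.n ⊕ Unit) (hd : M.defect S Λ 1 r.n i j l k ≠ 0)
    (h₁ : onlyZero (pairs.length + 1) (M.system S (p₀ :: pairs) Λ 0 1) = true)
    (h₂ : onlyZero (pairs.length + 1) (M.system S (p₀ :: pairs) Λ 4 15) = true)
    (h₃ : onlyZero pairs.length ((M.system S (p₀ :: pairs) Λ 2 11).map List.tail) = true) :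
    HasGenericCurvature r.n (r.metric S) where
  finrank := h.finrank_ext
  ricciForm_ne := h.ricciForm_ne hΛ h0
  not_constant := h.not_constant hΛ i j l k (by omega) hd
  degenerate x y hxy := degenerate_of_comm _ (h.comm_eq_self hΛ one_ne_zero hp h₁ (by simpa using hxy))
  three hn' := by omega
  four _ := ⟨fun s hs => h.comm_eq_self hΛ (a := 4) (b := 15) (by norm_num) hp h₂
      (by push_cast; exact hs), bivectorCoord h.basis p₀, fun s hs hs0 =>
      h.comm_eq_self_of_tail hΛ (a := 2) (b := 11) (by norm_num) hp h₃ (by push_cast; exact hs) hs0⟩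

end IntModel.Describes
end EinsteinSolv

namespace EinsteinSolv

open TensorProduct

theorem IsFrame.form_repr {L : Type*} [LieRing L] [LieAlgebra ℝ L] {ι : Type*} [Fintype ι]
    [DecidableEq ι] {g : LieMetric L} {b : Module.Basis ι ℝ L} {C : ι → ι → ι → ℝ} {w u : ι → ℝ}
    {W ρ : ℝ} (h : IsFrame g b C w u W ρ) (x y : L) :
    g.form x y = ρ * ∑ i, w i * (b.repr x i * b.repr y i) := by
  conv_lhs => rw [← b.sum_repr x]
  rw [map_sum, LinearMap.sum_apply, Finset.mul_sum]
  refine Finset.sum_congr rfl fun i _ => ?_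
  conv_lhs => rw [← b.sum_repr y]
  rw [map_smul, LinearMap.smul_apply, h.form_sum_right, smul_eq_mul]
  ring

namespace IntModel.Describes

attribute [local instance 100] LieRing.ofAssociativeRing

variable {r : TableRow} {M : IntModel r.n} {t : Fin r.n → ℝ} {S : Finset ℕ} {Λ : ℤ}

/-- Here the curvature operator has no kernel, so the zero functional serves in the clause for n =
3. -/
theorem hasGenericCurvature_three (h : Describes r M t) (hn : r.n = 3)
    (hΛ : ∀ j l, M.ric S j l = if j = l then Λ * M.w S j else 0) (h0 : Λ ≠ 0)
    {pairs : List ((Fin r.n ⊕ Unit) × (Fin r.n ⊕ Unit))} (hp : IsPairList pairs)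
    (i j l k : Fin r.n ⊕ Unit) (hd : M.defect S Λ 1 r.n i j l k ≠ 0)
    (h₁ : onlyZero pairs.length (M.system S pairs Λ 0 1) = true) :
    HasGenericCurvature r.n (r.metric S) where
  finrank := h.finrank_ext
  ricciForm_ne := h.ricciForm_ne hΛ h0
  not_constant := h.not_constant hΛ i j l k (by omega) hd
  degenerate x y hxy := degenerate_of_comm _ (h.comm_eq_self hΛ one_ne_zero hp h₁ (by simpa using hxy))
  three _ := ⟨0, fun s hs _ => h.comm_eq_self hΛ one_ne_zero hp h₁ (by simpa using hs)⟩
  four hn' := by omega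

/-- The case of a one-dimensional space of eigenbivectors with eigenvalue zero. -/
theorem hasGenericCurvature_of_kernel (h : Describes r M t) (hn : r.n = 3)
    (hΛ : ∀ j l, M.ric S j l = if j = l then Λ * M.w S j else 0) (h0 : Λ ≠ 0)
    {p₀ : (Fin r.n ⊕ Unit) × (Fin r.n ⊕ Unit)}
    {pairs : List ((Fin r.n ⊕ Unit) × (Fin r.n ⊕ Unit))} (hp : IsPairList (p₀ :: pairs))
    (i j l k : Fin r.n ⊕ Unit) (hd : M.defect S Λ 1 r.n i j l k ≠ 0)
    (v : (Fin r.n ⊕ Unit) × (Fin r.n ⊕ Unit) → ℤ) (hv0 : v p₀ = 1)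
    (hv : ∀ q ∈ p₀ :: pairs,
      ((p₀ :: pairs).map fun p => v p * M.defect S Λ 0 1 p.1 p.2 q.2 q.1).sum = 0)
    (ho : onlyZero pairs.length ((M.system S (p₀ :: pairs) Λ 0 1).map List.tail) = true)
    (hdeg : ∀ (x y : Fin r.n ⊕ Unit → ℝ) (c : ℝ),
      (∀ p ∈ p₀ :: pairs, x p.1 * y p.2 - x p.2 * y p.1 = c * v p) →
      (∑ i, M.w S i * (x i * x i)) * (∑ i, M.w S i * (y i * y i)) =
        (∑ i, M.w S i * (x i * y i)) * (∑ i, M.w S i * (y i * x i))) :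
    HasGenericCurvature r.n (r.metric S) where
  finrank := h.finrank_ext
  ricciForm_ne := h.ricciForm_ne hΛ h0
  not_constant := h.not_constant hΛ i j l k (by omega) hd
  degenerate x y hxy := by
    -- A decomposable kernel bivector x∧y is a multiple of v, and `hdeg` says that such a plane is
    -- degenerate.
    have h1 := h.bivectorCoord_eq hΛ one_ne_zero hp v hv0 hv ho (by simpa using hxy)
    have h2 := hdeg (h.basis.repr x) (h.basis.repr y) _ fun p hpp => by
      rw [← bivectorCoord_tmul]; exact h1 p hpp
    simp only [(h.isFrame S).ricciForm_eq (ricArr_eq hΛ), (h.isFrame S).form_repr]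
    linear_combination (Λ / (4 * M.W ^ 2 * M.κ ^ 2) * (M.κ : ℝ) ^ 2) ^ 2 * h2
  three _ := ⟨bivectorCoord h.basis p₀, fun s hs hs0 =>
    h.comm_eq_self_of_tail hΛ one_ne_zero hp ho (by simpa using hs) hs0⟩
  four hn' := by omega

end IntModel.Describes

/-! ### Integral models of the nine rows and their Einstein equations. -/

section Rows

open IntModel

theorem describes_mk {n : ℕ} {d : Fin n → Matrix (Fin n) (Fin n) ℝ} {jac D leib sig}
    {M : IntModel n} {t : Fin n → ℝ} (sq : ∀ i, t i ^ 2 = M.τ i)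
    (hd : ∀ k i j, M.κ * t i * t j * d k i j = M.d k i j * t k)
    (hD : ∀ k j, M.κ * t j * D k j = M.D k j * t k)
    (hκ : M.κ ≠ 0) (hW : M.W ≠ 0) (dvd : ∀ i, M.τ i ∣ M.W) :
    Describes ⟨n, d, jac, D, leib, sig⟩ M t :=
  ⟨sq, hd, hD, hκ, hW, dvd⟩

theorem mul_single_eq {n : ℕ} {t : Fin n → ℝ} {κ c s : ℝ} {a b : Fin n} {z : ℤ}
    (h : κ * t a * t b * c = z * s) (i j : Fin n) :
    κ * t i * t j * Matrix.single a b c i j = (Matrix.single a b z i j : ℤ) * s := by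
  rw [Matrix.single_apply, Matrix.single_apply]
  split_ifs with hij
  · rw [← hij.1, ← hij.2, h]
  · simp

theorem mul_zero_eq {n : ℕ} {t : Fin n → ℝ} {κ s : ℝ} (i j : Fin n) :
    κ * t i * t j * (0 : Matrix (Fin n) (Fin n) ℝ) i j =
      ((0 : Matrix (Fin n) (Fin n) ℤ) i j : ℤ) * s := by
  simp

theorem mul_diagonal_eq {n : ℕ} {t v : Fin n → ℝ} {κ : ℝ} {z : Fin n → ℤ}
    (h : ∀ i, κ * v i = z i) (k j : Fin n) :
    κ * t j * Matrix.diagonal v k j = (Matrix.diagonal z k j : ℤ) * t k := by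
  rw [Matrix.diagonal_apply, Matrix.diagonal_apply]
  split_ifs with hij
  · rw [hij, ← h]; ring
  · simp

theorem mul_add_single_eq {n : ℕ} {t : Fin n → ℝ} {κ c : ℝ} {a b : Fin n} {z : ℤ}
    {D : Matrix (Fin n) (Fin n) ℝ} {E : Matrix (Fin n) (Fin n) ℤ}
    (hD : ∀ k j, κ * t j * D k j = E k j * t k) (h : κ * t b * c = z * t a) (k j : Fin n) :
    κ * t j * (D + Matrix.single a b c) k j = ((E + Matrix.single a b z) k j : ℤ) * t k := by
  rw [Matrix.add_apply, Matrix.add_apply, mul_add, hD, Matrix.single_apply, Matrix.single_apply,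
    Int.cast_add, add_mul]
  congr 1
  split_ifs with hij
  · rw [← hij.1, ← hij.2, h]
  · simp

/-- The integral model of `row31`. -/
def model31 : IntModel 3 where
  κ := 7
  d := ![0, 0, Matrix.single 0 1 4]
  D := Matrix.diagonal ![6, -2, 4] + Matrix.single 1 0 8
  τ := ![1, 1, 1]
  W := 1

theorem describes_row31 : Describes row31 model31 ![1, 1, 1] := by
  refine describes_mk ?_ ?_ ?_ (by decide) (by decide) (by decide)
  · intro i
    fin_cases i <;> simp [model31]
  · intro k
    fin_cases k
    · exact mul_zero_eq
    · exact mul_zero_eq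
    · refine mul_single_eq ?_
      simp [model31]
      ring
  · refine mul_add_single_eq (mul_diagonal_eq ?_) ?_
    · intro i
      fin_cases i <;> norm_num [model31]
    · simp [model31]
      ring

/-- The integer Λ equals 4W²κ² times the Einstein constant, as in every row below; here the constant
is −24/49. A finite check over the signatures and index pairs suffices. -/
theorem ric_model31 : ∀ S ∈ row31.signatures, ∀ j l,
    model31.ric S j l = if j = l then -96 * model31.w S j else 0 := by
  decide +kernel

/-- The integral model of `row3`. -/
def model3 : IntModel 3 where
  κ := 5
  d := 0
  D := Matrix.diagonal ![5, -1, 2] + Matrix.single 1 0 6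
  τ := ![1, 1, 1]
  W := 1

theorem describes_row3 : Describes row3 model3 ![1, 1, 1] := by
  refine describes_mk ?_ ?_ ?_ (by decide) (by decide) (by decide)
  · intro i
    fin_cases i <;> simp [model3]
  · exact fun k => mul_zero_eq
  · refine mul_add_single_eq (mul_diagonal_eq ?_) ?_
    · intro i
      fin_cases i <;> norm_num [model3]
    · simp [model3]
      ring

theorem ric_model3 : ∀ S ∈ row3.signatures, ∀ j l,
    model3.ric S j l = if j = l then -48 * model3.w S j else 0 := by
  decide +kernel

/-- The integral model of `row421`. -/
def model421 : IntModel 4 where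
  κ := 51
  d := ![0, 0, Matrix.single 0 1 42, Matrix.single 0 2 14]
  D := Matrix.diagonal ![28, -21, 7, 35] + Matrix.single 1 0 7
  τ := ![1, 66, 22, 187]
  W := 1122

/-- The scalings are chosen so that every root is absorbed: √3·√66 = 3√22 and √34·√22 = 2√187, while
the off-diagonal entry of D contains √66 itself. W is the least common multiple of the τ_i. -/
theorem describes_row421 : Describes row421 model421 ![1, √66, √22, √187] := by
  refine describes_mk ?_ ?_ ?_ (by decide) (by decide) (by decide)
  · intro i
    fin_cases i <;> simp [model421]
  · intro k
    fin_cases k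
    · exact mul_zero_eq
    · exact mul_zero_eq
    · refine mul_single_eq ?_
      have h1 := Real.mul_self_sqrt (show (0 : ℝ) ≤ 3 by norm_num)
      have h2 : √(66 : ℝ) = √3 * √22 := by rw [← Real.sqrt_mul (by norm_num)]; norm_num
      simp [model421, h2]
      linear_combination 14 * √22 * h1
    · refine mul_single_eq ?_
      have h1 := Real.mul_self_sqrt (show (0 : ℝ) ≤ 2 by norm_num)
      have h2 : √(22 : ℝ) = √2 * √11 := by rw [← Real.sqrt_mul (by norm_num)]; norm_num
      have h3 : √(34 : ℝ) = √2 * √17 := by rw [← Real.sqrt_mul (by norm_num)]; norm_num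
      have h4 : √(187 : ℝ) = √11 * √17 := by rw [← Real.sqrt_mul (by norm_num)]; norm_num
      simp [model421, h2, h3, h4]
      linear_combination 7 * √11 * √17 * h1
  · refine mul_add_single_eq (mul_diagonal_eq ?_) ?_
    · intro i
      fin_cases i <;> norm_num [model421]
    · simp [model421]
      ring

theorem ric_model421 : ∀ S ∈ row421.signatures, ∀ j l,
    model421.ric S j l = if j = l then -4441342752 * model421.w S j else 0 := by
  decide +kernel

/-- The integral model of `row41a`. -/
def model41a : IntModel 4 where
  κ := 17
  d := ![0, 0, 0, Matrix.single 0 1 2]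
  D := Matrix.diagonal ![15, -7, 6, 8] + Matrix.single 1 0 22
  τ := ![1, 1, 1, 22]
  W := 22

theorem describes_row41a : Describes row41a model41a ![1, 1, 1, √22] := by
  refine describes_mk ?_ ?_ ?_ (by decide) (by decide) (by decide)
  · intro i
    fin_cases i <;> simp [model41a]
  · intro k
    fin_cases k
    · exact mul_zero_eq
    · exact mul_zero_eq
    · exact mul_zero_eq
    · refine mul_single_eq ?_
      simp [model41a]
      ring
  · refine mul_add_single_eq (mul_diagonal_eq ?_) ?_
    · intro i
      fin_cases i <;> norm_num [model41a]
    · simp [model41a]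
      ring

theorem ric_model41a : ∀ S ∈ row41a.signatures, ∀ j l,
    model41a.ric S j l = if j = l then -255552 * model41a.w S j else 0 := by
  decide +kernel

/-- The integral model of `row41b`. -/
def model41b : IntModel 4 where
  κ := 1
  d := ![0, 0, 0, Matrix.single 0 1 2]
  D := Matrix.diagonal ![0, 0, 1, 0] + Matrix.single 3 2 2
  τ := ![1, 6, 3, 1]
  W := 6

theorem describes_row41b : Describes row41b model41b ![1, √6, √3, 1] := by
  refine describes_mk ?_ ?_ ?_ (by decide) (by decide) (by decide)
  · intro i
    fin_cases i <;> simp [model41b]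
  · intro k
    fin_cases k
    · exact mul_zero_eq
    · exact mul_zero_eq
    · exact mul_zero_eq
    · refine mul_single_eq ?_
      have h1 := Real.mul_self_sqrt (show (0 : ℝ) ≤ 6 by norm_num)
      simp [model41b]
      linear_combination 1 / 3 * h1
  · refine mul_add_single_eq (mul_diagonal_eq ?_) ?_
    · intro i
      fin_cases i <;> norm_num [model41b]
    · have h1 := Real.mul_self_sqrt (show (0 : ℝ) ≤ 3 by norm_num)
      simp [model41b]
      linear_combination 2 / 3 * h1

theorem ric_model41b : ∀ S ∈ row41b.signatures, ∀ j l,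
    model41b.ric S j l = if j = l then -48 * model41b.w S j else 0 := by
  decide +kernel

/-- The integral model of `row41c`. -/
def model41c : IntModel 4 where
  κ := 3
  d := ![0, 0, 0, Matrix.single 0 1 1]
  D := Matrix.diagonal ![2, 0, -1, 2] + Matrix.single 2 0 2
  τ := ![1, 1, 3, 6]
  W := 6

theorem describes_row41c : Describes row41c model41c ![1, 1, √3, √6] := by
  refine describes_mk ?_ ?_ ?_ (by decide) (by decide) (by decide)
  · intro i
    fin_cases i <;> simp [model41c]
  · intro k
    fin_cases k
    · exact mul_zero_eq
    · exact mul_zero_eq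
    · exact mul_zero_eq
    · refine mul_single_eq ?_
      simp [model41c]
  · refine mul_add_single_eq (mul_diagonal_eq ?_) ?_
    · intro i
      fin_cases i <;> norm_num [model41c]
    · simp [model41c]
      ring

theorem ric_model41c : ∀ S ∈ row41c.signatures, ∀ j l,
    model41c.ric S j l = if j = l then -432 * model41c.w S j else 0 := by
  decide +kernel

/-- The integral model of `row41d`. -/
def model41d : IntModel 4 where
  κ := 9
  d := ![0, 0, 0, Matrix.single 0 1 2]
  D := Matrix.diagonal ![3, -3, 6, 0] + Matrix.single 1 0 6 + Matrix.single 3 2 4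
  τ := ![1, 1, 2, 6]
  W := 6

theorem describes_row41d : Describes row41d model41d ![1, 1, √2, √6] := by
  refine describes_mk ?_ ?_ ?_ (by decide) (by decide) (by decide)
  · intro i
    fin_cases i <;> simp [model41d]
  · intro k
    fin_cases k
    · exact mul_zero_eq
    · exact mul_zero_eq
    · exact mul_zero_eq
    · refine mul_single_eq ?_
      simp [model41d]
      ring
  · refine mul_add_single_eq (mul_add_single_eq (mul_diagonal_eq ?_) ?_) ?_
    · intro i
      fin_cases i <;> norm_num [model41d]
    · simp [model41d]
      ring
    · have h1 : √(6 : ℝ) = √2 * √3 := by rw [← Real.sqrt_mul (by norm_num)]; norm_num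
      simp [model41d, h1]
      ring

theorem ric_model41d : ∀ S ∈ row41d.signatures, ∀ j l,
    model41d.ric S j l = if j = l then -1728 * model41d.w S j else 0 := by
  decide +kernel

/-- The integral model of `row4a`. -/
def model4a : IntModel 4 where
  κ := 3
  d := 0
  D := Matrix.diagonal ![3, -1, 1, 1] + Matrix.single 1 0 4
  τ := ![1, 1, 1, 1]
  W := 1

theorem describes_row4a : Describes row4a model4a ![1, 1, 1, 1] := by
  refine describes_mk ?_ ?_ ?_ (by decide) (by decide) (by decide)
  · intro i
    fin_cases i <;> simp [model4a]
  · exact fun k => mul_zero_eq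
  · refine mul_add_single_eq (mul_diagonal_eq ?_) ?_
    · intro i
      fin_cases i <;> norm_num [model4a]
    · simp [model4a]
      ring

theorem ric_model4a : ∀ S ∈ row4a.signatures, ∀ j l,
    model4a.ric S j l = if j = l then -16 * model4a.w S j else 0 := by
  decide +kernel

/-- The integral model of `row4b`. -/
def model4b : IntModel 4 where
  κ := 5
  d := 0
  D := Matrix.diagonal ![3, 3, -1, -1] + Matrix.single 2 0 4 + Matrix.single 3 1 4
  τ := ![1, 1, 1, 1]
  W := 1

theorem describes_row4b : Describes row4b model4b ![1, 1, 1, 1] := by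
  refine describes_mk ?_ ?_ ?_ (by decide) (by decide) (by decide)
  · intro i
    fin_cases i <;> simp [model4b]
  · exact fun k => mul_zero_eq
  · refine mul_add_single_eq (mul_add_single_eq (mul_diagonal_eq ?_) ?_) ?_
    · intro i
      fin_cases i <;> norm_num [model4b]
    · simp [model4b]
      ring
    · simp [model4b]
      ring

theorem ric_model4b : ∀ S ∈ row4b.signatures, ∀ j l,
    model4b.ric S j l = if j = l then -16 * model4b.w S j else 0 := by
  decide +kernel

end Rows

end EinsteinSolv

namespace EinsteinSolv

/-! ### Generic curvature of the nine rows. -/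

section Rows

open IntModel

/-- Coordinates of the bivector `(e₁ + e₂) ∧ (e₃ + ε e₀)`. -/
def kernelThree (ε : ℤ) (p : (Fin 3 ⊕ Unit) × (Fin 3 ⊕ Unit)) : ℤ :=
  if p = (.inl 0, .inl 2) ∨ p = (.inl 1, .inl 2) then 1 else
    if p = (.inl 0, .inr ()) ∨ p = (.inl 1, .inr ()) then ε else 0

/-- By Lagrange's identity the Gram determinant of x, y is the sum over i < j of w_i w_j (x_i y_j −
x_j y_i)². For a multiple of the given bivector it vanishes: e₁ + e₂ is null and orthogonal to e₃ +
ε e₀. -/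
theorem gram_eq_of_kernelThree {w : Fin 3 ⊕ Unit → ℤ} {ε : ℤ}
    (h01 : w (.inl 0) + w (.inl 1) = 0) (h2 : ε ^ 2 * w (.inr ()) + w (.inl 2) = 0)
    (x y : Fin 3 ⊕ Unit → ℝ) (c : ℝ)
    (hp : ∀ p ∈ pairsThree, x p.1 * y p.2 - x p.2 * y p.1 = c * kernelThree ε p) :
    (∑ i, w i * (x i * x i)) * (∑ i, w i * (y i * y i)) =
      (∑ i, w i * (x i * y i)) * (∑ i, w i * (y i * x i)) := by
  have e1 := hp (.inl 0, .inl 1) (by simp [pairsThree])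
  have e2 := hp (.inl 0, .inl 2) (by simp [pairsThree])
  have e3 := hp (.inl 1, .inl 2) (by simp [pairsThree])
  have e4 := hp (.inl 0, .inr ()) (by simp [pairsThree])
  have e5 := hp (.inl 1, .inr ()) (by simp [pairsThree])
  have e6 := hp (.inl 2, .inr ()) (by simp [pairsThree])
  simp [kernelThree] at e1 e2 e3 e4 e5 e6
  have hw0 : (w (.inl 1) : ℝ) = -w (.inl 0) := by exact_mod_cast (eq_neg_of_add_eq_zero_right h01)
  have hw2 : (w (.inl 2) : ℝ) = -(ε ^ 2 * w (.inr ())) := by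
    exact_mod_cast (eq_neg_of_add_eq_zero_right h2)
  simp only [Fintype.sum_sum_type, Fin.sum_univ_three, Finset.univ_unique,
    Finset.sum_singleton, PUnit.default_eq_unit, hw0, hw2]
  have key : ∀ {a b : ℝ}, a = b → a ^ 2 = b ^ 2 := fun h => by rw [h]
  -- The terms of Lagrange's identity, one for each coordinate of the bivector.
  linear_combination (w (.inl 0) : ℝ) * -w (.inl 0) * key e1 +
    (w (.inl 0) : ℝ) * -(ε ^ 2 * w (.inr ())) * key e2 +
    (-w (.inl 0) : ℝ) * -(ε ^ 2 * w (.inr ())) * key e3 +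
    (w (.inl 0) : ℝ) * w (.inr ()) * key e4 + (-w (.inl 0) : ℝ) * w (.inr ()) * key e5 +
    -((ε : ℝ) ^ 2 * w (.inr ())) * w (.inr ()) * key e6

theorem generic_row31 : ∀ S ∈ row31.signatures, HasGenericCurvature 3 (row31.metric S) := by
  intro S hS
  refine describes_row31.hasGenericCurvature_of_kernel rfl (ric_model31 S hS) (by decide)
    isPairList_three (.inl 0 : Fin 3 ⊕ Unit) (.inl 2 : Fin 3 ⊕ Unit) (.inl 2 : Fin 3 ⊕ Unit)
    -- The kernel is spanned by (e₁ + e₂) ∧ (e₃ + ε e₀), where ε depends on which of e₁, e₂ is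
    -- timelike.
    (.inl 0 : Fin 3 ⊕ Unit) ?_ (kernelThree (if 1 ∈ S then 1 else -1))
    rfl ?_ ?_ (gram_eq_of_kernelThree (w := model31.w S) ?_ ?_) <;> revert S <;> decide +kernel

theorem generic_row3 : ∀ S ∈ row3.signatures, HasGenericCurvature 3 (row3.metric S) := by
  intro S hS
  refine describes_row3.hasGenericCurvature_three rfl (ric_model3 S hS) (by decide)
    isPairList_three (.inl 0 : Fin 3 ⊕ Unit) (.inl 2 : Fin 3 ⊕ Unit) (.inl 2 : Fin 3 ⊕ Unit) (.inl 0 : Fin 3 ⊕ Unit) ?_ ?_ <;> revert S <;> decide +kernel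

theorem generic_row421 : ∀ S ∈ row421.signatures, HasGenericCurvature 4 (row421.metric S) := by
  intro S hS
  refine describes_row421.hasGenericCurvature_four rfl (ric_model421 S hS) (by decide)
    isPairList_four (.inl 0 : Fin 4 ⊕ Unit) (.inl 2 : Fin 4 ⊕ Unit) (.inl 2 : Fin 4 ⊕ Unit) (.inl 0 : Fin 4 ⊕ Unit) ?_ ?_ ?_ ?_ <;> revert S <;> decide +kernel

theorem generic_row41a : ∀ S ∈ row41a.signatures, HasGenericCurvature 4 (row41a.metric S) := by
  intro S hS
  refine describes_row41a.hasGenericCurvature_four rfl (ric_model41a S hS) (by decide)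
    isPairList_four (.inl 0 : Fin 4 ⊕ Unit) (.inl 2 : Fin 4 ⊕ Unit) (.inl 2 : Fin 4 ⊕ Unit) (.inl 0 : Fin 4 ⊕ Unit) ?_ ?_ ?_ ?_ <;> revert S <;> decide +kernel

theorem generic_row41b : ∀ S ∈ row41b.signatures, HasGenericCurvature 4 (row41b.metric S) := by
  intro S hS
  refine describes_row41b.hasGenericCurvature_four rfl (ric_model41b S hS) (by decide)
    isPairList_four (.inl 0 : Fin 4 ⊕ Unit) (.inl 2 : Fin 4 ⊕ Unit) (.inl 2 : Fin 4 ⊕ Unit) (.inl 0 : Fin 4 ⊕ Unit) ?_ ?_ ?_ ?_ <;> revert S <;> decide +kernel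

theorem generic_row41c : ∀ S ∈ row41c.signatures, HasGenericCurvature 4 (row41c.metric S) := by
  intro S hS
  refine describes_row41c.hasGenericCurvature_four rfl (ric_model41c S hS) (by decide)
    isPairList_four (.inl 0 : Fin 4 ⊕ Unit) (.inl 2 : Fin 4 ⊕ Unit) (.inl 2 : Fin 4 ⊕ Unit) (.inl 0 : Fin 4 ⊕ Unit) ?_ ?_ ?_ ?_ <;> revert S <;> decide +kernel

theorem generic_row41d : ∀ S ∈ row41d.signatures, HasGenericCurvature 4 (row41d.metric S) := by
  intro S hS
  refine describes_row41d.hasGenericCurvature_four rfl (ric_model41d S hS) (by decide)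
    isPairList_four (.inl 0 : Fin 4 ⊕ Unit) (.inl 2 : Fin 4 ⊕ Unit) (.inl 2 : Fin 4 ⊕ Unit) (.inl 0 : Fin 4 ⊕ Unit) ?_ ?_ ?_ ?_ <;> revert S <;> decide +kernel

theorem generic_row4a : ∀ S ∈ row4a.signatures, HasGenericCurvature 4 (row4a.metric S) := by
  intro S hS
  refine describes_row4a.hasGenericCurvature_four rfl (ric_model4a S hS) (by decide)
    isPairList_four (.inl 0 : Fin 4 ⊕ Unit) (.inl 2 : Fin 4 ⊕ Unit) (.inl 2 : Fin 4 ⊕ Unit) (.inl 0 : Fin 4 ⊕ Unit) ?_ ?_ ?_ ?_ <;> revert S <;> decide +kernel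

theorem generic_row4b : ∀ S ∈ row4b.signatures, HasGenericCurvature 4 (row4b.metric S) := by
  intro S hS
  refine describes_row4b.hasGenericCurvature_four rfl (ric_model4b S hS) (by decide)
    -- The plane of e₁, e₂ is used here because the coefficient for e₁, e₃ takes exactly its
    -- constant curvature value in all listed signatures.
    isPairList_four (.inl 0 : Fin 4 ⊕ Unit) (.inl 1 : Fin 4 ⊕ Unit) (.inl 1 : Fin 4 ⊕ Unit) (.inl 0 : Fin 4 ⊕ Unit) ?_ ?_ ?_ ?_ <;> revert S <;> decide +kernel

end Rows

end EinsteinSolv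

/-! ### Nice bases of nilpotent Lie algebras of dimension at most four -/

namespace EinsteinSolv

section Nice

variable {N : Type*} [LieRing N] [LieAlgebra ℝ N]

/-- The structure constants of a Lie algebra in a basis. -/
noncomputable def structureConstant {ι : Type*} (e : Module.Basis ι ℝ N) (i j k : ι) : ℝ :=
  e.repr ⁅e i, e j⁆ k

theorem structureConstant_swap {ι : Type*} (e : Module.Basis ι ℝ N) (i j k : ι) :
    structureConstant e i j k = -structureConstant e j i k := by
  rw [structureConstant, structureConstant, ← lie_skew, map_neg, Finsupp.neg_apply]

theorem IsNiceBasis.eq_of_ne_zero {m : ℕ} {e : Module.Basis (Fin m) ℝ N} (he : IsNiceBasis e)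
    {i j k l : Fin m} (hk : structureConstant e i j k ≠ 0) (hl : structureConstant e i j l ≠ 0) :
    k = l := by
  obtain ⟨p, c, h⟩ := he.1 i j
  have key : ∀ q, structureConstant e i j q ≠ 0 → q = p := by
    intro q hq
    by_contra hqp
    refine hq ?_
    rw [structureConstant, h]
    simp [Ne.symm hqp]
  rw [key k hk, key l hl]

theorem IsNiceBasis.eq_of_ne_zero' {m : ℕ} {e : Module.Basis (Fin m) ℝ N} (he : IsNiceBasis e)
    {i j k l : Fin m} (hk : structureConstant e i j k ≠ 0) (hl : structureConstant e i l k ≠ 0) :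
    j = l := by
  obtain ⟨p, c, h⟩ := he.2 i k
  have key : ∀ q, structureConstant e i q k ≠ 0 → q = p := by
    intro q hq
    by_contra hqp
    refine hq ?_
    have := h (e q)
    rw [Module.Basis.coord_apply] at this
    rw [structureConstant, this]
    simp [hqp]
  rw [key j hk, key l hl]

/-- The elements of a nice basis of a nilpotent Lie algebra can be graded by their depth in the
lower central series. -/
theorem IsNiceBasis.exists_depth [LieRing.IsNilpotent N] {m : ℕ} {e : Module.Basis (Fin m) ℝ N}
    (he : IsNiceBasis e) :
    ∃ ρ : Fin m → ℕ, ∀ i j k, structureConstant e i j k ≠ 0 → ρ i < ρ k ∧ ρ j < ρ k := by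
  obtain ⟨s, hs⟩ := LieModule.IsNilpotent.nilpotent ℝ N N
  have hex : ∀ i, ∃ s, e i ∉ LieModule.lowerCentralSeries ℝ N N s := fun i =>
    ⟨s, by rw [hs]; simpa using e.ne_zero i⟩
  classical
  -- The depth of e_i is the first s for which e_i lies outside the s-th term of the lower central
  -- series.
  have key : ∀ i j k, structureConstant e i j k ≠ 0 → Nat.find (hex j) < Nat.find (hex k) := by
    intro i j k hk
    rw [Nat.lt_find_iff]
    intro t ht
    rw [not_not]
    cases t with
    | zero => simp
    | succ t =>
      have hj : e j ∈ LieModule.lowerCentralSeries ℝ N N t := by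
        by_contra hj
        exact absurd (Nat.find_min' (hex j) hj) (by omega)
      have hl : ⁅e i, e j⁆ ∈ LieModule.lowerCentralSeries ℝ N N (t + 1) := by
        rw [LieModule.lowerCentralSeries_succ]
        exact LieSubmodule.lie_mem_lie (LieSubmodule.mem_top _) hj
      -- Niceness is essential: the bracket is a single multiple of e_k, so e_k itself lies as deep
      -- as the bracket.
      have hb : ⁅e i, e j⁆ = structureConstant e i j k • e k := by
        refine e.ext_elem fun l => ?_
        by_cases hlk : k = l
        · subst hlk; simp [structureConstant]
        · have : structureConstant e i j l = 0 := by
            by_contra h0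
            exact hlk (he.eq_of_ne_zero hk h0)
          rw [structureConstant] at this
          simp [this, hlk]
      rw [hb] at hl
      simpa [hk] using (LieModule.lowerCentralSeries ℝ N N (t + 1)).smul_mem
        (structureConstant e i j k)⁻¹ hl
  refine ⟨fun i => Nat.find (hex i), fun i j k hk => ⟨key j i k ?_, key i j k hk⟩⟩
  rw [structureConstant_swap]
  simpa using hk

/-- A nice basis of a nilpotent Lie algebra can be reordered so that brackets involve only later
elements. -/
theorem IsNiceBasis.exists_perm [LieRing.IsNilpotent N] {m : ℕ} {e : Module.Basis (Fin m) ℝ N}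
    (he : IsNiceBasis e) : ∃ σ : Equiv.Perm (Fin m), ∀ i j k,
      structureConstant e (σ i) (σ j) (σ k) ≠ 0 → i < k ∧ j < k := by
  obtain ⟨ρ, hρ⟩ := he.exists_depth
  refine ⟨Tuple.sort ρ, fun i j k hk => ?_⟩
  have := hρ _ _ _ hk
  have hm := Tuple.monotone_sort ρ
  exact ⟨hm.reflect_lt this.1, hm.reflect_lt this.2⟩

end Nice

/-! ### Normal forms of the structure constants in dimensions three and four. -/

/-- The structure constants of `[e₁, e₂] = a e₃`. -/
def stdThree (a : ℝ) (i j k : Fin 3) : ℝ :=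
  if i = 0 ∧ j = 1 ∧ k = 2 then a else if i = 1 ∧ j = 0 ∧ k = 2 then -a else 0

/-- The structure constants of `[e₁, e₂] = a e₃`, `[e₁, e₃] = d e₄`. -/
def stdFour (a d : ℝ) (i j k : Fin 4) : ℝ :=
  if i = 0 ∧ j = 1 ∧ k = 2 then a else if i = 1 ∧ j = 0 ∧ k = 2 then -a else
  if i = 0 ∧ j = 2 ∧ k = 3 then d else if i = 2 ∧ j = 0 ∧ k = 3 then -d else 0

/-- Two distinct indices below k force k to be the last index, so only one constant survives. -/
theorem eq_stdThree {C : Fin 3 → Fin 3 → Fin 3 → ℝ} (hC : ∀ i j k, C i j k = -C j i k)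
    (ht : ∀ i j k, C i j k ≠ 0 → i < k ∧ j < k) (i j k : Fin 3) :
    C i j k = stdThree (C 0 1 2) i j k := by
  have hd : ∀ i k, C i i k = 0 := fun i k => by linarith [hC i i k]
  have h0 : ∀ i j k, ¬ (i < k ∧ j < k) → C i j k = 0 := fun i j k h => by
    by_contra hk; exact h (ht i j k hk)
  fin_cases k <;> fin_cases i <;> fin_cases j <;>
    first
    | (simp [stdThree]; done)
    | (simp only [stdThree]; exact hC _ _ _)
    | (simp [stdThree, hd]; done)
    | (simp only [stdThree]; exact h0 _ _ _ (by decide))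

/-- Structure constants on four indices for which brackets involve only later elements. -/
def triFour (a b d f : ℝ) (i j k : Fin 4) : ℝ :=
  if k = 2 then if i = 0 ∧ j = 1 then a else if i = 1 ∧ j = 0 then -a else 0
  else if k = 3 then
    if i = 0 ∧ j = 1 then b else if i = 1 ∧ j = 0 then -b else
    if i = 0 ∧ j = 2 then d else if i = 2 ∧ j = 0 then -d else
    if i = 1 ∧ j = 2 then f else if i = 2 ∧ j = 1 then -f else 0
  else 0

theorem eq_triFour {C : Fin 4 → Fin 4 → Fin 4 → ℝ} (hC : ∀ i j k, C i j k = -C j i k)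
    (ht : ∀ i j k, C i j k ≠ 0 → i < k ∧ j < k) (i j k : Fin 4) :
    C i j k = triFour (C 0 1 2) (C 0 1 3) (C 0 2 3) (C 1 2 3) i j k := by
  have hd : ∀ i k, C i i k = 0 := fun i k => by linarith [hC i i k]
  have h0 : ∀ i j k, ¬ (i < k ∧ j < k) → C i j k = 0 := fun i j k h => by
    by_contra hk; exact h (ht i j k hk)
  fin_cases k <;> fin_cases i <;> fin_cases j <;>
    first
    | (simp [triFour]; done)
    | (simp only [triFour]; exact hC _ _ _)
    | (simp [triFour, hd]; done)
    | (simp only [triFour]; exact h0 _ _ _ (by decide))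

/-- Triangularity leaves a, b for [e₁,e₂] along e₃, e₄, and d, f for [e₁,e₃], [e₂,e₃] along e₄. One
bracket cannot have two components, so ab = 0; one vector cannot reach e₄ through two partners, so
bd = bf = df = 0. A reordering brings each remaining pattern to the normal form, and the condition
on a and d places a single nonzero bracket in the first slot. -/
theorem exists_perm_stdFour {C : Fin 4 → Fin 4 → Fin 4 → ℝ} (hC : ∀ i j k, C i j k = -C j i k)
    (ht : ∀ i j k, C i j k ≠ 0 → i < k ∧ j < k)
    (h1 : ∀ i j k l, C i j k ≠ 0 → C i j l ≠ 0 → k = l)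
    (h2 : ∀ i j k l, C i j k ≠ 0 → C i l k ≠ 0 → j = l) :
    ∃ (σ : Equiv.Perm (Fin 4)) (a d : ℝ), (a = 0 → d = 0) ∧
      ∀ i j k, C (σ i) (σ j) (σ k) = stdFour a d i j k := by
  have hab : C 0 1 3 ≠ 0 → C 0 1 2 = 0 := fun h => by
    by_contra h'; exact absurd (h1 _ _ _ _ h h') (by decide)
  have hbd : C 0 1 3 ≠ 0 → C 0 2 3 = 0 := fun h => by
    by_contra h'; exact absurd (h2 _ _ _ _ h h') (by decide)
  have hbf : C 0 1 3 ≠ 0 → C 1 2 3 = 0 := fun h => by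
    by_contra h'
    exact absurd (h2 1 0 3 2 (by rw [hC]; simpa using h) h') (by decide)
  have hdf : C 0 2 3 ≠ 0 → C 1 2 3 = 0 := fun h => by
    by_contra h'
    exact absurd (h2 2 0 3 1 (by rw [hC]; simpa using h) (by rw [hC]; simpa using h')) (by decide)
  have hq := eq_triFour hC ht
  generalize C 0 1 2 = a, C 0 1 3 = b, C 0 2 3 = d, C 1 2 3 = f at *
  simp only [hq]
  by_cases hb : b = 0
  · subst hb
    by_cases hd : d = 0
    · subst hd
      by_cases hf : f = 0
      · subst hf
        refine ⟨1, a, 0, fun _ => rfl, fun i j k => ?_⟩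
        fin_cases i <;> fin_cases j <;> fin_cases k <;> simp [triFour, stdFour]
      · by_cases ha : a = 0
        · subst ha
          refine ⟨finRotate 4, f, 0, fun _ => rfl, fun i j k => ?_⟩
          simp only [finRotate_apply]
          fin_cases i <;> fin_cases j <;> fin_cases k <;> simp [triFour, stdFour]
        · refine ⟨Equiv.swap 0 1, -a, f, fun h => absurd (neg_eq_zero.1 h) ha, fun i j k => ?_⟩
          fin_cases i <;> fin_cases j <;> fin_cases k <;>
            simp [triFour, stdFour, Equiv.swap_apply_def]
    · rw [hdf hd]
      by_cases ha : a = 0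
      · subst ha
        refine ⟨Equiv.swap 1 2 * Equiv.swap 2 3, d, 0, fun _ => rfl, fun i j k => ?_⟩
        fin_cases i <;> fin_cases j <;> fin_cases k <;>
          simp [triFour, stdFour, Equiv.swap_apply_def]
      · refine ⟨1, a, d, fun h => absurd h ha, fun i j k => ?_⟩
        fin_cases i <;> fin_cases j <;> fin_cases k <;> simp [triFour, stdFour]
  · rw [hab hb, hbd hb, hbf hb]
    refine ⟨Equiv.swap 2 3, b, 0, fun _ => rfl, fun i j k => ?_⟩
    fin_cases i <;> fin_cases j <;> fin_cases k <;>
      simp [triFour, stdFour, Equiv.swap_apply_def]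

end EinsteinSolv

/-! ### Einstein metrics of pseudo-Iwasawa type with generic curvature -/

namespace EinsteinSolv

open TensorProduct

variable {L : Type*} [LieRing L] [LieAlgebra ℝ L]

theorem structureConstant_derivation {N : Type*} [LieRing N] [LieAlgebra ℝ N] {ι : Type*}
    [Fintype ι] (e : Module.Basis ι ℝ N) (T : N →ₗ[ℝ] N)
    (hT : ∀ x y, T ⁅x, y⁆ = ⁅T x, y⁆ + ⁅x, T y⁆) (i j k : ι) :
    ∑ l, structureConstant e i j l * e.repr (T (e l)) k =
      ∑ l, e.repr (T (e i)) l * structureConstant e l j k +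
        ∑ l, e.repr (T (e j)) l * structureConstant e i l k := by
  have h2 := congrArg (fun x => e.repr x k) (hT (e i) (e j))
  have e1 : e.repr (T ⁅e i, e j⁆) k = ∑ l, structureConstant e i j l * e.repr (T (e l)) k := by
    conv_lhs => rw [← e.sum_repr ⁅e i, e j⁆]
    simp only [map_sum, map_smul, Finsupp.coe_finsetSum, Finset.sum_apply,
      Finsupp.smul_apply, smul_eq_mul, structureConstant]
  have e2 : e.repr ⁅T (e i), e j⁆ k =
      ∑ l, e.repr (T (e i)) l * structureConstant e l j k := by
    conv_lhs => rw [← e.sum_repr (T (e i))]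
    simp only [sum_lie, smul_lie, map_sum, map_smul, Finsupp.coe_finsetSum, Finset.sum_apply,
      Finsupp.smul_apply, smul_eq_mul, structureConstant]
  have e3 : e.repr ⁅e i, T (e j)⁆ k =
      ∑ l, e.repr (T (e j)) l * structureConstant e i l k := by
    conv_lhs => rw [← e.sum_repr (T (e j))]
    simp only [lie_sum, lie_smul, map_sum, map_smul, Finsupp.coe_finsetSum, Finset.sum_apply,
      Finsupp.smul_apply, smul_eq_mul, structureConstant]
  simp only [map_add, Finsupp.add_apply] at h2
  rw [← e1, ← e2, ← e3]
  exact h2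

namespace IsPseudoIwasawaDecomposition

variable {g : LieMetric L} {n : LieIdeal ℝ L} {a : LieSubalgebra ℝ L}

theorem exists_add (h : IsPseudoIwasawaDecomposition g n a) (x : L) :
    ∃ y ∈ n, ∃ X ∈ a, x = y + X := by
  have : x ∈ n.toSubmodule ⊔ a.toSubmodule := by rw [h.isCompl.sup_eq_top]; trivial
  obtain ⟨y, hy, X, hX, rfl⟩ := Submodule.mem_sup.1 this
  exact ⟨y, hy, X, hX, rfl⟩

/-- Since 𝔞 is abelian, the derived algebra lies in the ideal 𝔫. -/
theorem lie_mem (h : IsPseudoIwasawaDecomposition g n a) (x y : L) : ⁅x, y⁆ ∈ n := by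
  obtain ⟨x', hx, X, hX, rfl⟩ := h.exists_add x
  obtain ⟨y', hy, Y, hY, rfl⟩ := h.exists_add y
  rw [add_lie, lie_add X, h.abelian X hX Y hY, add_zero]
  exact add_mem (lie_mem_left ℝ L n _ _ hx) (lie_mem_right ℝ L n _ _ hy)

/-- A basis of the ideal, together with a spanning vector of the complement. -/
theorem exists_basis (h : IsPseudoIwasawaDecomposition g n a) {X : L} (hX : X ∈ a)
    (hXX : g.form X X ≠ 0) (hspan : ∀ Y ∈ a, ∃ c : ℝ, Y = c • X) {ι : Type*}
    (e : Module.Basis ι ℝ n) :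
    ∃ b : Module.Basis (ι ⊕ Unit) ℝ L, (∀ i, b (.inl i) = e i) ∧ b (.inr ()) = X := by
  have hX0 : X ≠ 0 := by rintro rfl; simp at hXX
  let f : Module.Basis Unit ℝ a.toSubmodule := Module.Basis.mk (v := fun _ => (⟨X, hX⟩ : a.toSubmodule))
    (by
      rw [linearIndependent_unique_iff]
      simpa [Subtype.ext_iff] using hX0)
    (by
      rintro ⟨Y, hY⟩ -
      obtain ⟨c, rfl⟩ := hspan Y hY
      rw [Set.range_const, Submodule.mem_span_singleton]
      exact ⟨c, rfl⟩)
  let e' : Module.Basis ι ℝ n.toSubmodule := e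
  refine ⟨(e'.prod f).map (Submodule.prodEquivOfIsCompl _ _ h.isCompl), fun i => ?_, ?_⟩
  · simp [e']
  · simp [f]

/-- δ is the matrix of ad X on 𝔫. It satisfies the symmetry relation because ad X is symmetric, and
the derivation rule by the Jacobi identity. The normalisation is W = ρ = 1, so u is the inverse of
w. -/
theorem exists_isFrame (h : IsPseudoIwasawaDecomposition g n a) {X : L} (hX : X ∈ a)
    (hXX : g.form X X ≠ 0) {ι : Type*} [Fintype ι] [DecidableEq ι] {e : Module.Basis ι ℝ n}
    (horth : ∀ i j, i ≠ j → g.form (e i) (e j) = 0) (hne : ∀ i, g.form (e i) (e i) ≠ 0)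
    {b : Module.Basis (ι ⊕ Unit) ℝ L} (hb : ∀ i, b (.inl i) = e i) (hbX : b (.inr ()) = X) :
    ∃ δ : ι → ι → ℝ,
      IsFrame g b (semiArr (structureConstant e) δ) (fun i => g.form (b i) (b i))
        (fun i => (g.form (b i) (b i))⁻¹) 1 1 ∧
      (∀ j k, g.form (e k) (e k) * δ k j = g.form (e j) (e j) * δ j k) ∧
      ∀ i j k, ∑ l, structureConstant e i j l * δ k l =
        ∑ l, δ l i * structureConstant e l j k + ∑ l, δ l j * structureConstant e i l k := by
  let T : n →ₗ[ℝ] n := LieModule.toEnd ℝ L n X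
  have hT : ∀ x : n, ((T x : n) : L) = ⁅X, (x : L)⁆ := fun x => rfl
  have hsum : ∀ x : n, (x : L) = ∑ k, e.repr x k • (e k : L) := by
    intro x
    conv_lhs => rw [← e.sum_repr x]
    rw [AddSubmonoidClass.coe_finsetSum]
    rfl
  have hform : ∀ (x : n) k, g.form x (e k) = g.form (e k) (e k) * e.repr x k := by
    intro x k
    rw [hsum x, map_sum, LinearMap.sum_apply, Finset.sum_eq_single k]
    · simp [mul_comm]
    · intro l _ hl; simp [horth l k hl]
    · simp
  refine ⟨fun k j => e.repr (T (e j)) k, ⟨?_, ?_, ?_, one_ne_zero, one_ne_zero⟩, ?_, ?_⟩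
  · rintro (i | i) (j | j)
    · simp only [hb, hbX, Fintype.sum_sum_type, semiArr, zero_smul, Finset.sum_const_zero, add_zero]
      rw [← LieSubmodule.coe_bracket]
      exact hsum _
    · simp only [hb, hbX, Fintype.sum_sum_type, semiArr, zero_smul, Finset.sum_const_zero, add_zero,
        neg_smul, Finset.sum_neg_distrib]
      rw [← lie_skew, ← hT, ← hsum]
    · simp only [hb, hbX, Fintype.sum_sum_type, semiArr, zero_smul, Finset.sum_const_zero, add_zero]
      rw [← hT, ← hsum]
    · simp [semiArr]
  · rintro (i | i) (j | j)
    · by_cases hij : i = j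
      · subst hij; simp
      · simp [hb, horth i j hij, hij]
    · simp [hb, hbX, h.orthogonal _ (e i).2 X hX]
    · simp [hb, hbX, g.symm X, h.orthogonal _ (e j).2 X hX]
    · simp
  · rintro (i | i)
    · simp only [hb]; exact mul_inv_cancel₀ (hne i)
    · simp only [hbX]; exact mul_inv_cancel₀ hXX
  · intro j k
    rw [← hform, ← hform, hT, hT, h.symmetric X hX, g.symm]
  · intro i j k
    refine structureConstant_derivation e T (fun x y => Subtype.ext ?_) i j k
    change ⁅X, ⁅(x : L), (y : L)⁆⁆ = ⁅⁅X, (x : L)⁆, (y : L)⁆ + ⁅(x : L), ⁅X, (y : L)⁆⁆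
    rw [leibniz_lie]

variable [FiniteDimensional ℝ L]

/-- In Koszul's formula the two terms containing ad X cancel by symmetry, and the third vanishes
because [L,L] ⊆ 𝔫 is orthogonal to 𝔞. -/
theorem leviCivita_eq_zero (h : IsPseudoIwasawaDecomposition g n a) {X : L} (hX : X ∈ a) (y : L) :
    g.leviCivita X y = 0 := by
  refine g.ext_form fun z => ?_
  rw [g.form_leviCivita, h.symmetric X hX, h.orthogonal _ (h.lie_mem y z) X hX,
    ← lie_skew z X, map_neg, LinearMap.neg_apply, g.symm _ y]
  simp

theorem curvature_eq_zero (h : IsPseudoIwasawaDecomposition g n a) {X Y : L} (hX : X ∈ a)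
    (hY : Y ∈ a) (z : L) : g.curvature X Y z = 0 := by
  simp [LieMetric.curvature, h.leviCivita_eq_zero hX, h.leviCivita_eq_zero hY, h.abelian X hX Y hY]

theorem tmul_mem_eigenbivectors (h : IsPseudoIwasawaDecomposition g n a) {X Y : L} (hX : X ∈ a)
    (hY : Y ∈ a) : X ⊗ₜ Y ∈ g.eigenbivectors 0 := by
  rw [LieMetric.mem_eigenbivectors]
  intro z
  rw [TensorProduct.lift.tmul, LieMetric.curvatureDefect_apply, h.curvature_eq_zero hX hY]
  simp

/-- Every X∧Y with X, Y in 𝔞 is in the kernel of the curvature operator, so all 2×2 Gram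
determinants on 𝔞 vanish. Since 𝔞 is nondegenerate, being orthogonal to its complement 𝔫, it is a
line. -/
theorem exists_spanning (h : IsPseudoIwasawaDecomposition g n a) (ha : a ≠ ⊥) {lam : ℝ}
    (hlam : lam ≠ 0) (hric : ∀ x y, g.ricciForm x y = lam * g.form x y)
    (hdeg : ∀ x y, x ⊗ₜ y ∈ g.eigenbivectors 0 →
      g.ricciForm x x * g.ricciForm y y = g.ricciForm x y * g.ricciForm y x) :
    ∃ X ∈ a, g.form X X ≠ 0 ∧ ∀ Y ∈ a, ∃ c : ℝ, Y = c • X := by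
  have hdeg' : ∀ X ∈ a, ∀ Y ∈ a, g.form X X * g.form Y Y = g.form X Y * g.form X Y := by
    intro X hX Y hY
    have := hdeg X Y (h.tmul_mem_eigenbivectors hX hY)
    simp only [hric, g.symm Y X] at this
    have h2 : lam ^ 2 ≠ 0 := pow_ne_zero 2 hlam
    refine mul_left_cancel₀ h2 ?_
    linear_combination this
  have hzero : ∀ Y ∈ a, (∀ Z ∈ a, g.form Y Z = 0) → Y = 0 := by
    intro Y hY hYZ
    refine g.ext_form fun z => ?_
    obtain ⟨y, hy, Z, hZ, rfl⟩ := h.exists_add z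
    rw [map_add, hYZ Z hZ, g.symm, h.orthogonal y hy Y hY]
    simp
  have hpol : ∀ Y Z : L, g.form (Y + Z) (Y + Z) = g.form Y Y + 2 * g.form Y Z + g.form Z Z := by
    intro Y Z
    simp only [map_add, LinearMap.add_apply, g.symm Z Y]
    ring
  -- If all vectors of 𝔞 were null, polarisation would make the form vanish on 𝔞.
  have hX : ∃ X ∈ a, g.form X X ≠ 0 := by
    by_contra! hnull
    refine ha ((LieSubalgebra.eq_bot_iff a).2 fun Y hY => hzero Y hY fun Z hZ => ?_)
    have := hpol Y Z
    rw [hnull _ (add_mem hY hZ), hnull Y hY, hnull Z hZ] at this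
    linarith
  obtain ⟨X, hX, hXX⟩ := hX
  refine ⟨X, hX, hXX, fun Y hY => ?_⟩
  have hproj : ∀ Z ∈ a, ∃ c : ℝ, g.form X (Z - c • X) = 0 := by
    intro Z _
    refine ⟨g.form X Z / g.form X X, ?_⟩
    rw [map_sub, map_smul, smul_eq_mul]
    field_simp
    ring
  -- Vectors of 𝔞 orthogonal to X are null by the Gram condition. By polarisation they are mutually
  -- orthogonal, hence orthogonal to all of 𝔞 and zero.
  have hnull : ∀ Z ∈ a, g.form X Z = 0 → g.form Z Z = 0 := by
    intro Z hZ hXZ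
    have := hdeg' X hX Z hZ
    rw [hXZ, mul_zero] at this
    exact (mul_eq_zero.1 this).resolve_left hXX
  obtain ⟨c, hc⟩ := hproj Y hY
  have hY' : Y - c • X ∈ a := sub_mem hY (a.smul_mem c hX)
  refine ⟨c, sub_eq_zero.1 (hzero _ hY' fun Z hZ => ?_)⟩
  obtain ⟨d, hd⟩ := hproj Z hZ
  have hZ' : Z - d • X ∈ a := sub_mem hZ (a.smul_mem d hX)
  have h1 := hpol (Y - c • X) (Z - d • X)
  rw [hnull _ (add_mem hY' hZ') (by rw [map_add, hc, hd, add_zero]), hnull _ hY' hc,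
    hnull _ hZ' hd] at h1
  have h2 : g.form (Y - c • X) Z = g.form (Y - c • X) (Z - d • X) + d * g.form (Y - c • X) X := by
    simp only [map_sub, map_smul, smul_eq_mul]
    ring
  rw [h2, g.symm _ X, hc]
  linarith

end IsPseudoIwasawaDecomposition

end EinsteinSolv

/-! ### Curvature of semidirect sums -/

namespace EinsteinSolv

section SemiArr

variable {ι : Type*} {c : ι → ι → ι → ℝ} {δ : ι → ι → ℝ} {w u : ι ⊕ Unit → ℝ}

theorem gamArr_semiArr_inl (i j k : ι) :
    gamArr (semiArr c δ) w (.inl i) (.inl j) (.inl k) = gamArr c (fun i => w (.inl i)) i j k := rfl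

theorem gamArr_semiArr_inl_inl_inr (hδ : ∀ j k, w (.inl k) * δ k j = w (.inl j) * δ j k) (i j : ι) :
    gamArr (semiArr c δ) w (.inl i) (.inl j) (.inr ()) = 2 * (w (.inl i) * δ i j) := by
  simp only [gamArr, semiArr]
  linear_combination hδ i j

theorem gamArr_semiArr_inl_inr_inl (hδ : ∀ j k, w (.inl k) * δ k j = w (.inl j) * δ j k) (i k : ι) :
    gamArr (semiArr c δ) w (.inl i) (.inr ()) (.inl k) = -(2 * (w (.inl i) * δ i k)) := by
  simp only [gamArr, semiArr]
  linear_combination -hδ i k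

theorem gamArr_semiArr_inl_inr_inr (i : ι) :
    gamArr (semiArr c δ) w (.inl i) (.inr ()) (.inr ()) = 0 := by
  simp [gamArr, semiArr]

/-- The coordinate form of ∇_X = 0 for X in 𝔞. -/
theorem gamArr_semiArr_inr (hδ : ∀ j k, w (.inl k) * δ k j = w (.inl j) * δ j k) (j k : ι ⊕ Unit) :
    gamArr (semiArr c δ) w (.inr ()) j k = 0 := by
  rcases j with j | j <;> rcases k with k | k <;> simp [gamArr, semiArr]
  linear_combination hδ j k

variable [Fintype ι]

/-- The Ricci form of a semidirect sum on the ideal. -/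
theorem ricArr_semiArr_inl (hδ : ∀ j k, w (.inl k) * δ k j = w (.inl j) * δ j k)
    (hu : ∀ i, w i * u i = 1) (j l : ι) :
    ricArr (semiArr c δ) w u 1 (.inl j) (.inl l) =
      ricArr c (fun i => w (.inl i)) (fun i => u (.inl i)) 1 j l -
        4 * u (.inr ()) * (∑ i, δ i i) * (w (.inl j) * δ j l) := by
  have e1 : ∀ i, rmArr (semiArr c δ) w u 1 (.inl i) (.inl j) (.inl l) (.inl i) =
      rmArr c (fun i => w (.inl i)) (fun i => u (.inl i)) 1 i j l i +
        4 * u (.inr ()) * ((w (.inl i) * δ i l) * (w (.inl i) * δ i j) -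
          (w (.inl j) * δ j l) * (w (.inl i) * δ i i)) := by
    intro i
    simp only [rmArr, Fintype.sum_sum_type, Finset.univ_unique, Finset.sum_singleton,
      PUnit.default_eq_unit, gamArr_semiArr_inl, gamArr_semiArr_inl_inl_inr hδ,
      gamArr_semiArr_inr hδ, semiArr]
    linear_combination -(4 * u (.inr ()) * (w (.inl i) * δ i l)) * (hδ j i)
  have e2 : rmArr (semiArr c δ) w u 1 (.inr ()) (.inl j) (.inl l) (.inr ()) =
      ∑ m, -4 * (δ m j * (w (.inl m) * δ m l)) := by
    simp only [rmArr, Fintype.sum_sum_type, Finset.univ_unique, Finset.sum_singleton,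
      PUnit.default_eq_unit, gamArr_semiArr_inl_inl_inr hδ, gamArr_semiArr_inl_inr_inr,
      gamArr_semiArr_inr hδ, semiArr]
    simp only [mul_zero, zero_mul, sub_zero, add_zero, zero_sub]
    refine Finset.sum_congr rfl fun m _ => ?_
    ring
  simp only [ricArr, Fintype.sum_sum_type, Finset.univ_unique, Finset.sum_singleton,
    PUnit.default_eq_unit, e1, e2]
  rw [Finset.mul_sum, ← Finset.sum_add_distrib, Finset.mul_sum, Finset.sum_mul,
    ← Finset.sum_sub_distrib]
  -- The terms quadratic in δ arising from 𝔫 cancel those from the plane with the last vector,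
  -- because w_i u_i = 1. What remains is the Ricci form of 𝔫 corrected by −(tr δ)δ.
  refine Finset.sum_congr rfl fun i _ => ?_
  linear_combination (4 * u (.inr ()) * (δ i l * (w (.inl i) * δ i j) -
    w (.inl j) * δ j l * δ i i)) * hu (.inl i)

/-- In invariant terms ric(X,X) = −tr((ad X)²), which fixes the Einstein constant in terms of the
eigenvalues of δ. -/
theorem ricArr_semiArr_inr (hδ : ∀ j k, w (.inl k) * δ k j = w (.inl j) * δ j k)
    (hu : ∀ i, w i * u i = 1) :
    ricArr (semiArr c δ) w u 1 (.inr ()) (.inr ()) = -4 * ∑ i, ∑ m, δ m i * δ i m := by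
  have e1 : ∀ i, rmArr (semiArr c δ) w u 1 (.inl i) (.inr ()) (.inr ()) (.inl i) =
      ∑ m, -4 * (δ m i * (w (.inl m) * δ m i)) := by
    intro i
    simp only [rmArr, Fintype.sum_sum_type, Finset.univ_unique, Finset.sum_singleton,
      PUnit.default_eq_unit, gamArr_semiArr_inl_inr_inl hδ, gamArr_semiArr_inl_inr_inr,
      gamArr_semiArr_inr hδ, semiArr]
    simp only [mul_zero, zero_mul, sub_zero, add_zero, zero_sub]
    refine Finset.sum_congr rfl fun m _ => ?_
    ring
  have e2 : rmArr (semiArr c δ) w u 1 (.inr ()) (.inr ()) (.inr ()) (.inr ()) = 0 := by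
    simp [rmArr, gamArr_semiArr_inr hδ, gamArr_semiArr_inl_inr_inr]
  simp only [ricArr, Fintype.sum_sum_type, Finset.univ_unique, Finset.sum_singleton,
    PUnit.default_eq_unit, e1, e2]
  rw [mul_zero, add_zero, Finset.mul_sum]
  refine Finset.sum_congr rfl fun i _ => ?_
  rw [Finset.mul_sum, Finset.mul_sum]
  refine Finset.sum_congr rfl fun m _ => ?_
  linear_combination -4 * u (.inl i) * δ m i * hδ i m - 4 * δ m i * δ i m * hu (.inl i)

end SemiArr

/-! ### Nilpotent Lie algebras in normal form -/

/-- A bracket [e_i,e_j] = c e_k contributes c² w_k/(2 w_i w_j) to the Ricci operator with weights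
−1, −1, +1 on e_i, e_j, e_k. -/
theorem ricArr_stdThree {w u : Fin 3 → ℝ} (hu : ∀ i, w i * u i = 1) (a : ℝ) (j l : Fin 3) :
    ricArr (stdThree a) w u 1 j l = if j = l then
      4 * (a ^ 2 * w 2 * u 0 * u 1 / 2) * ![-1, -1, 1] j * w j else 0 := by
  have h0 := hu 0
  have h1 := hu 1
  have h2 := hu 2
  have e0 : u 0 = (w 0)⁻¹ := eq_inv_of_mul_eq_one_right h0
  have e1 : u 1 = (w 1)⁻¹ := eq_inv_of_mul_eq_one_right h1
  have e2 : u 2 = (w 2)⁻¹ := eq_inv_of_mul_eq_one_right h2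
  have n0 := left_ne_zero_of_mul_eq_one h0
  have n1 := left_ne_zero_of_mul_eq_one h1
  have n2 := left_ne_zero_of_mul_eq_one h2
  fin_cases j <;> fin_cases l <;>
    simp [ricArr, rmArr, gamArr, stdThree, Fin.sum_univ_three, e0, e1, e2] <;> field_simp <;> ring

/-- The two brackets contribute independently, each with the weights −1, −1, +1, and the
off-diagonal entries vanish. -/
theorem ricArr_stdFour {w u : Fin 4 → ℝ} (hu : ∀ i, w i * u i = 1) (a d : ℝ) (j l : Fin 4) :
    ricArr (stdFour a d) w u 1 j l = if j = l then
      4 * (a ^ 2 * w 2 * u 0 * u 1 / 2 * ![-1, -1, 1, 0] j +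
        d ^ 2 * w 3 * u 0 * u 2 / 2 * ![-1, 0, -1, 1] j) * w j else 0 := by
  have h0 := hu 0
  have h1 := hu 1
  have h2 := hu 2
  have h3 := hu 3
  have e0 : u 0 = (w 0)⁻¹ := eq_inv_of_mul_eq_one_right h0
  have e1 : u 1 = (w 1)⁻¹ := eq_inv_of_mul_eq_one_right h1
  have e2 : u 2 = (w 2)⁻¹ := eq_inv_of_mul_eq_one_right h2
  have e3 : u 3 = (w 3)⁻¹ := eq_inv_of_mul_eq_one_right h3
  have n0 := left_ne_zero_of_mul_eq_one h0
  have n1 := left_ne_zero_of_mul_eq_one h1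
  have n2 := left_ne_zero_of_mul_eq_one h2
  have n3 := left_ne_zero_of_mul_eq_one h3
  fin_cases j <;> fin_cases l <;>
    simp [ricArr, rmArr, gamArr, stdFour, Fin.sum_univ_four, e0, e1, e2, e3] <;> field_simp <;> ring

end EinsteinSolv

/-! ### Eigenbivectors in an orthonormal frame -/

namespace EinsteinSolv

open TensorProduct

/-- The lowered coefficients of `4 (R(e_i, e_j) e_l - κ (ric(e_j, e_l) e_i - ric(e_i, e_l) e_j))`,
for an Einstein metric with constant `lam`. -/
noncomputable def frameDefect {ι : Type*} [Fintype ι] [DecidableEq ι] (C : ι → ι → ι → ℝ) (w u : ι → ℝ)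
    (lam κ : ℝ) (i j l k : ι) : ℝ :=
  rmArr C w u 1 i j l k - κ * (4 * lam * w l * w k) *
    ((if j = l then 1 else 0) * (if i = k then 1 else 0) -
      (if i = l then 1 else 0) * (if j = k then 1 else 0))

section Frame

variable {L : Type*} [LieRing L] [LieAlgebra ℝ L] [FiniteDimensional ℝ L]

/-- The endomorphism `z ↦ R(x, y) z - κ (ric(y, z) x - ric(x, z) y)`. -/
noncomputable def LieMetric.defectEnd (g : LieMetric L) (κ : ℝ) (x y : L) : L →ₗ[ℝ] L :=
  g.leviCivita x ∘ₗ g.leviCivita y - g.leviCivita y ∘ₗ g.leviCivita x - g.leviCivita ⁅x, y⁆ -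
    κ • ((g.ricciForm y).smulRight x - (g.ricciForm x).smulRight y)

theorem LieMetric.defectEnd_apply (g : LieMetric L) (κ : ℝ) (x y z : L) :
    g.defectEnd κ x y z = g.curvatureDefect κ z x y := rfl

variable {ι : Type*} [Fintype ι] [DecidableEq ι] {g : LieMetric L} {b : Module.Basis ι ℝ L}
  {C : ι → ι → ι → ℝ} {w u : ι → ℝ} {lam : ℝ}

theorem IsFrame.ricArr_eq (h : IsFrame g b C w u 1 1)
    (hric : ∀ x y, g.ricciForm x y = lam * g.form x y) (j l : ι) :
    ricArr C w u 1 j l = if j = l then 4 * lam * w j else 0 := by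
  have h1 := h.ricciForm j l
  rw [hric, h.form] at h1
  split_ifs at h1 ⊢
  · linarith
  · linarith

theorem IsFrame.form_curvatureDefect (h : IsFrame g b C w u 1 1)
    (hric : ∀ x y, g.ricciForm x y = lam * g.form x y) (κ : ℝ) (i j l k : ι) :
    g.form (g.curvatureDefect κ (b l) (b i) (b j)) (b k) =
      1 / 4 * frameDefect C w u lam κ i j l k := by
  rw [LieMetric.curvatureDefect_apply, hric, hric, frameDefect]
  simp only [map_sub, map_smul, LinearMap.sub_apply, LinearMap.smul_apply, smul_eq_mul]
  have hf : ∀ i k, g.form (b i) (b k) = w k * if i = k then 1 else 0 := fun i k => by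
    rw [h.form, mul_boole, one_mul]
    split_ifs with hik
    · rw [hik]
    · rfl
  rw [h.form_curvature, hf, hf, hf, hf]
  ring

theorem IsFrame.mem_eigenbivectors (h : IsFrame g b C w u 1 1)
    (hric : ∀ x y, g.ricciForm x y = lam * g.form x y) {κ : ℝ} {i j p q : ι} {α β : ℝ}
    (hz : ∀ l k, α * frameDefect C w u lam κ i j l k + β * frameDefect C w u lam κ p q l k = 0) :
    α • (b i ⊗ₜ b j) + β • (b p ⊗ₜ b q) ∈ g.eigenbivectors κ := by
  rw [LieMetric.mem_eigenbivectors]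
  -- For fixed x, y the defect is linear in z, so it can be tested on the frame in both remaining
  -- slots.
  have key : α • g.defectEnd κ (b i) (b j) + β • g.defectEnd κ (b p) (b q) = 0 := by
    refine b.ext fun l => h.ext_form fun k => ?_
    simp only [LinearMap.add_apply, LinearMap.smul_apply, LieMetric.defectEnd_apply, map_add,
      map_smul, smul_eq_mul, h.form_curvatureDefect hric, LinearMap.zero_apply, map_zero]
    linear_combination 1 / 4 * hz l k
  intro z
  simpa [LieMetric.defectEnd_apply] using LinearMap.congr_fun key z

theorem IsFrame.tmul_mem_eigenbivectors (h : IsFrame g b C w u 1 1)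
    (hric : ∀ x y, g.ricciForm x y = lam * g.form x y) {κ : ℝ} {i j : ι}
    (hz : ∀ l k, frameDefect C w u lam κ i j l k = 0) : b i ⊗ₜ b j ∈ g.eigenbivectors κ := by
  have := h.mem_eigenbivectors hric (i := i) (j := j) (p := i) (q := j) (α := 1) (β := 0)
    fun l k => by rw [hz]; simp
  simpa using this

theorem IsFrame.curvature_eq (h : IsFrame g b C w u 1 1)
    (hric : ∀ x y, g.ricciForm x y = lam * g.form x y) {κ : ℝ}
    (hz : ∀ i j l k, frameDefect C w u lam κ i j l k = 0) (x y z : L) :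
    g.curvature x y z = κ • (g.ricciForm y z • x - g.ricciForm x z • y) := by
  have h1 : ∀ i j, g.defectEnd κ (b i) (b j) = 0 := fun i j =>
    b.ext fun l => h.ext_form fun k => by
      rw [LieMetric.defectEnd_apply, h.form_curvatureDefect hric, hz]; simp
  have h2 : g.curvatureDefect κ z = 0 := b.ext fun i => b.ext fun j => by
    rw [← LieMetric.defectEnd_apply, h1]; rfl
  have h3 := LinearMap.congr_fun₂ h2 x y
  exact sub_eq_zero.1 h3

end Frame

/-! ### Symmetric tensors and linear independence of bivectors. -/

section Symmetric

variable {L : Type*} [AddCommGroup L] [Module ℝ L] {ι : Type*} {b : Module.Basis ι ℝ L}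

theorem bivectorCoord_of_comm {s : L ⊗[ℝ] L} (h : TensorProduct.comm ℝ L L s = s) (p : ι × ι) :
    bivectorCoord b p s = 0 := by
  have key : bivectorCoord b p ∘ₗ (TensorProduct.comm ℝ L L).toLinearMap = -bivectorCoord b p := by
    refine TensorProduct.ext' fun x y => ?_
    simp only [LinearMap.comp_apply, LinearEquiv.coe_coe, TensorProduct.comm_tmul,
      bivectorCoord_tmul, LinearMap.neg_apply]
    ring
  have h1 := LinearMap.congr_fun key s
  rw [LinearMap.comp_apply, LinearEquiv.coe_coe, h, LinearMap.neg_apply] at h1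
  linarith

theorem bivectorCoord_basis [DecidableEq ι] (p : ι × ι) (i j : ι) :
    bivectorCoord b p (b i ⊗ₜ b j) = (if i = p.1 then 1 else 0) * (if j = p.2 then 1 else 0) -
      (if i = p.2 then 1 else 0) * (if j = p.1 then 1 else 0) := by
  rw [bivectorCoord_tmul]
  simp [Finsupp.single_apply]

/-- A space of tensors that are symmetric once one linear form vanishes on them does not contain
two linearly independent bivectors. -/
theorem false_of_two_bivectors {E : Submodule ℝ (L ⊗[ℝ] L)} {f : L ⊗[ℝ] L →ₗ[ℝ] ℝ}
    (hf : ∀ s ∈ E, f s = 0 → TensorProduct.comm ℝ L L s = s) {s t : L ⊗[ℝ] L} (hs : s ∈ E)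
    (ht : t ∈ E) {p q : ι × ι} (hsp : bivectorCoord b p s ≠ 0) (htp : bivectorCoord b p t = 0)
    (htq : bivectorCoord b q t ≠ 0) : False := by
  -- The combination f(t)s − f(s)t is killed by f, hence is symmetric. Its p-coordinate gives f(t) =
  -- 0, so t is symmetric as well, against its nonzero q-coordinate.
  have h1 := bivectorCoord_of_comm (b := b) (hf (f t • s - f s • t)
    (sub_mem (E.smul_mem _ hs) (E.smul_mem _ ht)) (by simp [mul_comm])) p
  simp only [map_sub, map_smul, htp, smul_eq_mul, mul_zero, sub_zero] at h1
  have h2 : f t = 0 := (mul_eq_zero.1 h1).resolve_right hsp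
  exact htq (bivectorCoord_of_comm (hf t ht h2) q)

end Symmetric

end EinsteinSolv

/-! ### Curvature of semidirect sums by a diagonal derivation -/

namespace EinsteinSolv

section Swap

variable {ι : Type*}

theorem rmArr_swap_right [Fintype ι] {K : Type*} [CommRing K] {C : ι → ι → ι → K}
    (hC : ∀ i j k, C i j k = -C j i k) (w u : ι → K) (W : K) (i j l k : ι) :
    rmArr C w u W i j l k = -rmArr C w u W i j k l := by
  rw [rmArr, rmArr, ← Finset.sum_neg_distrib]
  refine Finset.sum_congr rfl fun m _ => ?_
  have : gamArr C w m l k = -gamArr C w m k l := by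
    simp only [gamArr]
    rw [hC m l k, hC l k m, hC k m l]
    ring
  rw [this]
  ring

theorem semiArr_swap {c : ι → ι → ι → ℝ} (hc : ∀ i j k, c i j k = -c j i k) (δ : ι → ι → ℝ) (i j k : ι ⊕ Unit) :
    semiArr c δ i j k = -semiArr c δ j i k := by
  rcases i with i | i <;> rcases j with j | j <;> rcases k with k | k <;> simp only [semiArr, neg_zero, neg_neg]
  exact hc i j k

theorem frameDefect_swap_right [Fintype ι] [DecidableEq ι] {C : ι → ι → ι → ℝ}
    (hC : ∀ i j k, C i j k = -C j i k) (w u : ι → ℝ) (lam κ : ℝ) (i j l k : ι) :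
    frameDefect C w u lam κ i j l k = -frameDefect C w u lam κ i j k l := by
  rw [frameDefect, frameDefect, rmArr_swap_right hC]
  ring

theorem frameDefect_swap [Fintype ι] [DecidableEq ι] {C : ι → ι → ι → ℝ}
    (hC : ∀ i j k, C i j k = -C j i k) (w u : ι → ℝ) (lam κ : ℝ) (i j l k : ι) :
    frameDefect C w u lam κ i j l k = -frameDefect C w u lam κ j i l k := by
  rw [frameDefect, frameDefect, rmArr_swap hC]
  ring

end Swap

section Diagonal

variable {ι : Type*} [DecidableEq ι]

/-- A diagonal matrix, as a function. -/
def diagFun (μ : ι → ℝ) (k j : ι) : ℝ := if k = j then μ k else 0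

theorem diagFun_symm (μ : ι → ℝ) (w : ι ⊕ Unit → ℝ) (j k : ι) :
    w (.inl k) * diagFun μ k j = w (.inl j) * diagFun μ j k := by
  unfold diagFun
  by_cases h : k = j
  · rw [h]
  · simp [h, Ne.symm h]

variable [Fintype ι] {c : ι → ι → ι → ℝ} {μ : ι → ℝ} {w u : ι ⊕ Unit → ℝ}

/-- The Gauss equation: the curvature of 𝔫 plus the term given by the second fundamental form, which
is diagonal with entries w_i μ_i. -/
theorem rmArr_diagFun (i j l k : ι) :
    rmArr (semiArr c (diagFun μ)) w u 1 (.inl i) (.inl j) (.inl l) (.inl k) =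
      rmArr c (fun i => w (.inl i)) (fun i => u (.inl i)) 1 i j l k +
        4 * u (.inr ()) * (w (.inl i) * μ i * (w (.inl j) * μ j)) *
          ((if i = l then 1 else 0) * (if j = k then 1 else 0) -
            (if j = l then 1 else 0) * (if i = k then 1 else 0)) := by
  simp only [rmArr, Fintype.sum_sum_type, Finset.univ_unique, Finset.sum_singleton,
    PUnit.default_eq_unit, gamArr_semiArr_inl, gamArr_semiArr_inl_inl_inr (diagFun_symm μ w),
    gamArr_semiArr_inr (diagFun_symm μ w), semiArr, diagFun, ← mul_boole _ (μ _)]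
  ring

/-- The Codazzi equation: the normal component comes from the covariant derivative of the shape
operator along 𝔫. -/
theorem rmArr_diagFun_inr_right (hu : ∀ i, w i * u i = 1) (i j l : ι) :
    rmArr (semiArr c (diagFun μ)) w u 1 (.inl i) (.inl j) (.inl l) (.inr ()) =
      2 * gamArr c (fun i => w (.inl i)) j l i * μ i -
        2 * gamArr c (fun i => w (.inl i)) i l j * μ j - 4 * c i j l * (w (.inl l) * μ l) := by
  simp only [rmArr, Fintype.sum_sum_type, Finset.univ_unique, Finset.sum_singleton,
    PUnit.default_eq_unit, gamArr_semiArr_inl, gamArr_semiArr_inl_inl_inr (diagFun_symm μ w),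
    gamArr_semiArr_inl_inr_inl (diagFun_symm μ w), gamArr_semiArr_inl_inr_inr,
    gamArr_semiArr_inr (diagFun_symm μ w), semiArr, diagFun]
  have e : ∀ (f : ι → ℝ) (i : ι), w (.inl i) * u (.inl i) = 1 →
      ∑ m, u (.inl m) * (f m * (w (.inl i) * if i = m then μ i else 0)) = f i * μ i := by
    intro f i hi
    rw [Finset.sum_eq_single i]
    · rw [if_pos rfl]
      linear_combination f i * μ i * hi
    · intro m _ hm
      simp [Ne.symm hm]
    · simp
  have e2 : ∑ m, c i j m * (w (.inl m) * if m = l then μ m else 0) =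
      c i j l * (w (.inl l) * μ l) := by
    rw [Finset.sum_eq_single l]
    · rw [if_pos rfl]
    · intro m _ hm
      simp [hm]
    · simp
  have e3 := e (fun m => gamArr c (fun i => w (.inl i)) j l m) i (hu _)
  have e4 := e (fun m => gamArr c (fun i => w (.inl i)) i l m) j (hu _)
  have e5 : 2 * gamArr c (fun i => w (.inl i)) j l i * μ i -
      2 * gamArr c (fun i => w (.inl i)) i l j * μ j - 4 * c i j l * (w (.inl l) * μ l) =
      2 * (gamArr c (fun i => w (.inl i)) j l i * μ i) -
      2 * (gamArr c (fun i => w (.inl i)) i l j * μ j) - 4 * (c i j l * (w (.inl l) * μ l)) := by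
    ring
  rw [e5, ← e2, ← e3, ← e4, Finset.mul_sum, Finset.mul_sum, Finset.mul_sum,
    ← Finset.sum_sub_distrib, ← Finset.sum_sub_distrib]
  simp only [mul_zero, sub_zero, add_zero]
  refine Finset.sum_congr rfl fun m _ => ?_
  ring

/-- Since ∇_X = 0 and [e_i,X] = −μ_i e_i, the curvature R(e_i,X) is μ_i ∇_{e_i}. -/
theorem rmArr_diagFun_inr_left (i : ι) (l k : ι ⊕ Unit) :
    rmArr (semiArr c (diagFun μ)) w u 1 (.inl i) (.inr ()) l k =
      2 * μ i * gamArr (semiArr c (diagFun μ)) w (.inl i) l k := by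
  simp only [rmArr, Fintype.sum_sum_type, Finset.univ_unique, Finset.sum_singleton,
    PUnit.default_eq_unit, gamArr_semiArr_inr (diagFun_symm μ w), semiArr, diagFun]
  simp

end Diagonal

/-! ### Eigenbivectors of the Einstein solutions over the normal forms. -/

section Solutions

theorem stdThree_swap (a : ℝ) (i j k : Fin 3) : stdThree a i j k = -stdThree a j i k := by
  fin_cases i <;> fin_cases j <;> fin_cases k <;> simp [stdThree]

theorem stdFour_swap (a d : ℝ) (i j k : Fin 4) : stdFour a d i j k = -stdFour a d j i k := by
  fin_cases i <;> fin_cases j <;> fin_cases k <;> simp [stdFour]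

/-- It suffices to check the vanishing of a combination of defects on the ideal and on the pairs
containing the last vector once. -/
theorem frameDefect_comb_eq_zero {ι : Type*} [Fintype ι] [DecidableEq ι]
    {C : ι ⊕ Unit → ι ⊕ Unit → ι ⊕ Unit → ℝ} (hC : ∀ i j k, C i j k = -C j i k)
    {w u : ι ⊕ Unit → ℝ} {lam κ α β : ℝ} {i j p q : ι ⊕ Unit}
    (h1 : ∀ l k : ι, α * frameDefect C w u lam κ i j (.inl l) (.inl k) +
      β * frameDefect C w u lam κ p q (.inl l) (.inl k) = 0)
    (h2 : ∀ l : ι, α * frameDefect C w u lam κ i j (.inl l) (.inr ()) +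
      β * frameDefect C w u lam κ p q (.inl l) (.inr ()) = 0) (l k : ι ⊕ Unit) :
    α * frameDefect C w u lam κ i j l k + β * frameDefect C w u lam κ p q l k = 0 := by
  rcases l with l | l <;> rcases k with k | k
  · exact h1 l k
  · exact h2 l
  · rw [frameDefect_swap_right hC w u lam κ i, frameDefect_swap_right hC w u lam κ p]
    linear_combination -h2 k
  · have e1 := frameDefect_swap_right hC w u lam κ i j (.inr ()) (.inr ())
    have e2 := frameDefect_swap_right hC w u lam κ p q (.inr ()) (.inr ())
    linear_combination 1 / 2 * α * e1 + 1 / 2 * β * e2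

theorem frameDefect_eq_zero {ι : Type*} [Fintype ι] [DecidableEq ι]
    {C : ι ⊕ Unit → ι ⊕ Unit → ι ⊕ Unit → ℝ} (hC : ∀ i j k, C i j k = -C j i k)
    {w u : ι ⊕ Unit → ℝ} {lam κ : ℝ} {i j : ι ⊕ Unit}
    (h1 : ∀ l k : ι, frameDefect C w u lam κ i j (.inl l) (.inl k) = 0)
    (h2 : ∀ l : ι, frameDefect C w u lam κ i j (.inl l) (.inr ()) = 0) (l k : ι ⊕ Unit) :
    frameDefect C w u lam κ i j l k = 0 := by
  have := frameDefect_comb_eq_zero hC (w := w) (u := u) (lam := lam) (κ := κ) (α := 1) (β := 0)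
    (i := i) (j := j) (p := i) (q := j) (by simpa using h1) (by simpa using h2) l k
  simpa using this

/-- The curvature of real hyperbolic type. -/
theorem frameDefect_scalar {ι : Type*} [Fintype ι] [DecidableEq ι] {w u : ι ⊕ Unit → ℝ}
    (hu : ∀ i, w i * u i = 1) {x lam κ : ℝ} (hlam : κ * lam = -x ^ 2 * u (.inr ()))
    (i j l k : ι ⊕ Unit) :
    frameDefect (semiArr (fun _ _ _ => 0) (diagFun fun _ => x)) w u lam κ i j l k = 0 := by
  have hC := semiArr_swap (c := fun _ _ _ : ι => (0 : ℝ)) (by simp) (diagFun fun _ => x)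
  have key : ∀ i j l k, frameDefect (semiArr (fun _ _ _ => 0) (diagFun fun _ => x)) w u lam κ
      (.inl i) j l k = 0 := by
    intro i j
    rcases j with j | j
    · refine frameDefect_eq_zero hC (fun l k => ?_) (fun l => ?_)
      · rw [frameDefect, rmArr_diagFun]
        have : rmArr (fun _ _ _ : ι => (0 : ℝ)) (fun i => w (.inl i)) (fun i => u (.inl i)) 1
            i j l k = 0 := by simp [rmArr, gamArr]
        rw [this]
        have f1 : w (.inl l) * w (.inl k) * ((if i = l then 1 else 0) * (if j = k then 1 else 0)) =
            w (.inl i) * w (.inl j) * ((if i = l then 1 else 0) * (if j = k then 1 else 0)) := by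
          by_cases h1 : i = l <;> by_cases h2 : j = k <;> simp [h1, h2]
        have f2 : w (.inl l) * w (.inl k) * ((if j = l then 1 else 0) * (if i = k then 1 else 0)) =
            w (.inl i) * w (.inl j) * ((if j = l then 1 else 0) * (if i = k then 1 else 0)) := by
          by_cases h1 : j = l <;> by_cases h2 : i = k <;> simp [h1, h2, mul_comm]
        simp only [Sum.inl.injEq]
        linear_combination 4 * w (.inl i) * w (.inl j) *
          ((if i = l then 1 else 0) * (if j = k then 1 else 0) -
            (if j = l then 1 else 0) * (if i = k then 1 else 0)) * hlam +
          4 * κ * lam * (f1 - f2)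
      · rw [frameDefect, rmArr_diagFun_inr_right hu]
        simp [gamArr]
    · refine frameDefect_eq_zero hC (fun l k => ?_) (fun l => ?_)
      · rw [frameDefect, rmArr_diagFun_inr_left, gamArr_semiArr_inl]
        simp [gamArr]
      · rw [frameDefect, rmArr_diagFun_inr_left, gamArr_semiArr_inl_inl_inr (diagFun_symm _ w)]
        by_cases h1 : i = l
        · subst h1
          simp [diagFun]
          linear_combination 4 * w (.inl i) * w (.inr ()) * hlam -
            4 * w (.inl i) * x ^ 2 * hu (.inr ())
        · simp [diagFun, h1]
  rcases i with i | i
  · exact key i j l k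
  · rcases j with j | j
    · rw [frameDefect_swap hC, key, neg_zero]
    · have := frameDefect_swap hC w u lam κ (.inr ()) (.inr ()) l k
      change frameDefect _ w u lam κ (.inr ()) (.inr ()) l k = 0
      linarith

/-- The vector e₄ spans a flat factor of the ideal, so the curvature on e₁∧e₄ and e₂∧e₄ is governed
by the products 2·3 = 6 of eigenvalues. The trace of δ² is 4 + 4 + 16 + 9 = 33, and the ratio is
6/33 = 2/11. -/
theorem frameDefect_four {w u : Fin 4 ⊕ Unit → ℝ} (hu : ∀ i, w i * u i = 1) {lam x a : ℝ}
    (hlam : lam = -33 * x ^ 2 * u (.inr ())) (l k : Fin 4 ⊕ Unit) :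
    frameDefect (semiArr (stdFour a 0) (diagFun ![2 * x, 2 * x, 4 * x, 3 * x])) w u lam (2 / 11)
      (.inl 0) (.inl 3) l k = 0 ∧
    frameDefect (semiArr (stdFour a 0) (diagFun ![2 * x, 2 * x, 4 * x, 3 * x])) w u lam (2 / 11)
      (.inl 1) (.inl 3) l k = 0 := by
  have hC := semiArr_swap (stdFour_swap a 0) (diagFun ![2 * x, 2 * x, 4 * x, 3 * x])
  constructor <;> revert l k <;> refine frameDefect_eq_zero hC (fun l k => ?_) (fun l => ?_)
  · rw [frameDefect, rmArr_diagFun, hlam]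
    fin_cases l <;> fin_cases k <;> simp [rmArr, gamArr, stdFour] <;> ring
  · rw [frameDefect, rmArr_diagFun_inr_right hu]
    fin_cases l <;> simp [gamArr, stdFour]
  · rw [frameDefect, rmArr_diagFun, hlam]
    fin_cases l <;> fin_cases k <;> simp [rmArr, gamArr, stdFour] <;> ring
  · rw [frameDefect, rmArr_diagFun_inr_right hu]
    fin_cases l <;> simp [gamArr, stdFour]

/-- On the ideal, ∇ along e₂ and along e₄ acts only on the plane of e₁, e₃, by multiples of the same
skew map, so R(e₂,e₄) vanishes there. The second fundamental form contributes 2·4 = 8, and the trace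
of δ² is 1 + 4 + 9 + 16 = 30, whence 8/30 = 4/15. -/
theorem frameDefect_four_filiform {w u : Fin 4 ⊕ Unit → ℝ} (hu : ∀ i, w i * u i = 1)
    {lam x a d : ℝ} (hlam : lam = -30 * x ^ 2 * u (.inr ())) 
    (l k : Fin 4 ⊕ Unit) :
    frameDefect (semiArr (stdFour a d) (diagFun ![x, 2 * x, 3 * x, 4 * x])) w u lam (4 / 15)
      (.inl 1) (.inl 3) l k = 0 := by
  have hC := semiArr_swap (stdFour_swap a d) (diagFun ![x, 2 * x, 3 * x, 4 * x])
  revert l k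
  refine frameDefect_eq_zero hC (fun l k => ?_) (fun l => ?_)
  · rw [frameDefect, rmArr_diagFun, hlam]
    fin_cases l <;> fin_cases k <;> simp [rmArr, gamArr, stdFour, Fin.sum_univ_four] <;>
      first | ring1 | (right; ring1)
  · rw [frameDefect, rmArr_diagFun_inr_right hu]
    fin_cases l <;> simp [gamArr, stdFour]

/-- This is the complex hyperbolic plane or an indefinite analogue, whose curvature operator has a
two-dimensional kernel. The two combinations of e₁∧e₃, e₂∧e₀ and of e₂∧e₃, e₁∧e₀ span it; `hP` is
the relation imposed by the Einstein equation. -/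
theorem frameDefect_three {w u : Fin 3 ⊕ Unit → ℝ} (hu : ∀ i, w i * u i = 1)
    {lam x a : ℝ} 
    (hP : a ^ 2 * w (.inl 2) = 4 * x ^ 2 * u (.inr ()) * w (.inl 0) * w (.inl 1))
    (l k : Fin 3 ⊕ Unit) :
    2 * x * w (.inl 1) * frameDefect (semiArr (stdThree a) (diagFun ![x, x, 2 * x])) w u lam 0
      (.inl 0) (.inl 2) l k + a * w (.inl 2) *
      frameDefect (semiArr (stdThree a) (diagFun ![x, x, 2 * x])) w u lam 0
      (.inl 1) (.inr ()) l k = 0 ∧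
    2 * x * w (.inl 0) * frameDefect (semiArr (stdThree a) (diagFun ![x, x, 2 * x])) w u lam 0
      (.inl 1) (.inl 2) l k + -a * w (.inl 2) *
      frameDefect (semiArr (stdThree a) (diagFun ![x, x, 2 * x])) w u lam 0
      (.inl 0) (.inr ()) l k = 0 := by
  have hC := semiArr_swap (stdThree_swap a) (diagFun ![x, x, 2 * x])
  constructor <;> revert l k <;> refine frameDefect_comb_eq_zero hC (fun l k => ?_) (fun l => ?_)
  · simp only [frameDefect, rmArr_diagFun, rmArr_diagFun_inr_left, gamArr_semiArr_inl]
    fin_cases l <;> fin_cases k <;> simp [rmArr, gamArr, stdThree, Fin.sum_univ_three]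
    · linear_combination -4 * x * w (.inl 2) * hP - 2 * x * a ^ 2 * w (.inl 2) ^ 2 * hu (.inl 1)
    · linear_combination 4 * x * w (.inl 2) * hP + 2 * x * a ^ 2 * w (.inl 2) ^ 2 * hu (.inl 1)
  · simp only [frameDefect, rmArr_diagFun_inr_right hu, rmArr_diagFun_inr_left,
      gamArr_semiArr_inl_inl_inr (diagFun_symm _ w)]
    fin_cases l <;> simp [gamArr, stdThree, diagFun]
    ring
  · simp only [frameDefect, rmArr_diagFun, rmArr_diagFun_inr_left, gamArr_semiArr_inl]
    fin_cases l <;> fin_cases k <;> simp [rmArr, gamArr, stdThree, Fin.sum_univ_three]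
    · linear_combination -4 * x * w (.inl 2) * hP - 2 * x * a ^ 2 * w (.inl 2) ^ 2 * hu (.inl 0)
    · linear_combination 4 * x * w (.inl 2) * hP + 2 * x * a ^ 2 * w (.inl 2) ^ 2 * hu (.inl 0)
  · simp only [frameDefect, rmArr_diagFun_inr_right hu, rmArr_diagFun_inr_left,
      gamArr_semiArr_inl_inl_inr (diagFun_symm _ w)]
    fin_cases l <;> simp [gamArr, stdThree, diagFun]
    ring

end Solutions

end EinsteinSolv

/-! ### Einstein metrics of pseudo-Iwasawa type do not have generic curvature -/

namespace EinsteinSolv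

open TensorProduct

section Solve

variable {L : Type*} [LieRing L] [LieAlgebra ℝ L] [FiniteDimensional ℝ L] {g : LieMetric L}
  {lam : ℝ}

/-- The Ricci form of 𝔫 is diagonal in a normal form, so the off-diagonal Einstein equations say
that (tr δ)δ is diagonal; the trace is nonzero. -/
theorem eq_diagFun {ι : Type*} [DecidableEq ι] {δ : ι → ι → ℝ} {t : ℝ} {w : ι ⊕ Unit → ℝ}
    (ht : t ≠ 0) (hw : ∀ i, w i ≠ 0) (h : ∀ j l, j ≠ l → t * (w (.inl j) * δ j l) = 0) :
    δ = diagFun fun i => δ i i := by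
  funext k j
  by_cases hkj : k = j
  · simp [diagFun, hkj]
  · have h1 := (mul_eq_zero.1 (h k j hkj)).resolve_left ht
    have h2 := (mul_eq_zero.1 h1).resolve_left (hw _)
    simp [diagFun, hkj, h2]

theorem HasGenericCurvature.false_of_scalar {n : ℕ} (hg : HasGenericCurvature n g) {ι : Type*}
    [Fintype ι] [DecidableEq ι] {b : Module.Basis (ι ⊕ Unit) ℝ L} {w u : ι ⊕ Unit → ℝ} {x : ℝ}
    (h : IsFrame g b (semiArr (fun _ _ _ => 0) (diagFun fun _ => x)) w u 1 1)
    (hric : ∀ x y, g.ricciForm x y = lam * g.form x y)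
    (hlam : (1 / n : ℝ) * lam = -x ^ 2 * u (.inr ())) : False := by
  obtain ⟨x, y, z, hxyz⟩ := hg.not_constant
  exact hxyz (h.curvature_eq hric (frameDefect_scalar h.mul_eq hlam) x y z)

/-- The diagonal Einstein equations together with the derivation rule determine the eigenvalues of δ
up to scale: all equal if a = 0, proportional to (1,1,2) otherwise. -/
theorem HasGenericCurvature.false_of_stdThree (hg : HasGenericCurvature 3 g)
    {b : Module.Basis (Fin 3 ⊕ Unit) ℝ L} {a : ℝ} {δ : Fin 3 → Fin 3 → ℝ}
    {w u : Fin 3 ⊕ Unit → ℝ} (h : IsFrame g b (semiArr (stdThree a) δ) w u 1 1)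
    (hric : ∀ x y, g.ricciForm x y = lam * g.form x y) (hlam : lam ≠ 0)
    (hδ : ∀ j k, w (.inl k) * δ k j = w (.inl j) * δ j k)
    (hder : ∀ i j k, ∑ l, stdThree a i j l * δ k l =
      ∑ l, δ l i * stdThree a l j k + ∑ l, δ l j * stdThree a i l k) : False := by
  have hu := h.mul_eq
  have hw := h.w_ne
  set t := u (.inr ()) * ∑ i, δ i i with ht_def
  set P := a ^ 2 * w (.inl 2) * u (.inl 0) * u (.inl 1) / 2 with hP
  have hinl : ∀ j l, (if j = l then 4 * P * ![-1, -1, 1] j * w (.inl j) else 0) -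
      4 * t * (w (.inl j) * δ j l) = if j = l then 4 * lam * w (.inl j) else 0 := by
    intro j l
    have h1 := h.ricArr_eq hric (.inl j) (.inl l)
    rw [ricArr_semiArr_inl hδ hu, ricArr_stdThree fun i => hu (.inl i)] at h1
    simp only [Sum.inl.injEq] at h1
    rw [← h1, ht_def]
    ring
  have hdiag : ∀ j, P * ![-1, -1, 1] j - t * δ j j = lam := by
    intro j
    have h1 := hinl j j
    rw [if_pos rfl, if_pos rfl] at h1
    have h2 : (4 * w (.inl j)) ≠ 0 := mul_ne_zero four_ne_zero (hw _)
    refine mul_left_cancel₀ h2 ?_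
    linear_combination h1
  have h0 := hdiag 0
  have h1 := hdiag 1
  have h2 := hdiag 2
  simp at h0 h1 h2
  -- If t = 0 the first and third equations read −P = λ = P, against λ ≠ 0.
  have ht : t ≠ 0 := by
    intro ht
    rw [ht] at h0 h1 h2
    exact hlam (by linarith)
  have hδd : δ = diagFun fun i => δ i i := eq_diagFun ht hw fun j l hjl => by
    have := hinl j l
    rw [if_neg hjl, if_neg hjl] at this
    linarith
  have hrr := h.ricArr_eq hric (.inr ()) (.inr ())
  rw [ricArr_semiArr_inr hδ hu, if_pos rfl] at hrr
  have hder' := hder 0 1 2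
  generalize hμ : (fun i => δ i i) = μ at hδd
  have hμi : ∀ i, δ i i = μ i := fun i => congrFun hμ i
  simp only [hμi] at h0 h1 h2
  have htτ : t = u (.inr ()) * (μ 0 + μ 1 + μ 2) := by
    rw [ht_def, Fin.sum_univ_three, hμi, hμi, hμi]
  rw [hδd] at hrr hder'
  simp [diagFun, Fin.sum_univ_three, stdThree] at hrr hder'
  -- The equation in the direction of X expresses λ by the trace of δ².
  have hlam' : lam = -(μ 0 * μ 0 + μ 1 * μ 1 + μ 2 * μ 2) * u (.inr ()) := by
    linear_combination -lam * hu (.inr ()) - 1 / 4 * u (.inr ()) * hrr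
  by_cases ha : a = 0
  · have hP0 : P = 0 := by rw [hP, ha]; ring
    have e1 : μ 1 = μ 0 := mul_left_cancel₀ ht (by linarith)
    have e2 : μ 2 = μ 0 := mul_left_cancel₀ ht (by linarith)
    have hμ' : μ = fun _ => μ 0 := by
      funext i; fin_cases i <;> simp [e1, e2]
    have hc : stdThree a = fun _ _ _ => 0 := by
      funext i j k; simp [stdThree, ha]
    rw [hδd, hμ', hc] at h
    refine hg.false_of_scalar h hric ?_
    rw [hlam', e1, e2]
    push_cast
    ring
  -- δ is a derivation and a ≠ 0, so the eigenvalue on e₃ is the sum of the first two, which are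
  -- equal by the first two Einstein equations.
  · have e0 : μ 2 = μ 0 + μ 1 := mul_left_cancel₀ ha (by linarith)
    have e1 : μ 1 = μ 0 := mul_left_cancel₀ ht (by linarith)
    have e2 : μ 2 = 2 * μ 0 := by rw [e0, e1]; ring
    have hx : μ 0 ≠ 0 := by
      intro hx
      rw [e2, hx] at h2
      rw [hx] at h0
      exact hlam (by linarith)
    have hμ' : μ = ![μ 0, μ 0, 2 * μ 0] := by
      funext i; fin_cases i <;> simp [e1, e2]
    have hPx : a ^ 2 * w (.inl 2) = 4 * μ 0 ^ 2 * u (.inr ()) * w (.inl 0) * w (.inl 1) := by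
      have e3 : 2 * P = 4 * μ 0 ^ 2 * u (.inr ()) := by
        rw [e2, htτ, e1, e2] at h2
        rw [htτ, e1, e2] at h0
        linarith
      have e4 : 2 * P * (w (.inl 0) * w (.inl 1)) = a ^ 2 * w (.inl 2) := by
        rw [hP]
        linear_combination a ^ 2 * w (.inl 2) * hu (.inl 0) * (w (.inl 1) * u (.inl 1)) +
          a ^ 2 * w (.inl 2) * hu (.inl 1)
      rw [← e4, e3]
      ring
    rw [hδd, hμ'] at h
    obtain ⟨f, hf⟩ := hg.three rfl
    refine false_of_two_bivectors (b := b) hf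
      (h.mem_eigenbivectors hric fun l k => (frameDefect_three hu hPx l k).1)
      (h.mem_eigenbivectors hric fun l k => (frameDefect_three hu hPx l k).2)
      (p := (.inl 0, .inl 2)) (q := (.inl 1, .inl 2)) ?_ ?_ ?_ <;>
      simp [bivectorCoord_basis, hx, hw]

/-- The same scheme with two brackets. The Einstein equations and the derivation rule leave three
spectra, one each for the abelian algebra, Heisenberg plus a line and the filiform algebra. -/
theorem HasGenericCurvature.false_of_stdFour (hg : HasGenericCurvature 4 g)
    {b : Module.Basis (Fin 4 ⊕ Unit) ℝ L} {a d : ℝ} (had : a = 0 → d = 0) {δ : Fin 4 → Fin 4 → ℝ}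
    {w u : Fin 4 ⊕ Unit → ℝ} (h : IsFrame g b (semiArr (stdFour a d) δ) w u 1 1)
    (hric : ∀ x y, g.ricciForm x y = lam * g.form x y) (hlam : lam ≠ 0)
    (hδ : ∀ j k, w (.inl k) * δ k j = w (.inl j) * δ j k)
    (hder : ∀ i j k, ∑ l, stdFour a d i j l * δ k l =
      ∑ l, δ l i * stdFour a d l j k + ∑ l, δ l j * stdFour a d i l k) : False := by
  have hu := h.mul_eq
  have hw := h.w_ne
  set t := u (.inr ()) * ∑ i, δ i i with ht_def
  set P := a ^ 2 * w (.inl 2) * u (.inl 0) * u (.inl 1) / 2 with hP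
  set Q := d ^ 2 * w (.inl 3) * u (.inl 0) * u (.inl 2) / 2 with hQ
  have hinl : ∀ j l, (if j = l then
      4 * (P * ![-1, -1, 1, 0] j + Q * ![-1, 0, -1, 1] j) * w (.inl j) else 0) -
      4 * t * (w (.inl j) * δ j l) = if j = l then 4 * lam * w (.inl j) else 0 := by
    intro j l
    have h1 := h.ricArr_eq hric (.inl j) (.inl l)
    rw [ricArr_semiArr_inl hδ hu, ricArr_stdFour fun i => hu (.inl i)] at h1
    simp only [Sum.inl.injEq] at h1
    rw [← h1, ht_def]
    ring
  have hdiag : ∀ j, P * ![-1, -1, 1, 0] j + Q * ![-1, 0, -1, 1] j - t * δ j j = lam := by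
    intro j
    have h1 := hinl j j
    rw [if_pos rfl, if_pos rfl] at h1
    have h2 : (4 * w (.inl j)) ≠ 0 := mul_ne_zero four_ne_zero (hw _)
    refine mul_left_cancel₀ h2 ?_
    linear_combination h1
  have h0 := hdiag 0
  have h1 := hdiag 1
  have h2 := hdiag 2
  have h3 := hdiag 3
  simp at h0 h1 h2 h3
  have ht : t ≠ 0 := by
    intro ht
    rw [ht] at h0 h1 h2 h3
    exact hlam (by linarith)
  have hδd : δ = diagFun fun i => δ i i := eq_diagFun ht hw fun j l hjl => by
    have := hinl j l
    rw [if_neg hjl, if_neg hjl] at this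
    linarith
  have hrr := h.ricArr_eq hric (.inr ()) (.inr ())
  rw [ricArr_semiArr_inr hδ hu, if_pos rfl] at hrr
  have hder1 := hder 0 1 2
  have hder2 := hder 0 2 3
  generalize hμ : (fun i => δ i i) = μ at hδd
  have hμi : ∀ i, δ i i = μ i := fun i => congrFun hμ i
  simp only [hμi] at h0 h1 h2 h3
  rw [hδd] at hrr hder1 hder2
  simp [diagFun, Fin.sum_univ_four, stdFour] at hrr hder1 hder2
  have hlam' : lam = -(μ 0 * μ 0 + μ 1 * μ 1 + μ 2 * μ 2 + μ 3 * μ 3) * u (.inr ()) := by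
    linear_combination -lam * hu (.inr ()) - 1 / 4 * u (.inr ()) * hrr
  by_cases ha : a = 0
  · have hP0 : P = 0 := by rw [hP, ha]; ring
    have hQ0 : Q = 0 := by rw [hQ, had ha]; ring
    have e1 : μ 1 = μ 0 := mul_left_cancel₀ ht (by linarith)
    have e2 : μ 2 = μ 0 := mul_left_cancel₀ ht (by linarith)
    have e3 : μ 3 = μ 0 := mul_left_cancel₀ ht (by linarith)
    have hμ' : μ = fun _ => μ 0 := by
      funext i; fin_cases i <;> simp [e1, e2, e3]
    have hc : stdFour a d = fun _ _ _ => 0 := by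
      funext i j k; simp [stdFour, ha, had ha]
    rw [hδd, hμ', hc] at h
    refine hg.false_of_scalar h hric ?_
    rw [hlam', e1, e2, e3]
    push_cast
    ring
  have e0 : μ 2 = μ 0 + μ 1 := mul_left_cancel₀ ha (by linarith)
  have e0' : t * μ 2 = t * μ 0 + t * μ 1 := by rw [e0]; ring
  by_cases hd : d = 0
  · have hQ0 : Q = 0 := by rw [hQ, hd]; ring
    have e1 : μ 1 = μ 0 := mul_left_cancel₀ ht (by linarith)
    have e2 : μ 2 = 2 * μ 0 := by rw [e0, e1]; ring
    -- Adding the equations for e₁ and e₃ cancels P, so the eigenvalue on e₄ is the mean of those on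
    -- e₁ and e₃. Halving μ₀ then makes the spectrum integral.
    have e3 : μ 3 = 3 / 2 * μ 0 := mul_left_cancel₀ ht (by linarith)
    have hμ' : μ = ![2 * (μ 0 / 2), 2 * (μ 0 / 2), 4 * (μ 0 / 2), 3 * (μ 0 / 2)] := by
      funext i; fin_cases i <;> simp [e1, e2, e3] <;> ring
    have hl : lam = -33 * (μ 0 / 2) ^ 2 * u (.inr ()) := by
      rw [hlam', e1, e2, e3]; ring
    rw [hδd, hμ', hd] at h
    obtain ⟨f, hf⟩ := (hg.four rfl).2
    refine false_of_two_bivectors (b := b) hf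
      (h.tmul_mem_eigenbivectors hric fun l k => (frameDefect_four hu hl l k).1)
      (h.tmul_mem_eigenbivectors hric fun l k => (frameDefect_four hu hl l k).2)
      (p := (.inl 0, .inl 3)) (q := (.inl 1, .inl 3)) ?_ ?_ ?_ <;>
      simp [bivectorCoord_basis]
  · have e4 : μ 3 = μ 0 + μ 2 := mul_left_cancel₀ hd (by linarith)
    have e4' : t * μ 3 = t * μ 0 + t * μ 2 := by rw [e4]; ring
    -- With both derivation rules, the differences of the Einstein equations give Q = t(μ₁ − μ₀), 2P
    -- = tμ₁ and P + Q = 2tμ₀; eliminating P and Q yields the ratio.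
    have e1 : μ 1 = 2 * μ 0 := mul_left_cancel₀ ht (by linarith)
    have e2 : μ 2 = 3 * μ 0 := by rw [e0, e1]; ring
    have e3 : μ 3 = 4 * μ 0 := by rw [e4, e2]; ring
    have hμ' : μ = ![μ 0, 2 * μ 0, 3 * μ 0, 4 * μ 0] := by
      funext i; fin_cases i <;> simp [e1, e2, e3]
    have hl : lam = -30 * μ 0 ^ 2 * u (.inr ()) := by
      rw [hlam', e1, e2, e3]; ring
    rw [hδd, hμ'] at h
    have := bivectorCoord_of_comm (b := b) ((hg.four rfl).1 _
      (h.tmul_mem_eigenbivectors hric fun l k => frameDefect_four_filiform hu hl l k))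
      (.inl 1, .inl 3)
    simp [bivectorCoord_basis] at this

end Solve

end EinsteinSolv

/-! ### Conclusion: pseudo-Iwasawa extensions never have generic curvature, while the rows of the
table do. -/

namespace EinsteinSolv

theorem structureConstant_reindex {N : Type*} [LieRing N] [LieAlgebra ℝ N] {ι : Type*}
    (e : Module.Basis ι ℝ N) (σ : Equiv.Perm ι) (i j k : ι) :
    structureConstant (e.reindex σ.symm) i j k = structureConstant e (σ i) (σ j) (σ k) := by
  simp [structureConstant]

/-- The normal form of the structure constants in a nice basis, up to reordering. -/
theorem IsNiceBasis.exists_stdThree {N : Type*} [LieRing N] [LieAlgebra ℝ N]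
    [LieRing.IsNilpotent N] {e : Module.Basis (Fin 3) ℝ N} (he : IsNiceBasis e) :
    ∃ (σ : Equiv.Perm (Fin 3)) (a : ℝ), structureConstant (e.reindex σ.symm) = stdThree a := by
  obtain ⟨σ, hσ⟩ := he.exists_perm
  refine ⟨σ, _, funext fun i => funext fun j => funext fun k =>
    eq_stdThree (structureConstant_swap _) (fun i j k h => ?_) i j k⟩
  rw [structureConstant_reindex] at h
  exact hσ i j k h

/-- The normal form of the structure constants in a nice basis, up to reordering. -/
theorem IsNiceBasis.exists_stdFour {N : Type*} [LieRing N] [LieAlgebra ℝ N]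
    [LieRing.IsNilpotent N] {e : Module.Basis (Fin 4) ℝ N} (he : IsNiceBasis e) :
    ∃ (σ : Equiv.Perm (Fin 4)) (a d : ℝ), (a = 0 → d = 0) ∧
      structureConstant (e.reindex σ.symm) = stdFour a d := by
  obtain ⟨σ, hσ⟩ := he.exists_perm
  obtain ⟨τ, a, d, had, h⟩ := exists_perm_stdFour
    (C := fun i j k => structureConstant e (σ i) (σ j) (σ k))
    (fun i j k => structureConstant_swap _ _ _ _) hσ
    (fun i j k l h h' => σ.injective (he.eq_of_ne_zero h h'))
    (fun i j k l h h' => σ.injective (he.eq_of_ne_zero' h h'))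
  refine ⟨σ * τ, a, d, had, funext fun i => funext fun j => funext fun k => ?_⟩
  rw [structureConstant_reindex]
  exact h i j k

theorem not_hasGenericCurvature {L : Type*} [LieRing L] [LieAlgebra ℝ L] [FiniteDimensional ℝ L]
    {g : LieMetric L} (h : IsEinsteinPseudoIwasawaOverNice g) {n : ℕ} (hn : n = 3 ∨ n = 4) :
    ¬ HasGenericCurvature n g := by
  intro hg
  obtain ⟨⟨lam, hE⟩, N, a, hd, ha, gn, hgn, -, m, e, hnice, horth⟩ := h
  have hric : ∀ x y, g.ricciForm x y = lam * g.form x y := fun x y => by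
    rw [← g.form_ricci, hE, map_smul, LinearMap.smul_apply, smul_eq_mul]
  have hlam : lam ≠ 0 := by
    rintro rfl
    exact hg.ricciForm_ne (LinearMap.ext fun x => LinearMap.ext fun y => by rw [hric]; simp)
  obtain ⟨X, hX, hXX, hspan⟩ := hd.exists_spanning ha hlam hric hg.degenerate
  -- With 𝔞 a line, the total dimension n + 1 leaves exactly n for the ideal, so the nice basis has
  -- 3 or 4 elements.
  have hm : m = n := by
    obtain ⟨b, -⟩ := hd.exists_basis hX hXX hspan e
    have h1 := Module.finrank_eq_card_basis b
    rw [hg.finrank] at h1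
    simpa using h1.symm
  subst hm
  have : LieRing.IsNilpotent N := hd.nilpotent
  have horth' : ∀ (σ : Equiv.Perm (Fin m)) (i j : Fin m), i ≠ j →
      g.form (e.reindex σ.symm i) (e.reindex σ.symm j) = 0 := fun σ i j hij => by
    rw [← hgn]
    simpa using horth.1 _ _ (σ.injective.ne hij)
  have hne : ∀ (σ : Equiv.Perm (Fin m)) (i : Fin m),
      g.form (e.reindex σ.symm i) (e.reindex σ.symm i) ≠ 0 := fun σ i => by
    rw [← hgn]
    rcases horth.2 (σ i) with h1 | h1 <;> simp [h1]
  rcases hn with rfl | rfl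
  · obtain ⟨σ, a, hσ⟩ := hnice.exists_stdThree
    obtain ⟨b, hb, hbX⟩ := hd.exists_basis hX hXX hspan (e.reindex σ.symm)
    obtain ⟨δ, hf, hδ, hder⟩ := hd.exists_isFrame hX hXX (horth' σ) (hne σ) hb hbX
    rw [hσ] at hf
    simp only [hσ] at hder
    simp only [← hb] at hδ
    exact hg.false_of_stdThree hf hric hlam hδ hder
  · obtain ⟨σ, a, d, had, hσ⟩ := hnice.exists_stdFour
    obtain ⟨b, hb, hbX⟩ := hd.exists_basis hX hXX hspan (e.reindex σ.symm)
    obtain ⟨δ, hf, hδ, hder⟩ := hd.exists_isFrame hX hXX (horth' σ) (hne σ) hb hbX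
    rw [hσ] at hf
    simp only [hσ] at hder
    simp only [← hb] at hδ
    exact hg.false_of_stdFour had hf hric hlam hδ hder

theorem isEinstein_and_hasGenericCurvature {r : TableRow} (hr : r ∈ table) {S : Finset ℕ}
    (hS : S ∈ r.signatures) : (r.metric S).IsEinstein ∧
      ∃ n, (n = 3 ∨ n = 4) ∧ HasGenericCurvature n (r.metric S) := by
  simp only [table, List.mem_cons, List.not_mem_nil, or_false] at hr
  rcases hr with rfl | rfl | rfl | rfl | rfl | rfl | rfl | rfl | rfl
  · exact ⟨describes_row31.isEinstein (ric_model31 S hS), 3, .inl rfl, generic_row31 S hS⟩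
  · exact ⟨describes_row3.isEinstein (ric_model3 S hS), 3, .inl rfl, generic_row3 S hS⟩
  · exact ⟨describes_row421.isEinstein (ric_model421 S hS), 4, .inr rfl, generic_row421 S hS⟩
  · exact ⟨describes_row41a.isEinstein (ric_model41a S hS), 4, .inr rfl, generic_row41a S hS⟩
  · exact ⟨describes_row41b.isEinstein (ric_model41b S hS), 4, .inr rfl, generic_row41b S hS⟩
  · exact ⟨describes_row41c.isEinstein (ric_model41c S hS), 4, .inr rfl, generic_row41c S hS⟩
  · exact ⟨describes_row41d.isEinstein (ric_model41d S hS), 4, .inr rfl, generic_row41d S hS⟩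
  · exact ⟨describes_row4a.isEinstein (ric_model4a S hS), 4, .inr rfl, generic_row4a S hS⟩
  · exact ⟨describes_row4b.isEinstein (ric_model4b S hS), 4, .inr rfl, generic_row4b S hS⟩

end EinsteinSolv

theorem mainTheorem5 (r : TableRow) (hr : r ∈ table) (S : Finset ℕ) (hS : S ∈ r.signatures) :
    (r.metric S).IsEinstein ∧
    ∀ {m : ℕ} {G : Type*} [TopologicalSpace G] [ChartedSpace (EuclideanSpace ℝ (Fin m)) G]
      [Group G] [LieGroup (𝓡 m) ∞ G] (γ : MetricField m G),
      IsLeftInvariantMetricOf γ (r.metric S) →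
    ∀ {L : Type*} [LieRing L] [LieAlgebra ℝ L] [FiniteDimensional ℝ L] (g' : LieMetric L),
      IsEinsteinPseudoIwasawaOverNice g' →
    ∀ {m' : ℕ} {G' : Type*} [TopologicalSpace G'] [ChartedSpace (EuclideanSpace ℝ (Fin m')) G']
      [Group G'] [LieGroup (𝓡 m') ∞ G'] (γ' : MetricField m' G'),
      IsLeftInvariantMetricOf γ' g' →
      ¬ IsometricUpToRescaling γ γ' := by
  obtain ⟨hE, n, hn, hgen⟩ := isEinstein_and_hasGenericCurvature hr hS
  refine ⟨hE, ?_⟩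
  intro m G _ _ _ _ γ hγ L _ _ _ g' hg' m' G' _ _ _ _ γ' hγ' hiso
  -- Generic curvature is transported along A to the pseudo-Iwasawa side, where it is impossible.
  obtain ⟨A, hA⟩ := exists_linearEquiv_curvature hγ hγ' hiso
  exact not_hasGenericCurvature hg' hn (hgen.of_equiv A hA)
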